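/- Let $u,v$ be odd positive integers with $v>2u$, let $\mathcal O=\mathbb C[[z]]$, and let $R=\mathbb C[[z^4,z^{2u}+z^v]]\subset\mathcal O$ be the ring of all power series in $z^4$ and $z^{2u}+z^v$. Let $\nu$ be the $z$-adic valuation, $\Gamma=\nu(R\setminus 0)$, $G=\mathbb Z_{\ge 0}\setminus\Gamma$ the set of gaps, and $\delta=|G|$. An $R$-submodule $M\subset\mathcal O$ is *standard* if $0\in\Delta_M:=\nu(M\setminus 0)$; put $D_M=G\cap\Delta_M$. A set $D$ is an *admissible $D$-set* if $D=D_M$ for some standard $M$. A *$D$-flag* of length $m\ge 0$ consists of a set $D_0\subset G$ and elements $g_1<\dots<g_m$ of $G\setminus D_0$ such that for $D_i=D_0\cup\{g_1,\dots,g_i\}$ all the sets $\Gamma\cup D_i$ $(0\le i\le m)$ are standard $\Gamma$-modules, i.e. contain $0$ and are stable under adding elements of $\Gamma$. Its *flagged cell* $J^m_R[\mathcal D]$ is the set of all flags $M_0\subset M_1\subset\dots\subset M_m$ of standard submodules with $D_{M_i}=D_i$ for $0\le i\le m$, and $\mathcal D$ is *admissible* if this set is non-empty. Since every standard $M$ contains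 $z^{2\delta}\mathcal O$ and $\dim M/z^{2\delta}\mathcal O=\delta+|D_M|$, the set $J^m_R[\mathcal D]$ lies in the product of the Grassmannians $\mathrm{Gr}(\mathcal O/z^{2\delta}\mathcal O,\ \delta+|D_i|)$, $0\le i\le m$, and it carries the resulting (reduced) structure of a variety. Write $J_R[D]$ for the case $m=0$, $D_0=D$, and $J^1_R[D,g]$ for the case $m=1$, $D_0=D$, $g_1=g$. For a set $\Delta\subset\mathbb Z_{\ge 0}$ with finite complement and $\ell\ge 0$ put $\gamma_\Delta(\ell)=|[\ell,\infty)\setminus\Delta|$. For $D\subset G$ and $g\in G\setminus D$ put $\Delta=\Gamma\cup D$ and $\Delta'=\Delta\cup\{g\}$, let $n=n(D)$ be the smallest odd number in $(\Delta\cup\{v\})\cap[2u,\infty)$, and set $$ \mu_{D,g}=\begin{cases} \gamma_{\Delta'}(g)-\gamma_{\Delta'}(g+4) & \text{if } g\equiv 1,3 \pmod 4,\\ \gamma_{\Delta'}(g)-\gamma_{\Delta'}(g+4)-\bigl(\gamma_{\Delta'}(g+n)-\gamma_{\Delta'}(g+4+n)\bigr) & \text{if } g\equiv 2 \pmod 4.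 \end{cases} $$ **Theorem.** (1) For every admissible $D$-flag $\mathcal D$ as above, $J^m_R[\mathcal D]$ is isomorphic, as a variety, to an affine space $\mathbb A^N$ with $$N=\dim J_R[D_0]+\sum_{i=0}^{m-1}\mu_{D_i,g_{i+1}} .$$ (2) If $D$ is an admissible $D$-set and $g\in G\setminus D$ is such that $D\cup\{g\}$ is an admissible $D$-set (for instance $D=D_i$, $g=g_{i+1}$ in (1)), then $J^1_R[D,g]$ is non-empty and $$\dim J^1_R[D,g]-\dim J_R[D]=\mu_{D,g}.$$ -/

import Mathlib

open scoped PowerSeries Topology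

noncomputable section

namespace FlaggedJacobian

/-! ### Quasi-projective varieties over `ℂ` in (multi)homogeneous coordinates -/

/-- A set `X` of points given by coordinates in a product of affine and projective spaces over `ℂ`.
The projective factors are indexed by `Factor`; the coordinate `s` has multidegree `weight s`: it is
`Pi.single i 1` for a homogeneous coordinate of the `i`-th projective factor and `0` for an affine
coordinate. `coord x` is a representative of the coordinate vector of the point `x`. -/
structure Coordinates (X : Type) where
  Idx : Type
  Factor : Type
  weight : Idx → Factor → ℕ
  coord : X → Idx → ℂ

namespace Coordinates

variable {X Y : Type}

/-- The Zariski topology on `X`: its basic open sets are the nonvanishing loci of the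
multihomogeneous polynomials in the coordinates. -/
@[reducible] def zariski (A : Coordinates X) : TopologicalSpace X :=
  TopologicalSpace.generateFrom
    {U | ∃ (e : A.Factor → ℕ) (Q : MvPolynomial A.Idx ℂ),
      MvPolynomial.IsWeightedHomogeneous A.weight Q e ∧
        U = {x | MvPolynomial.eval (A.coord x) Q ≠ 0}}

/-- `f` is a regular function on `U`: near each point of `U` it is a quotient of two multihomogeneous
polynomials of the same multidegree, with nonvanishing denominator. -/
def IsRegularOn (A : Coordinates X) (U : Set X) (f : X → ℂ) : Prop :=
  ∀ x ∈ U, ∃ (e : A.Factor → ℕ) (P Q : MvPolynomial A.Idx ℂ),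
    MvPolynomial.IsWeightedHomogeneous A.weight P e ∧
    MvPolynomial.IsWeightedHomogeneous A.weight Q e ∧
    MvPolynomial.eval (A.coord x) Q ≠ 0 ∧
    ∀ y ∈ U, MvPolynomial.eval (A.coord y) Q ≠ 0 →
      f y = MvPolynomial.eval (A.coord y) P / MvPolynomial.eval (A.coord y) Q

/-- Isomorphism of varieties: a homeomorphism for the Zariski topologies that identifies the regular
functions on corresponding open sets. -/
def Isomorphic (A : Coordinates X) (B : Coordinates Y) : Prop :=
  ∃ e : X ≃ Y,
    (∀ U : Set Y, IsOpen[B.zariski] U ↔ IsOpen[A.zariski] (e ⁻¹' U)) ∧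
    ∀ U : Set Y, IsOpen[B.zariski] U →
      ∀ f : Y → ℂ, B.IsRegularOn U f ↔ A.IsRegularOn (e ⁻¹' U) (f ∘ e)

/-- The dimension of a variety: the Krull dimension of its Zariski topology. -/
def dim (A : Coordinates X) : WithBot ℕ∞ :=
  @topologicalKrullDim X A.zariski

end Coordinates

/-- The affine space `𝔸^N` over `ℂ`: no projective factor, all coordinates affine. -/
def affineSpace (N : ℕ) : Coordinates (Fin N → ℂ) where
  Idx := Fin N
  Factor := Empty
  weight := 0
  coord := id

/-- The Plücker coordinates of a `k`-dimensional subspace `W ⊆ ℂ^c` (with respect to some basis of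
`W`; another basis multiplies all of them by one nonzero scalar): the `k × k` minors of a matrix
whose rows form a basis of `W`. The value `0` is a dummy for subspaces of another dimension. -/
def plucker {c : ℕ} (k : ℕ) (W : Submodule ℂ (Fin c → ℂ)) (S : Fin k ↪o Fin c) : ℂ :=
  open Classical in
  if h : Module.finrank ℂ W = k then
    Matrix.det (Matrix.of fun i j : Fin k =>
      (Module.finBasisOfFinrankEq ℂ W h i : Fin c → ℂ) (S j))
  else 0

/-! ### The ring, its semigroup and its standard modules -/

/-- The two power series `z^4` and `z^{2u} + z^v`. -/
def gens (u v : ℕ) : Fin 2 → MvPowerSeries Unit ℂ :=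
  ![(PowerSeries.X ^ 4 : ℂ⟦X⟧), (PowerSeries.X ^ (2 * u) + PowerSeries.X ^ v : ℂ⟦X⟧)]

open Classical in
/-- The ring `ℂ[[z^4, z^{2u} + z^v]] ⊆ ℂ[[z]]`: all `F(z^4, z^{2u} + z^v)` with `F` a power series in
two variables. (For `u, v > 0` the substitution is defined, see `mem_R`.) -/
def R (u v : ℕ) : Subalgebra ℂ ℂ⟦X⟧ :=
  if h : MvPowerSeries.HasSubst (gens u v) then (MvPowerSeries.substAlgHom (R := ℂ) h).range else ⊥

lemma hasSubst_gens {u v : ℕ} (hu : 0 < u) (hv : 0 < v) : MvPowerSeries.HasSubst (gens u v) := by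
  apply MvPowerSeries.hasSubst_of_constantCoeff_zero
  intro s
  change PowerSeries.constantCoeff (R := ℂ) (gens u v s) = 0
  fin_cases s
  · simp [gens]
  · simp [gens, hu.ne', hv.ne']

lemma mem_R {u v : ℕ} (hu : 0 < u) (hv : 0 < v) (f : ℂ⟦X⟧) :
    f ∈ R u v ↔ ∃ F : MvPowerSeries (Fin 2) ℂ, MvPowerSeries.subst (gens u v) F = f := by
  have h := hasSubst_gens hu hv
  rw [R, dif_pos h]
  simp only [← MvPowerSeries.coe_substAlgHom h]
  exact AlgHom.mem_range _

/-- The set of the valuations (orders in `z`) of the nonzero elements of a set of power series. -/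
def valuations (M : Set ℂ⟦X⟧) : Set ℕ := {k | ∃ f ∈ M, PowerSeries.order f = k}

/-- The semigroup `Γ` of `R`. -/
def semigroup (u v : ℕ) : Set ℕ := valuations (R u v : Set ℂ⟦X⟧)

/-- The set of gaps `G = ℤ_{≥ 0} ∖ Γ`. -/
def gaps (u v : ℕ) : Set ℕ := (semigroup u v)ᶜ

/-- The `δ`-invariant `|G|`. -/
def delta (u v : ℕ) : ℕ := (gaps u v).ncard

/-- `Δ` is a standard `Γ`-module: `0 ∈ Δ` and `Γ + Δ ⊆ Δ`. -/
def IsStandardGammaModule (u v : ℕ) (Δ : Set ℕ) : Prop :=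
  0 ∈ Δ ∧ ∀ a ∈ semigroup u v, ∀ b ∈ Δ, a + b ∈ Δ

/-- An `R`-submodule `M ⊆ ℂ[[z]]` is standard if it contains an element of valuation `0`. -/
def IsStandard {u v : ℕ} (M : Submodule (R u v) ℂ⟦X⟧) : Prop :=
  0 ∈ valuations (M : Set ℂ⟦X⟧)

/-- The `D`-set (set of added gaps) `D_M = G ∩ Δ_M` of a module `M`. -/
def addedGaps {u v : ℕ} (M : Submodule (R u v) ℂ⟦X⟧) : Set ℕ :=
  gaps u v ∩ valuations (M : Set ℂ⟦X⟧)

/-! ### `D`-flags and their cells -/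

/-- The set `D_i = D ∪ {g_1, …, g_i}`; the sequence `g_1, …, g_m` is indexed by `Fin m` from `0`. -/
def dset {m : ℕ} (D : Set ℕ) (g : Fin m → ℕ) (i : Fin (m + 1)) : Set ℕ :=
  D ∪ {k | ∃ j : Fin m, j.castSucc < i ∧ g j = k}

/-- `D` and the increasing sequence `g` of gaps outside `D` define a `D`-flag
`D_0 = D ⊂ D_1 ⊂ … ⊂ D_m`: all `Γ ∪ D_i` are standard `Γ`-modules. -/
structure IsDFlag (u v : ℕ) {m : ℕ} (D : Set ℕ) (g : Fin m → ℕ) : Prop where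
  subset_gaps : D ⊆ gaps u v
  strictMono : StrictMono g
  mem_gaps : ∀ j, g j ∈ gaps u v \ D
  isModule : ∀ i, IsStandardGammaModule u v (semigroup u v ∪ dset D g i)

/-- The flagged cell `J^m_R[𝒟]`: the flags `M_0 ⊆ M_1 ⊆ … ⊆ M_m` of standard modules with
`D_{M_i} = D_i`. -/
def FlagCell (u v : ℕ) {m : ℕ} (D : Set ℕ) (g : Fin m → ℕ) : Type :=
  {M : Fin (m + 1) → Submodule (R u v) ℂ⟦X⟧ //
    Monotone M ∧ ∀ i, IsStandard (M i) ∧ addedGaps (M i) = dset D g i}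

/-- The `D`-flag is admissible if there is a flag of modules corresponding to it. -/
def IsAdmissible (u v : ℕ) {m : ℕ} (D : Set ℕ) (g : Fin m → ℕ) : Prop :=
  IsDFlag u v D g ∧ Nonempty (FlagCell u v D g)

/-- `D` is an admissible `D`-set: it is the `D`-set of a standard module. -/
def IsAdmissibleSet (u v : ℕ) (D : Set ℕ) : Prop :=
  ∃ M : Submodule (R u v) ℂ⟦X⟧, IsStandard M ∧ addedGaps M = D

/-- Truncation `ℂ[[z]] → ℂ[[z]]/(z^c) = ℂ^c`. -/
def truncation (c : ℕ) : ℂ⟦X⟧ →ₗ[ℂ] (Fin c → ℂ) :=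
  LinearMap.pi fun i => PowerSeries.coeff (R := ℂ) (i : ℕ)

/-- The image of a module `M` in `ℂ[[z]]/(z^{2δ})`; a standard module contains `z^{2δ}ℂ[[z]]`, so it is
determined by this image. -/
def imageMod {u v : ℕ} (M : Submodule (R u v) ℂ⟦X⟧) :
    Submodule ℂ (Fin (2 * delta u v) → ℂ) :=
  (M.restrictScalars ℂ).map (truncation (2 * delta u v))

/-- The variety structure of `J^m_R[𝒟]`: it lies in the product over `0 ≤ i ≤ m` of the Grassmannians
of `(δ + |D_i|)`-dimensional subspaces of `ℂ[[z]]/(z^{2δ})`, each of them embedded into a projective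
space by its Plücker coordinates. -/
def flagCellVariety (u v : ℕ) {m : ℕ} (D : Set ℕ) (g : Fin m → ℕ) :
    Coordinates (FlagCell u v D g) where
  Idx := Σ i : Fin (m + 1), (Fin (delta u v + (dset D g i).ncard) ↪o Fin (2 * delta u v))
  Factor := Fin (m + 1)
  weight := fun s => Pi.single s.1 1
  coord := fun M s => plucker _ (imageMod (M.1 s.1)) s.2

/-- The cell `J_R[D]`, the case `m = 0`. -/
def cellVariety (u v : ℕ) (D : Set ℕ) : Coordinates (FlagCell u v D (![] : Fin 0 → ℕ)) :=
  flagCellVariety u v D ![]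

/-! ### The numerical functions -/

/-- The gap counting function `γ_Δ(ℓ) = |[ℓ, ∞) ∖ Δ|`. -/
def gapCount (Δ : Set ℕ) (l : ℕ) : ℤ := ((Set.Ici l \ Δ).ncard : ℤ)

/-- `n(D)`, the smallest odd number in `(Δ ∪ {v}) ∩ [2u, ∞)`, where `Δ = Γ ∪ D`. -/
def smallestOdd (u v : ℕ) (D : Set ℕ) : ℕ :=
  sInf {k | Odd k ∧ k ∈ (semigroup u v ∪ D) ∪ {v} ∧ 2 * u ≤ k}

/-- The explicit value of `μ_{D,g}`, where `Δ' = Γ ∪ D ∪ {g}`: the first case is `g ≡ 2 (mod 4)`, the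
second is `g ≡ 1, 3 (mod 4)` (a gap `g` is never divisible by `4`). -/
def mu (u v : ℕ) (D : Set ℕ) (g : ℕ) : ℤ :=
  let Δ' : Set ℕ := semigroup u v ∪ D ∪ {g}
  let n := smallestOdd u v D
  if g % 4 = 2 then
    gapCount Δ' g - gapCount Δ' (g + 4) - (gapCount Δ' (g + n) - gapCount Δ' (g + 4 + n))
  else
    gapCount Δ' g - gapCount Δ' (g + 4)

end FlaggedJacobian

end

open FlaggedJacobian

/-!
All varieties in question are spaces of modules with a fixed set `Δ` of valuations. Such a module `M` has a unique
reduced echelon basis `red M a`, `a ∈ Δ`, and up to sign the ratios of its Plücker coordinates to the nonvanishing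
one are minors of the echelon matrix, while the entries of that matrix occur among these ratios
(`exists_minor_eq_coeff_red`). Hence a flagged cell is isomorphic to `𝔸^N` as soon as the algebra generated by the
coefficients of the echelon bases becomes the polynomial algebra under a bijection with `ℂ^N`
(`isomorphic_of_isAffineCell`). The latter property is called `IsAffineCell` and is what the proof establishes.

Let `x = z^4` and `y = z^{2u} + z^v`. Adding a gap `g` to a module `M` means choosing `f` of order `g` with
`x f ∈ M` and `y f ∈ M`. The first condition alone has the solutions
`f = x⁻¹ (h_{g+4} + ∑ ρ_k h_{k+4})`, with `h_a = red M a` and one free parameter `ρ_k` for every gap `k > g` such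
that `k + 4` is not a gap. A step is *free* if the first condition implies the second one; then the cell grows by
an affine space (`isAffineCell_of_free_step`), whose dimension is `μ` (`IsStep.mu_of_isFree`). Steps at odd `g` are
free for reasons of order. If `g ≡ 2 (mod 4)` and `4 S = 2u - g`, put `w = y - x^S f`; then
`x^S y f = y² - y w`, and if all numbers from `g + n(D)` on are valuations, both terms lie in `x^S M`
(`genY_mul_mem_of_even`).

The remaining *exceptional* steps have `g ≡ 2 (mod 4)` and a gap that is at least `g + n(D)`
(`IsStep.exists_exceptional`). Then `g` is smaller than all elements of `D`, so such a step can only be the first one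
of a flag. Moreover `μ = 1`. Since every standard module contains a unit, cells are products of an affine space and
of the cells of modules containing `1` (`isAffineCell_of_scale`), and for a gap `g` below `D` a module `M' ∋ 1` with
set `D ∪ {g}` contains a unique `M ∋ 1` with set `D`. It follows that the flagged cell of an exceptional step is
essentially the normalised cell of `D ∪ {g}`, and one has to show that the normalised cells of `D` and of `D ∪ {g}`
are affine spaces whose dimensions differ by `1`.

In the exceptional situation a module containing `1` is spanned over `ℂ[[z^4]]` by `1`, `z^a + o`,
`z^α (1 + Λ)` and `z^β`, where `a`, `α < β` are the least valuations in the remaining classes modulo `4`, the series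
`o` is odd and `Λ` has exponents in `2 + 4ℕ` (`specialSpace`). Stability under `y` amounts to two systems
of equations for the coefficients of `(1 - Λ) o`, which are triangular; they are compatible if and only if
certain coefficients of `Λ` take prescribed values (`Special.isSolution_iff`). The other coefficients of `Λ` and the
undetermined coefficients of `(1 - Λ) o` are coordinates (`Special.isAffineCell`), and counting them for `a = g + 4`
and for `a = g` gives the difference `1` (`card_free_add`).
-/

open scoped PowerSeries Topology

noncomputable section

namespace FlaggedJacobian

/-! ### Polynomial functions, affine cells, and isomorphisms onto affine space -/

/-- The algebra of polynomial functions on `ι → ℂ`. -/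
def polyFun (ι : Type*) : Subalgebra ℂ ((ι → ℂ) → ℂ) :=
  Algebra.adjoin ℂ (Set.range fun (i : ι) (c : ι → ℂ) => c i)

lemma mem_polyFun_iff {ι : Type*} {f : (ι → ℂ) → ℂ} :
    f ∈ polyFun ι ↔ ∃ p : MvPolynomial ι ℂ, ∀ c, f c = MvPolynomial.eval c p := by
  have key : ∀ (p : MvPolynomial ι ℂ) (c : ι → ℂ),
      (MvPolynomial.aeval (R := ℂ) (fun (i : ι) (c : ι → ℂ) => c i) p) c = MvPolynomial.eval c p := by
    intro p c
    have := MvPolynomial.comp_aeval (R := ℂ) (fun (i : ι) (c : ι → ℂ) => c i)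
      (Pi.evalAlgHom ℂ (fun _ : ι → ℂ => ℂ) c)
    have h2 := DFunLike.congr_fun this p
    simp only [AlgHom.comp_apply, Pi.evalAlgHom_apply] at h2
    rw [h2, MvPolynomial.aeval_eq_eval]
  rw [polyFun, Algebra.adjoin_range_eq_range_aeval]
  constructor
  · rintro ⟨p, rfl⟩
    exact ⟨p, fun c => key p c⟩
  · rintro ⟨p, hp⟩
    exact ⟨p, funext fun c => (key p c).trans (hp c).symm⟩

lemma coord_mem_polyFun {ι : Type*} (i : ι) : (fun c : ι → ℂ => c i) ∈ polyFun ι :=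
  Algebra.subset_adjoin ⟨i, rfl⟩

/-- A subalgebra closed under substitution: a polynomial expression in elements of a subalgebra of
functions lies in that subalgebra. -/
lemma comp_mem_of_mem_polyFun {X ι : Type*} {O : Subalgebra ℂ (X → ℂ)} {F : X → ι → ℂ}
    (hF : ∀ i, (fun x => F x i) ∈ O) {f : (ι → ℂ) → ℂ} (hf : f ∈ polyFun ι) :
    (fun x => f (F x)) ∈ O := by
  induction hf using Algebra.adjoin_induction with
  | mem f hf => obtain ⟨i, rfl⟩ := hf; exact hF i
  | algebraMap r => exact O.algebraMap_mem r
  | add f g _ _ hf hg => exact O.add_mem hf hg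
  | mul f g _ _ hf hg => exact O.mul_mem hf hg

/-- The set `X` with the algebra `O` of regular functions is an affine space of dimension `N`: some
bijection `X ≃ ℂ^N` has components in `O` and carries `O` into the polynomial functions. -/
def IsAffineCell {X : Type*} (O : Subalgebra ℂ (X → ℂ)) (N : ℕ) : Prop :=
  ∃ e : X ≃ (Fin N → ℂ), (∀ j, (fun x => e x j) ∈ O) ∧ ∀ f ∈ O, (fun c => f (e.symm c)) ∈ polyFun (Fin N)

/-- An affine cell may be parametrised by any finite index set. -/
lemma isAffineCell_of_equiv {X ι : Type*} [Fintype ι] {O : Subalgebra ℂ (X → ℂ)}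
    (e : X ≃ (ι → ℂ)) (h1 : ∀ j, (fun x => e x j) ∈ O)
    (h2 : ∀ f ∈ O, (fun c => f (e.symm c)) ∈ polyFun ι) {N : ℕ} (hN : Fintype.card ι = N) :
    IsAffineCell O N := by
  subst hN
  let σ := Fintype.equivFin ι
  refine ⟨e.trans (Equiv.arrowCongr σ (Equiv.refl ℂ)), fun j => h1 _, fun f hf => ?_⟩
  have := comp_mem_of_mem_polyFun (O := polyFun (Fin (Fintype.card ι)))
    (F := fun c i => c (σ i)) (fun i => coord_mem_polyFun _) (h2 f hf)
  exact this

/-- A fibration in affine spaces `ℂ^K` over an affine cell that is globally trivial is an affine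
cell. -/
lemma IsAffineCell.of_prod {X Y K : Type} [Fintype K] {OX : Subalgebra ℂ (X → ℂ)}
    {OY : Subalgebra ℂ (Y → ℂ)} {N : ℕ} (hY : IsAffineCell OY N) (φ : X ≃ Y × (K → ℂ))
    (h1 : ∀ f ∈ OY, (fun x => f (φ x).1) ∈ OX) (h2 : ∀ k, (fun x => (φ x).2 k) ∈ OX)
    (h3 : ∀ f ∈ OX, ∀ {Z : Type} (P : Subalgebra ℂ (Z → ℂ)) (y : Z → Y) (r : Z → K → ℂ),
      (∀ f ∈ OY, (fun z => f (y z)) ∈ P) → (∀ k, (fun z => r z k) ∈ P) →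
      (fun z => f (φ.symm (y z, r z))) ∈ P) {N' : ℕ} (hN : N + Fintype.card K = N') :
    IsAffineCell OX N' := by
  obtain ⟨e, he1, he2⟩ := hY
  refine isAffineCell_of_equiv (ι := Fin N ⊕ K)
    (φ.trans ((e.prodCongr (Equiv.refl _)).trans (Equiv.sumArrowEquivProdArrow _ _ _).symm))
    ?_ ?_ (by simpa using hN)
  · rintro (j | k)
    · exact h1 _ (he1 j)
    · exact h2 k
  · intro f hf
    refine h3 f hf (polyFun (Fin N ⊕ K)) (fun c => e.symm fun j => c (Sum.inl j))
      (fun c k => c (Sum.inr k)) ?_ ?_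
    · intro g hg
      exact comp_mem_of_mem_polyFun (F := fun (c : Fin N ⊕ K → ℂ) j => c (Sum.inl j))
        (fun i => coord_mem_polyFun _) (he2 g hg)
    · intro k
      exact coord_mem_polyFun _

lemma eval_bind₁ {σ τ : Type*} (x : τ → ℂ) (T : σ → MvPolynomial τ ℂ) (P : MvPolynomial σ ℂ) :
    MvPolynomial.eval x (MvPolynomial.bind₁ T P) =
      MvPolynomial.eval (fun s => MvPolynomial.eval x (T s)) P :=
  MvPolynomial.eval₂Hom_bind₁ _ _ _ _

lemma isWeightedHomogeneous_affineSpace {N : ℕ} (p : MvPolynomial (Fin N) ℂ) (d : Empty → ℕ) :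
    MvPolynomial.IsWeightedHomogeneous (affineSpace N).weight p d :=
  fun _ _ => funext fun i => nomatch i

lemma zariski_affineSpace (N : ℕ) : (affineSpace N).zariski = TopologicalSpace.generateFrom
    {U : Set (Fin N → ℂ) | ∃ Q : MvPolynomial (Fin N) ℂ, U = {x | MvPolynomial.eval x Q ≠ 0}} := by
  change TopologicalSpace.generateFrom _ = _
  congr 1
  ext U
  exact ⟨fun ⟨_, Q, _, h⟩ => ⟨Q, h⟩,
    fun ⟨Q, h⟩ => ⟨(fun i => nomatch i), Q, isWeightedHomogeneous_affineSpace Q _, h⟩⟩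

namespace Coordinates

variable {X Y : Type}

/-- The functions on `X` that are globally a quotient of two multihomogeneous polynomials of the same
multidegree, with a denominator that vanishes nowhere on `X`. -/
def fractions (A : Coordinates X) : Subalgebra ℂ (X → ℂ) where
  carrier := {f | ∃ (e : A.Factor → ℕ) (P Q : MvPolynomial A.Idx ℂ),
    MvPolynomial.IsWeightedHomogeneous A.weight P e ∧
    MvPolynomial.IsWeightedHomogeneous A.weight Q e ∧
    (∀ x, MvPolynomial.eval (A.coord x) Q ≠ 0) ∧
    ∀ x, f x = MvPolynomial.eval (A.coord x) P / MvPolynomial.eval (A.coord x) Q}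
  mul_mem' := by
    rintro f g ⟨e, P, Q, hP, hQ, h0, h⟩ ⟨e', P', Q', hP', hQ', h0', h'⟩
    refine ⟨e + e', P * P', Q * Q', hP.mul hP', hQ.mul hQ', fun x => ?_, fun x => ?_⟩
    · rw [map_mul]; exact mul_ne_zero (h0 x) (h0' x)
    · rw [Pi.mul_apply, h, h', map_mul, map_mul, div_mul_div_comm]
  add_mem' := by
    rintro f g ⟨e, P, Q, hP, hQ, h0, h⟩ ⟨e', P', Q', hP', hQ', h0', h'⟩
    refine ⟨e + e', P * Q' + Q * P', Q * Q', (hP.mul hQ').add (hQ.mul hP'), hQ.mul hQ',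
      fun x => ?_, fun x => ?_⟩
    · rw [map_mul]; exact mul_ne_zero (h0 x) (h0' x)
    · rw [Pi.add_apply, h, h', map_mul, map_add, map_mul, map_mul, div_add_div _ _ (h0 x) (h0' x)]
  algebraMap_mem' := by
    intro r
    refine ⟨0, MvPolynomial.C r, 1, MvPolynomial.isWeightedHomogeneous_C _ _,
      MvPolynomial.isWeightedHomogeneous_one _ _, fun x => by simp, fun x => by simp⟩

lemma eval_scale {σ ι : Type*} [Fintype ι] {w : σ → ι → ℕ} {P : MvPolynomial σ ℂ} {d : ι → ℕ}
    (hP : MvPolynomial.IsWeightedHomogeneous w P d) (c : ι → ℂ) (t : σ → ℂ) :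
    MvPolynomial.eval (fun s => (∏ i, c i ^ w s i) * t s) P =
      (∏ i, c i ^ d i) * MvPolynomial.eval t P := by
  rw [MvPolynomial.eval_eq, MvPolynomial.eval_eq, Finset.mul_sum]
  refine Finset.sum_congr rfl fun m hm => ?_
  have hw : Finsupp.weight w m = d := hP (MvPolynomial.mem_support_iff.mp hm)
  have h1 : ∏ s ∈ m.support, ((∏ i, c i ^ w s i) * t s) ^ m s =
      (∏ i, c i ^ d i) * ∏ s ∈ m.support, t s ^ m s := by
    simp_rw [mul_pow]
    rw [Finset.prod_mul_distrib]
    congr 1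
    simp_rw [← Finset.prod_pow]
    rw [Finset.prod_comm]
    refine Finset.prod_congr rfl fun i _ => ?_
    rw [← hw, Finsupp.weight_apply, Finsupp.sum, Finset.sum_apply, ← Finset.prod_pow_eq_pow_sum]
    refine Finset.prod_congr rfl fun s _ => ?_
    rw [← pow_mul, Pi.smul_apply, smul_eq_mul, mul_comm]
  rw [h1]; ring

/-- A bijection onto `ℂ^N` is an isomorphism with affine space if its components are global fractions
and if, up to a nonzero scalar for each projective factor, the coordinates of `x` are polynomials in
the image of `x`. -/
theorem isomorphic_affineSpace (A : Coordinates X) [Fintype A.Factor] {N : ℕ}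
    (e : X ≃ (Fin N → ℂ)) (c : X → A.Factor → ℂ) (hc : ∀ x i, c x i ≠ 0)
    (T : A.Idx → MvPolynomial (Fin N) ℂ)
    (hT : ∀ x s, A.coord x s = (∏ i, c x i ^ A.weight s i) * MvPolynomial.eval (e x) (T s))
    (he : ∀ j, (fun x => e x j) ∈ A.fractions) : A.Isomorphic (affineSpace N) := by
  have hc' : ∀ x (d : A.Factor → ℕ), ∏ i, c x i ^ d i ≠ 0 := fun x d =>
    Finset.prod_ne_zero_iff.mpr fun i _ => pow_ne_zero _ (hc x i)
  have hev : ∀ {P : MvPolynomial A.Idx ℂ} {d}, MvPolynomial.IsWeightedHomogeneous A.weight P d →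
      ∀ x, MvPolynomial.eval (A.coord x) P =
        (∏ i, c x i ^ d i) * MvPolynomial.eval (e x) (MvPolynomial.bind₁ T P) := by
    intro P d hP x
    have : A.coord x = fun s => (∏ i, c x i ^ A.weight s i) * MvPolynomial.eval (e x) (T s) :=
      funext fun s => hT x s
    rw [this, eval_scale hP, eval_bind₁]
  have hfr : ∀ p : MvPolynomial (Fin N) ℂ, (fun x => MvPolynomial.eval (e x) p) ∈ A.fractions :=
    fun p => comp_mem_of_mem_polyFun (F := fun x => e x) he (mem_polyFun_iff.mpr ⟨p, fun _ => rfl⟩)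
  refine ⟨e, fun U => ⟨fun hU => ?_, fun hU => ?_⟩, fun U hU f => ⟨fun hf x hx => ?_, fun hf y hy => ?_⟩⟩
  · have : @Continuous _ _ A.zariski (affineSpace N).zariski e := by
      let := A.zariski
      rw [zariski_affineSpace]
      refine continuous_generateFrom_iff.mpr ?_
      rintro V ⟨Q, rfl⟩
      obtain ⟨d', P', Q', hP', hQ', h0, h⟩ := hfr Q
      refine TopologicalSpace.isOpen_generateFrom_of_mem ⟨d', P', hP', ?_⟩
      ext x
      have h3 : MvPolynomial.eval (e x) Q = _ := h x
      rw [Set.mem_preimage, Set.mem_ofPred_eq, Set.mem_ofPred_eq, h3]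
      simp [h0 x]
    exact @IsOpen.preimage _ _ A.zariski (affineSpace N).zariski _ this _ hU
  · have : @Continuous _ _ (affineSpace N).zariski A.zariski e.symm := by
      let := (affineSpace N).zariski
      refine continuous_generateFrom_iff.mpr ?_
      rintro V ⟨d, Q, hQ, rfl⟩
      refine TopologicalSpace.isOpen_generateFrom_of_mem
        ⟨(fun i => nomatch i), MvPolynomial.bind₁ T Q, isWeightedHomogeneous_affineSpace _ _, ?_⟩
      ext x
      change MvPolynomial.eval (A.coord (e.symm x)) Q ≠ 0 ↔ MvPolynomial.eval x _ ≠ 0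
      rw [hev hQ]
      simp [hc']
    have h2 := @IsOpen.preimage _ _ (affineSpace N).zariski A.zariski _ this _ hU
    rwa [← Set.preimage_comp, Equiv.self_comp_symm, Set.preimage_id] at h2
  · obtain ⟨d, P, Q, -, -, h0, h⟩ := hf (e x) hx
    obtain ⟨d1, P1, Q1, hP1, hQ1, h01, h1⟩ := hfr P
    obtain ⟨d2, P2, Q2, hP2, hQ2, h02, h2⟩ := hfr Q
    refine ⟨d1 + d2, P1 * Q2, Q1 * P2, hP1.mul hQ2, hQ1.mul hP2, ?_, ?_⟩
    · rw [map_mul]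
      refine mul_ne_zero (h01 x) fun h3 => h0 ?_
      have := h2 x
      simp only [h3, zero_div] at this
      exact this
    · intro y hy hne
      rw [map_mul] at hne
      have h3 := right_ne_zero_of_mul hne
      have e1 : MvPolynomial.eval (e y) P = _ := h1 y
      have e2 : MvPolynomial.eval (e y) Q = _ := h2 y
      have h4 : MvPolynomial.eval (e y) Q ≠ 0 := by rw [e2]; exact div_ne_zero h3 (h02 y)
      have e3 : f (e y) = MvPolynomial.eval (e y) P / MvPolynomial.eval (e y) Q := h (e y) hy h4
      rw [Function.comp_apply, e3, e1, e2, map_mul, map_mul, div_div_div_eq]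
  · obtain ⟨d, P, Q, hP, hQ, h0, h⟩ := hf (e.symm y) (by simpa using hy)
    refine ⟨(fun i => nomatch i), MvPolynomial.bind₁ T P, MvPolynomial.bind₁ T Q, isWeightedHomogeneous_affineSpace _ _, isWeightedHomogeneous_affineSpace _ _, ?_, ?_⟩
    · rw [hev hQ] at h0
      have := right_ne_zero_of_mul h0
      rwa [Equiv.apply_symm_apply] at this
    · intro z hz hne
      have h3 := h (e.symm z) (by simpa using hz)
      rw [hev hQ, hev hP, Equiv.apply_symm_apply, Function.comp_apply, Equiv.apply_symm_apply,
        mul_div_mul_left _ _ (hc' _ _)] at h3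
      refine h3 (mul_ne_zero (hc' _ _) hne)

lemma Isomorphic.dim_eq {A : Coordinates X} {B : Coordinates Y} (h : A.Isomorphic B) :
    A.dim = B.dim := by
  obtain ⟨e, he, -⟩ := h
  let := A.zariski
  let := B.zariski
  have : IsHomeomorph e := by
    rw [isHomeomorph_iff_continuous_isClosedMap_bijective]
    refine ⟨⟨fun U hU => (he U).mp hU⟩, ?_, e.bijective⟩
    intro C hC
    rw [← isOpen_compl_iff] at hC ⊢
    rw [he, Set.preimage_compl, Equiv.preimage_image]
    exact hC
  exact IsHomeomorph.topologicalKrullDim_eq e this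

end Coordinates

/-- The Zariski topology on points is induced from the spectrum of the polynomial ring. -/
lemma isInducing_pointToPoint (N : ℕ) :
    @Topology.IsInducing _ _ (affineSpace N).zariski _
      (MvPolynomial.pointToPoint : (Fin N → ℂ) → PrimeSpectrum (MvPolynomial (Fin N) ℂ)) := by
  let := (affineSpace N).zariski
  constructor
  rw [PrimeSpectrum.isTopologicalBasis_basic_opens.eq_generateFrom, induced_generateFrom_eq]
  rw [zariski_affineSpace]
  congr 1
  ext U
  have key : ∀ (Q : MvPolynomial (Fin N) ℂ) (c : Fin N → ℂ),
      MvPolynomial.pointToPoint c ∈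
      ((PrimeSpectrum.basicOpen Q : TopologicalSpace.Opens _) : Set (PrimeSpectrum (MvPolynomial (Fin N) ℂ))) ↔
        MvPolynomial.eval c Q ≠ 0 := by
    intro Q c
    rw [SetLike.mem_coe, PrimeSpectrum.mem_basicOpen, MvPolynomial.pointToPoint]
    simp only [MvPolynomial.mem_vanishingIdeal_singleton_iff]
    rfl
  constructor
  · rintro ⟨Q, rfl⟩
    refine ⟨_, ⟨Q, rfl⟩, ?_⟩
    ext c
    exact key Q c
  · rintro ⟨_, ⟨Q, rfl⟩, rfl⟩
    refine ⟨Q, ?_⟩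
    ext c
    exact key Q c

/-- The dimension is at most that of the spectrum of the polynomial ring, into which the points embed, and the
coordinate subspaces form a chain of irreducible closed sets of length `N`. -/
lemma dim_affineSpace (N : ℕ) : (affineSpace N).dim = N := by
  unfold Coordinates.dim
  rw [zariski_affineSpace]
  set τ : TopologicalSpace (Fin N → ℂ) := TopologicalSpace.generateFrom
    {U : Set (Fin N → ℂ) | ∃ Q : MvPolynomial (Fin N) ℂ, U = {x | MvPolynomial.eval x Q ≠ 0}} with hτ
  have hbasis : ∀ U : Set (Fin N → ℂ), IsOpen U → ∀ x ∈ U, ∃ Q : MvPolynomial (Fin N) ℂ,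
      MvPolynomial.eval x Q ≠ 0 ∧ ∀ y, MvPolynomial.eval y Q ≠ 0 → y ∈ U := by
    intro U hU
    induction hU with
    | basic s hs =>
      obtain ⟨Q, rfl⟩ := hs
      exact fun x hx => ⟨Q, hx, fun y hy => hy⟩
    | univ => exact fun x _ => ⟨1, by simp, fun y _ => trivial⟩
    | inter s t _ _ hs ht =>
      intro x hx
      obtain ⟨Q, hQ, h⟩ := hs x hx.1
      obtain ⟨Q', hQ', h'⟩ := ht x hx.2
      refine ⟨Q * Q', by rw [map_mul]; exact mul_ne_zero hQ hQ', fun y hy => ?_⟩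
      rw [map_mul] at hy
      exact ⟨h y (left_ne_zero_of_mul hy), h' y (right_ne_zero_of_mul hy)⟩
    | sUnion S _ hS =>
      rintro x ⟨s, hs, hx⟩
      obtain ⟨Q, hQ, h⟩ := hS s hs x hx
      exact ⟨Q, hQ, fun y hy => ⟨s, hs, h y hy⟩⟩
  have hopen : ∀ Q : MvPolynomial (Fin N) ℂ, IsOpen {x : Fin N → ℂ | MvPolynomial.eval x Q ≠ 0} :=
    fun Q => TopologicalSpace.isOpen_generateFrom_of_mem ⟨Q, rfl⟩
  have hirr : PreirreducibleSpace (Fin N → ℂ) := by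
    constructor
    rintro U V hU hV ⟨x, -, hx⟩ ⟨y, -, hy⟩
    obtain ⟨Q, hQ, h⟩ := hbasis U hU x hx
    obtain ⟨Q', hQ', h'⟩ := hbasis V hV y hy
    have h1 : Q * Q' ≠ 0 := mul_ne_zero (by rintro rfl; simp at hQ) (by rintro rfl; simp at hQ')
    obtain ⟨z, hz⟩ : ∃ z, MvPolynomial.eval z (Q * Q') ≠ 0 := by
      by_contra! h2
      exact h1 (MvPolynomial.funext fun z => by simpa using h2 z)
    rw [map_mul] at hz
    exact ⟨z, trivial, h z (left_ne_zero_of_mul hz), h' z (right_ne_zero_of_mul hz)⟩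
  apply le_antisymm
  · refine (Topology.IsInducing.topologicalKrullDim_le (hτ ▸ zariski_affineSpace N ▸ isInducing_pointToPoint N)).trans ?_
    rw [PrimeSpectrum.topologicalKrullDim_eq_ringKrullDim, MvPolynomial.ringKrullDim_of_isNoetherianRing]
    simp
  · let p : ℕ → (Fin N → ℂ) → (Fin N → ℂ) := fun i c j => if (j : ℕ) < i then c j else 0
    have hp : ∀ i, Continuous (p i) := by
      intro i
      refine continuous_generateFrom_iff.mpr ?_
      rintro V ⟨Q, rfl⟩
      have := hopen (MvPolynomial.bind₁ (fun j : Fin N => if (j : ℕ) < i then MvPolynomial.X j else 0) Q)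
      convert this using 1
      ext c
      rw [Set.mem_preimage, Set.mem_ofPred_eq, Set.mem_ofPred_eq, eval_bind₁]
      have : p i c = fun j : Fin N => MvPolynomial.eval c
          (if (j : ℕ) < i then MvPolynomial.X j else 0) := by
        funext j
        by_cases hj : (j : ℕ) < i <;> simp [p, hj]
      rw [this]
    let Z : ℕ → Set (Fin N → ℂ) := fun i => {c | ∀ j : Fin N, i ≤ (j : ℕ) → c j = 0}
    have hZ : ∀ i, Z i = Set.range (p i) := by
      intro i
      ext c
      constructor
      · intro h
        refine ⟨c, funext fun j => ?_⟩
        by_cases hj : (j : ℕ) < i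
        · simp [p, hj]
        · simp [p, hj, h j (not_lt.mp hj)]
      · rintro ⟨c, rfl⟩ j hj
        simp [p, not_lt.mpr hj]
    have hZirr : ∀ i, IsIrreducible (Z i) := by
      intro i
      rw [hZ, ← Set.image_univ]
      have : IrreducibleSpace (Fin N → ℂ) := { hirr with toNonempty := ⟨0⟩ }
      exact (IrreducibleSpace.isIrreducible_univ _).image _ (hp i).continuousOn
    have hZcl : ∀ i, IsClosed (Z i) := by
      intro i
      have : Z i = ⋂ j : {j : Fin N // i ≤ (j : ℕ)}, {c | MvPolynomial.eval c (MvPolynomial.X (R := ℂ) j.1) ≠ 0}ᶜ := by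
        ext c
        simp [Z]
      rw [this]
      exact isClosed_iInter fun j => (hopen _).isClosed_compl
    let s : LTSeries (TopologicalSpace.IrreducibleCloseds (Fin N → ℂ)) :=
      { length := N
        toFun := fun i => ⟨Z i, hZirr i, hZcl i⟩
        step := by
          intro i
          change (_ : TopologicalSpace.IrreducibleCloseds (Fin N → ℂ)) < _
          refine lt_of_le_of_ne ?_ ?_
          · intro c hc j hj
            exact hc j (le_trans (by simp) hj)
          · intro h
            have h1 : Pi.single i (1 : ℂ) ∈ Z (i.succ : ℕ) := by
              intro j hj
              rw [Pi.single_apply, if_neg]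
              rintro rfl
              simp at hj
            have h2 : Z (i.castSucc : ℕ) = Z (i.succ : ℕ) := congrArg (fun z : TopologicalSpace.IrreducibleCloseds (Fin N → ℂ) => z.carrier) h
            rw [← h2] at h1
            simpa using h1 i (by simp) }
    exact Order.LTSeries.length_le_krullDim s

/-! ### Valuations and tails of spaces of power series -/

open PowerSeries in
lemma mem_valuations_iff {M : Set ℂ⟦X⟧} {k : ℕ} :
    k ∈ valuations M ↔ ∃ f ∈ M, coeff k f ≠ 0 ∧ ∀ i < k, coeff i f = 0 := by
  simp only [valuations, Set.mem_ofPred_eq, order_eq_nat]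

/-- The power series of order at least `c`. -/
def tail (c : ℕ) : Submodule ℂ ℂ⟦X⟧ where
  carrier := {f | ∀ k < c, PowerSeries.coeff k f = 0}
  add_mem' := by intro f g hf hg k hk; rw [map_add, hf k hk, hg k hk, add_zero]
  zero_mem' := by intro k _; simp
  smul_mem' := by intro r f hf k hk; rw [map_smul, hf k hk, smul_zero]

lemma mem_tail {c : ℕ} {f : ℂ⟦X⟧} : f ∈ tail c ↔ ∀ k < c, PowerSeries.coeff k f = 0 := Iff.rfl

lemma mem_tail_iff_dvd {c : ℕ} {f : ℂ⟦X⟧} : f ∈ tail c ↔ (PowerSeries.X : ℂ⟦X⟧) ^ c ∣ f :=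
  PowerSeries.X_pow_dvd_iff.symm

lemma tail_anti {c d : ℕ} (h : c ≤ d) : tail d ≤ tail c := fun _ hf k hk => hf k (hk.trans_le h)

lemma X_pow_mem_tail (c : ℕ) : (PowerSeries.X : ℂ⟦X⟧) ^ c ∈ tail c := mem_tail_iff_dvd.mpr dvd_rfl

lemma mul_mem_tail {a b : ℕ} {f g : ℂ⟦X⟧} (hf : f ∈ tail a) (hg : g ∈ tail b) :
    f * g ∈ tail (a + b) := by
  rw [mem_tail_iff_dvd] at *
  rw [pow_add]
  exact mul_dvd_mul hf hg

lemma mul_mem_tail_left {a : ℕ} {f : ℂ⟦X⟧} (hf : f ∈ tail a) (g : ℂ⟦X⟧) : f * g ∈ tail a := by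
  rw [mem_tail_iff_dvd] at *
  exact hf.mul_right g

lemma mul_mem_tail_right {a : ℕ} {f : ℂ⟦X⟧} (hf : f ∈ tail a) (g : ℂ⟦X⟧) : g * f ∈ tail a := by
  rw [mul_comm]; exact mul_mem_tail_left hf g

lemma X_pow_mul_mem_tail_iff {a b : ℕ} {f : ℂ⟦X⟧} :
    (PowerSeries.X : ℂ⟦X⟧) ^ a * f ∈ tail (a + b) ↔ f ∈ tail b := by
  rw [mem_tail_iff_dvd, mem_tail_iff_dvd, pow_add]
  exact mul_dvd_mul_iff_left (pow_ne_zero _ PowerSeries.X_ne_zero)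

/-- The leading coefficient of an element of `M` of order `k` may be taken to be `1`. -/
lemma exists_monic_of_mem_valuations {M : Submodule ℂ ℂ⟦X⟧} {k : ℕ}
    (hk : k ∈ valuations (M : Set ℂ⟦X⟧)) : ∃ f ∈ M, PowerSeries.coeff k f = 1 ∧ f ∈ tail k := by
  obtain ⟨f, hf, h0, h⟩ := mem_valuations_iff.mp hk
  refine ⟨(PowerSeries.coeff k f)⁻¹ • f, M.smul_mem _ hf, ?_, (tail k).smul_mem _ h⟩
  rw [map_smul, smul_eq_mul, inv_mul_cancel₀ h0]

lemma mem_valuations_of_mem {M : Set ℂ⟦X⟧} {k : ℕ} {f : ℂ⟦X⟧} (hf : f ∈ M)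
    (h1 : PowerSeries.coeff k f = 1) (h2 : f ∈ tail k) : k ∈ valuations M :=
  mem_valuations_iff.mpr ⟨f, hf, by rw [h1]; exact one_ne_zero, h2⟩

/-- An element of `M` is determined by its coefficients at the valuations of `M`. -/
lemma eq_zero_of_coeff_valuations {M : Submodule ℂ ℂ⟦X⟧} {f : ℂ⟦X⟧} (hf : f ∈ M)
    (h : ∀ b ∈ valuations (M : Set ℂ⟦X⟧), PowerSeries.coeff b f = 0) : f = 0 := by
  by_contra h0
  have h1 := PowerSeries.coeff_order h0
  refine h1 (h _ (mem_valuations_iff.mpr ⟨f, hf, h1, fun i hi => ?_⟩))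
  exact PowerSeries.coeff_of_lt_order_toNat i hi

lemma eq_of_coeff_valuations {M : Submodule ℂ ℂ⟦X⟧} {f g : ℂ⟦X⟧} (hf : f ∈ M) (hg : g ∈ M)
    (h : ∀ b ∈ valuations (M : Set ℂ⟦X⟧), PowerSeries.coeff b f = PowerSeries.coeff b g) : f = g :=
  sub_eq_zero.mp (eq_zero_of_coeff_valuations (M.sub_mem hf hg) fun b hb => by
    rw [map_sub, h b hb, sub_self])

/-- Two nested spaces with the same valuations, the larger of which contains a tail of the smaller,
are equal. -/
lemma eq_of_le_of_valuations {M N : Submodule ℂ ℂ⟦X⟧} {c : ℕ} (hc : tail c ≤ M) (h : M ≤ N)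
    (hv : valuations (N : Set ℂ⟦X⟧) ⊆ valuations (M : Set ℂ⟦X⟧)) : M = N := by
  refine le_antisymm h fun f hf => ?_
  have key : ∀ n, ∃ g ∈ M, f - g ∈ tail n := by
    intro n
    induction n with
    | zero => exact ⟨0, M.zero_mem, fun k hk => by omega⟩
    | succ n ih =>
      obtain ⟨g, hg, hfg⟩ := ih
      by_cases h0 : PowerSeries.coeff n (f - g) = 0
      · refine ⟨g, hg, fun k hk => ?_⟩
        rcases Nat.lt_succ_iff_lt_or_eq.mp hk with h1 | rfl
        · exact hfg k h1
        · exact h0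
      · obtain ⟨e, he, he1, he2⟩ := exists_monic_of_mem_valuations
          (hv (mem_valuations_iff.mpr ⟨f - g, N.sub_mem hf (h hg), h0, hfg⟩))
        refine ⟨g + PowerSeries.coeff n (f - g) • e, M.add_mem hg (M.smul_mem _ he), fun k hk => ?_⟩
        rw [← sub_sub, map_sub, map_smul]
        rcases Nat.lt_succ_iff_lt_or_eq.mp hk with h1 | rfl
        · rw [hfg k h1, he2 k h1, smul_zero, sub_zero]
        · rw [he1, smul_eq_mul, mul_one, sub_self]
  obtain ⟨g, hg, hfg⟩ := key c
  have := M.add_mem hg (hc hfg)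
  rwa [add_sub_cancel] at this

/-! ### The ring `R` and its semigroup -/

/-- The generator `z^{2u} + z^v` of `R`. -/
def genY (u v : ℕ) : ℂ⟦X⟧ := PowerSeries.X ^ (2 * u) + PowerSeries.X ^ v

lemma exists_split (F : MvPowerSeries (Fin 2) ℂ) : ∃ F₁ F₂ : MvPowerSeries (Fin 2) ℂ,
    F = MvPowerSeries.C (MvPowerSeries.coeff 0 F) + MvPowerSeries.X 0 * F₁ + MvPowerSeries.X 1 * F₂ := by
  let F' : MvPowerSeries (Fin 2) ℂ := fun m => if m 0 = 0 then F m else 0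
  have hF' : ∀ m, MvPowerSeries.coeff m F' = if m 0 = 0 then MvPowerSeries.coeff m F else 0 :=
    fun m => rfl
  obtain ⟨F₁, h1⟩ : MvPowerSeries.X 0 ∣ F - F' := by
    rw [MvPowerSeries.X_dvd_iff]
    intro m hm
    rw [map_sub, hF', if_pos hm, sub_self]
  obtain ⟨F₂, h2⟩ : MvPowerSeries.X 1 ∣ F' - MvPowerSeries.C (MvPowerSeries.coeff 0 F) := by
    rw [MvPowerSeries.X_dvd_iff]
    intro m hm
    rw [map_sub, hF', MvPowerSeries.coeff_C]
    by_cases h0 : m 0 = 0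
    · have : m = 0 := by ext i; fin_cases i <;> simpa
      simp [this]
    · have : m ≠ 0 := by rintro rfl; simp at h0
      simp [h0, this]
  exact ⟨F₁, F₂, by rw [← h1, add_assoc, ← h2]; ring⟩

section

variable {u v : ℕ} (hu : 0 < u) (hv : 0 < v)

include hu hv in
lemma subst_gens_X_zero : MvPowerSeries.subst (gens u v) (MvPowerSeries.X 0 : MvPowerSeries (Fin 2) ℂ)
    = (PowerSeries.X ^ 4 : ℂ⟦X⟧) := MvPowerSeries.subst_X (hasSubst_gens hu hv) 0

include hu hv in
lemma subst_gens_X_one : MvPowerSeries.subst (gens u v) (MvPowerSeries.X 1 : MvPowerSeries (Fin 2) ℂ)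
    = genY u v := MvPowerSeries.subst_X (hasSubst_gens hu hv) 1

include hu hv in
lemma subst_gens_split (c : ℂ) (F₁ F₂ : MvPowerSeries (Fin 2) ℂ) :
    MvPowerSeries.subst (gens u v) (MvPowerSeries.C c + MvPowerSeries.X 0 * F₁ + MvPowerSeries.X 1 * F₂)
    = (PowerSeries.C c + PowerSeries.X ^ 4 * MvPowerSeries.subst (gens u v) F₁
      + genY u v * MvPowerSeries.subst (gens u v) F₂ : ℂ⟦X⟧) := by
  have h := hasSubst_gens hu hv
  have hC : MvPowerSeries.subst (gens u v) (MvPowerSeries.C (σ := Fin 2) c) = (PowerSeries.C c : ℂ⟦X⟧) := by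
    rw [← MvPowerSeries.coe_substAlgHom h]
    exact (MvPowerSeries.substAlgHom (R := ℂ) h).commutes c
  rw [MvPowerSeries.subst_add h, MvPowerSeries.subst_add h, MvPowerSeries.subst_mul h,
    MvPowerSeries.subst_mul h, subst_gens_X_zero hu hv, subst_gens_X_one hu hv, hC]

include hu hv in
/-- Up to any order, an element of `R` is a polynomial in the two generators. -/
lemma exists_adjoin_approx (N : ℕ) (F : MvPowerSeries (Fin 2) ℂ) :
    ∃ P ∈ Algebra.adjoin ℂ ({PowerSeries.X ^ 4, genY u v} : Set ℂ⟦X⟧),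
      (MvPowerSeries.subst (gens u v) F : ℂ⟦X⟧) - P ∈ tail N := by
  induction N generalizing F with
  | zero => exact ⟨0, Subalgebra.zero_mem _, fun k hk => by omega⟩
  | succ N ih =>
    obtain ⟨F₁, F₂, hF⟩ := exists_split F
    obtain ⟨P₁, hP₁, h1⟩ := ih F₁
    obtain ⟨P₂, hP₂, h2⟩ := ih F₂
    set A := Algebra.adjoin ℂ ({PowerSeries.X ^ 4, genY u v} : Set ℂ⟦X⟧)
    have hx : (PowerSeries.X ^ 4 : ℂ⟦X⟧) ∈ A := Algebra.subset_adjoin (by simp)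
    have hy : genY u v ∈ A := Algebra.subset_adjoin (by simp)
    refine ⟨PowerSeries.C (MvPowerSeries.coeff 0 F) + PowerSeries.X ^ 4 * P₁ + genY u v * P₂,
      A.add_mem (A.add_mem (A.algebraMap_mem _) (A.mul_mem hx hP₁)) (A.mul_mem hy hP₂), ?_⟩
    rw [hF, subst_gens_split hu hv, ← hF]
    have e : ∀ a b c d e f : ℂ⟦X⟧, e + a * b + c * d - (e + a * f + c * P₂) = a * (b - f) + c * (d - P₂) := by
      intros; ring
    rw [e]
    refine (tail _).add_mem ?_ ?_
    · exact tail_anti (by omega) (mul_mem_tail (X_pow_mem_tail 4) h1)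
    · rw [add_comm]
      refine mul_mem_tail (a := 1) ?_ h2
      exact (tail 1).add_mem (tail_anti (by omega) (X_pow_mem_tail _)) (tail_anti hv (X_pow_mem_tail _))

include hu hv in
lemma X_pow_four_mem : (PowerSeries.X ^ 4 : ℂ⟦X⟧) ∈ R u v :=
  (mem_R hu hv _).mpr ⟨_, subst_gens_X_zero hu hv⟩

include hu hv in
lemma genY_mem : genY u v ∈ R u v :=
  (mem_R hu hv _).mpr ⟨_, subst_gens_X_one hu hv⟩

/-- The power series `∑ φ_i X_0^i` in two variables. -/
def seriesInFirst (φ : ℕ → ℂ) : MvPowerSeries (Fin 2) ℂ := fun m => if m 1 = 0 then φ (m 0) else 0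

lemma coeff_seriesInFirst (φ : ℕ → ℂ) (m : Fin 2 →₀ ℕ) :
    MvPowerSeries.coeff m (seriesInFirst φ) = if m 1 = 0 then φ (m 0) else 0 := rfl

include hu hv in
/-- The ring `R` contains all power series in `z^4`. -/
lemma mem_R_of_support {f : ℂ⟦X⟧} (hf : ∀ k, k % 4 ≠ 0 → PowerSeries.coeff k f = 0) : f ∈ R u v := by
  have hrec : ∀ φ, seriesInFirst φ = MvPowerSeries.C (φ 0) + MvPowerSeries.X 0 * seriesInFirst (fun i => φ (i + 1)) +
      MvPowerSeries.X 1 * 0 := by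
    intro φ
    rw [mul_zero, add_zero]
    ext m
    rw [map_add, coeff_seriesInFirst, MvPowerSeries.coeff_C, MvPowerSeries.X, MvPowerSeries.coeff_monomial_mul, coeff_seriesInFirst]
    by_cases h0 : m 0 = 0
    · have : ¬ (Finsupp.single 0 1 ≤ m) := by
        intro h
        have := h 0
        simp [h0] at this
      rw [if_neg this, add_zero]
      by_cases h1 : m 1 = 0
      · have : m = 0 := by ext i; fin_cases i <;> simpa
        simp [this]
      · have : m ≠ 0 := by rintro rfl; simp at h1
        simp [h1, this]
    · have h1 : Finsupp.single 0 1 ≤ m := by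
        rw [Finsupp.single_le_iff]; omega
      have h2 : m ≠ 0 := by rintro rfl; simp at h0
      rw [if_pos h1, if_neg h2, zero_add, one_mul]
      have h3 : (m - Finsupp.single 0 1 : Fin 2 →₀ ℕ) 1 = m 1 := by simp
      have h4 : (m - Finsupp.single 0 1 : Fin 2 →₀ ℕ) 0 + 1 = m 0 := by simp; omega
      rw [h3, h4]
  have hco : ∀ k φ, PowerSeries.coeff k (MvPowerSeries.subst (gens u v) (seriesInFirst φ) : ℂ⟦X⟧) =
      if k % 4 = 0 then φ (k / 4) else 0 := by
    intro k
    induction k using Nat.strong_induction_on with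
    | _ k ih =>
    intro φ
    rw [hrec, subst_gens_split hu hv, map_add, map_add, PowerSeries.coeff_C, PowerSeries.coeff_X_pow_mul']
    have h0 : (MvPowerSeries.subst (gens u v) (0 : MvPowerSeries (Fin 2) ℂ) : ℂ⟦X⟧) = 0 := by
      rw [← MvPowerSeries.coe_substAlgHom (hasSubst_gens hu hv), map_zero]
    rw [h0, mul_zero, map_zero, add_zero]
    by_cases hk : 4 ≤ k
    · rw [if_pos hk, ih (k - 4) (by omega), if_neg (by omega : k ≠ 0), zero_add]
      have h1 : (k - 4) % 4 = k % 4 := by omega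
      have h2 : (k - 4) / 4 + 1 = k / 4 := by omega
      rw [h1, h2]
    · rw [if_neg hk, add_zero]
      by_cases hk0 : k = 0
      · simp [hk0]
      · rw [if_neg hk0, if_neg (by omega)]
  refine (mem_R hu hv f).mpr ⟨seriesInFirst fun i => PowerSeries.coeff (4 * i) f, ?_⟩
  ext k
  refine (hco k _).trans ?_
  by_cases hk : k % 4 = 0
  · rw [if_pos hk]; congr 1; congr 1; omega
  · rw [if_neg hk, hf k hk]

include hu hv in
lemma R_induction {S : Submodule ℂ ℂ⟦X⟧} {c : ℕ} (hc : tail c ≤ S)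
    (hx : ∀ f ∈ S, PowerSeries.X ^ 4 * f ∈ S) (hy : ∀ f ∈ S, genY u v * f ∈ S)
    {r : ℂ⟦X⟧} (hr : r ∈ R u v) {f : ℂ⟦X⟧} (hf : f ∈ S) : r * f ∈ S := by
  obtain ⟨F, rfl⟩ := (mem_R hu hv r).mp hr
  obtain ⟨P, hP, h⟩ := exists_adjoin_approx hu hv c F
  have hPf : ∀ P ∈ Algebra.adjoin ℂ ({PowerSeries.X ^ 4, genY u v} : Set ℂ⟦X⟧), ∀ f ∈ S, P * f ∈ S := by
    intro P hP
    induction hP using Algebra.adjoin_induction with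
    | mem P hP =>
      rcases hP with rfl | rfl
      · exact hx
      · exact hy
    | algebraMap r => intro f hf; rw [← Algebra.smul_def]; exact S.smul_mem r hf
    | add P Q _ _ hP hQ => intro f hf; rw [add_mul]; exact S.add_mem (hP f hf) (hQ f hf)
    | mul P Q _ _ hP hQ => intro f hf; rw [mul_assoc]; exact hP _ (hQ f hf)
  have h2 := S.add_mem (hPf P hP f hf) (hc (mul_mem_tail_left h f))
  rwa [← add_mul, add_sub_cancel] at h2

include hu hv in
/-- A space of power series stable under the generators of `R` that contains all power series of large
order is an `R`-module. -/
lemma exists_submodule {S : Submodule ℂ ℂ⟦X⟧} {c : ℕ} (hc : tail c ≤ S)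
    (hx : ∀ f ∈ S, PowerSeries.X ^ 4 * f ∈ S) (hy : ∀ f ∈ S, genY u v * f ∈ S) :
    ∃ M : Submodule (R u v) ℂ⟦X⟧, M.restrictScalars ℂ = S :=
  ⟨{ carrier := S
     add_mem' := S.add_mem
     zero_mem' := S.zero_mem
     smul_mem' := fun r _ hf => R_induction hu hv hc hx hy r.2 hf }, rfl⟩

lemma mul_mem_of_mem_R {M : Submodule (R u v) ℂ⟦X⟧} {r f : ℂ⟦X⟧} (hr : r ∈ R u v) (hf : f ∈ M) :
    r * f ∈ M := M.smul_mem (⟨r, hr⟩ : R u v) hf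

/-- The valuations of a module containing a unit include the semigroup. -/
lemma semigroup_subset_valuations {M : Submodule (R u v) ℂ⟦X⟧} (h0 : IsStandard M) :
    semigroup u v ⊆ valuations (M : Set ℂ⟦X⟧) := by
  rintro a ⟨r, hr, hra⟩
  obtain ⟨f, hf, hf0⟩ := h0
  exact ⟨r * f, mul_mem_of_mem_R hr hf, by rw [PowerSeries.order_mul, hra, hf0]; simp⟩

lemma add_mem_valuations {M : Submodule (R u v) ℂ⟦X⟧} {a b : ℕ} (ha : a ∈ semigroup u v)
    (hb : b ∈ valuations (M : Set ℂ⟦X⟧)) : a + b ∈ valuations (M : Set ℂ⟦X⟧) := by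
  obtain ⟨r, hr, hra⟩ := ha
  obtain ⟨f, hf, hfb⟩ := hb
  exact ⟨r * f, mul_mem_of_mem_R hr hf, by rw [PowerSeries.order_mul, hra, hfb]; simp⟩

lemma add_mem_semigroup {a b : ℕ} (ha : a ∈ semigroup u v) (hb : b ∈ semigroup u v) :
    a + b ∈ semigroup u v := by
  obtain ⟨r, hr, hra⟩ := ha
  obtain ⟨f, hf, hfb⟩ := hb
  exact ⟨r * f, (R u v).mul_mem hr hf, by rw [PowerSeries.order_mul, hra, hfb]; simp⟩

include hu hv in
lemma four_mul_mem_semigroup (k : ℕ) : 4 * k ∈ semigroup u v :=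
  ⟨_, (R u v).pow_mem (X_pow_four_mem hu hv) k, by rw [← pow_mul, PowerSeries.order_X_pow]⟩

include hu in
lemma two_mul_mem_semigroup (huv : 2 * u < v) : 2 * u ∈ semigroup u v := by
  refine mem_valuations_iff.mpr ⟨_, genY_mem hu (by omega), ?_, ?_⟩
  · rw [genY, map_add, PowerSeries.coeff_X_pow, PowerSeries.coeff_X_pow]
    simp [huv.ne]
  · intro i hi
    rw [genY, map_add, PowerSeries.coeff_X_pow, PowerSeries.coeff_X_pow]
    simp [hi.ne, (hi.trans huv).ne]

/-- The square of the second generator, minus a power of the first one. -/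
lemma genY_sq (u v : ℕ) : genY u v * genY u v - (PowerSeries.X ^ 4) ^ u =
    2 * PowerSeries.X ^ (2 * u + v) + PowerSeries.X ^ (2 * v) := by
  rw [genY]; ring

include hu in
lemma two_mul_add_mem_semigroup (huv : 2 * u < v) : 2 * u + v ∈ semigroup u v := by
  have hv : 0 < v := by omega
  refine mem_valuations_iff.mpr ⟨genY u v * genY u v - (PowerSeries.X ^ 4) ^ u,
    (R u v).sub_mem ((R u v).mul_mem (genY_mem hu hv) (genY_mem hu hv))
      ((R u v).pow_mem (X_pow_four_mem hu hv) _), ?_, ?_⟩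
  · rw [genY_sq, map_add, show (2 : ℂ⟦X⟧) = PowerSeries.C 2 from (map_ofNat _ 2).symm,
      PowerSeries.coeff_C_mul, PowerSeries.coeff_X_pow, PowerSeries.coeff_X_pow]
    have : 2 * u + v ≠ 2 * v := by omega
    simp [this]
  · intro i hi
    rw [genY_sq, map_add, show (2 : ℂ⟦X⟧) = PowerSeries.C 2 from (map_ofNat _ 2).symm,
      PowerSeries.coeff_C_mul, PowerSeries.coeff_X_pow, PowerSeries.coeff_X_pow]
    have : i ≠ 2 * v := by omega
    simp [this, hi.ne]

include hu in
end

/-- The hypotheses on the exponents. -/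
structure Exponents (u v : ℕ) : Prop where
  odd_u : Odd u
  odd_v : Odd v
  lt : 2 * u < v

namespace Exponents

variable {u v : ℕ} (E : Exponents u v)

include E

lemma u_pos : 0 < u := E.odd_u.pos
lemma v_pos : 0 < v := E.odd_v.pos
lemma u_mod : u % 2 = 1 := Nat.odd_iff.mp E.odd_u
lemma v_mod : v % 2 = 1 := Nat.odd_iff.mp E.odd_v

lemma mem_semigroup_of_four {k : ℕ} (h : k % 4 = 0) : k ∈ semigroup u v := by
  have := four_mul_mem_semigroup E.u_pos E.v_pos (k / 4)
  rwa [show 4 * (k / 4) = k by omega] at this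

lemma mem_semigroup_of_add {a k : ℕ} (ha : a ∈ semigroup u v) (hk : a ≤ k) (h : (k - a) % 4 = 0) :
    k ∈ semigroup u v := by
  have := add_mem_semigroup ha (E.mem_semigroup_of_four h)
  rwa [show a + (k - a) = k by omega] at this

lemma mem_semigroup_of_even {k : ℕ} (h : k % 2 = 0) (hk : 2 * u ≤ k) : k ∈ semigroup u v := by
  have hu := E.u_mod
  by_cases h4 : k % 4 = 0
  · exact E.mem_semigroup_of_four h4
  · exact E.mem_semigroup_of_add (two_mul_mem_semigroup E.u_pos E.lt) hk (by omega)

lemma mem_semigroup_of_large {k : ℕ} (hk : 4 * u + v ≤ k) : k ∈ semigroup u v := by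
  have hu := E.u_mod
  have hv := E.v_mod
  have h1 := two_mul_add_mem_semigroup E.u_pos E.lt
  rcases Nat.even_or_odd k with h | h
  · exact E.mem_semigroup_of_even (Nat.even_iff.mp h) (by omega)
  · have h := Nat.odd_iff.mp h
    by_cases h4 : (k - (2 * u + v)) % 4 = 0
    · exact E.mem_semigroup_of_add h1 (by omega) h4
    · exact E.mem_semigroup_of_add (add_mem_semigroup (two_mul_mem_semigroup E.u_pos E.lt) h1)
        (by omega) (by omega)

lemma gaps_finite : (gaps u v).Finite :=
  (Set.finite_lt_nat (4 * u + v)).subset fun k hk => by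
    by_contra h
    exact hk (E.mem_semigroup_of_large (not_lt.mp h))

lemma zero_mem_semigroup : 0 ∈ semigroup u v := E.mem_semigroup_of_four rfl

/-- All gaps are smaller than `2δ`: if `k` is a gap then one of `i`, `k - i` is a gap for each
`i ≤ k`. -/
lemma lt_two_delta {k : ℕ} (hk : k ∈ gaps u v) : k < 2 * delta u v := by
  classical
  let G := E.gaps_finite.toFinset
  have hG : G.card = delta u v := by rw [delta, Set.ncard_eq_toFinset_card _ E.gaps_finite]
  have hsub : Finset.range (k + 1) ⊆ G ∪ G.image fun i => k - i := by
    intro i hi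
    have hi : i < k + 1 := by simpa using hi
    rw [Finset.mem_union, Finset.mem_image]
    by_cases h : i ∈ gaps u v
    · left; simpa [G] using h
    · right
      refine ⟨k - i, ?_, by omega⟩
      rw [Set.Finite.mem_toFinset]
      intro h2
      refine hk ?_
      have := add_mem_semigroup (not_not.mp h : i ∈ semigroup u v) h2
      rwa [show i + (k - i) = k by omega] at this
  have h1 := Finset.card_le_card hsub
  have h2 := Finset.card_union_le G (G.image fun i => k - i)
  have h3 : (G.image fun i => k - i).card ≤ G.card := Finset.card_image_le
  simp only [Finset.card_range] at h1
  omega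

lemma mem_semigroup_of_two_delta {k : ℕ} (hk : 2 * delta u v ≤ k) : k ∈ semigroup u v := by
  by_contra h
  exact absurd (E.lt_two_delta h) (by omega)

end Exponents

/-- A space of power series that is stable under power series in `z^4` and has elements of all
valuations `≥ c` contains all power series of order at least `c`. -/
lemma tail_le_of_valuations {M : Submodule ℂ ℂ⟦X⟧} {c : ℕ}
    (hA : ∀ r : ℂ⟦X⟧, (∀ k, k % 4 ≠ 0 → PowerSeries.coeff k r = 0) → ∀ f ∈ M, r * f ∈ M)
    (hc : ∀ k, c ≤ k → k ∈ valuations (M : Set ℂ⟦X⟧)) : tail c ≤ M := by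
  choose e he he1 he2 using fun j : ℕ => exists_monic_of_mem_valuations (hc (c + j) (by omega))
  intro f hf
  -- `E k` is an element of order `c + k`, and only four elements of `M` are used to produce them
  let E : ℕ → ℂ⟦X⟧ := fun k => PowerSeries.X ^ (4 * (k / 4)) * e (k % 4)
  have hE1 : ∀ k, PowerSeries.coeff (c + k) (E k) = 1 := by
    intro k
    simp only [E]
    rw [show c + k = (c + k % 4) + 4 * (k / 4) by omega, PowerSeries.coeff_X_pow_mul, he1]
  have hE2 : ∀ k, E k ∈ tail (c + k) := by
    intro k
    have := mul_mem_tail (X_pow_mem_tail (4 * (k / 4))) (he2 (k % 4))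
    rwa [show 4 * (k / 4) + (c + k % 4) = c + k by omega] at this
  let r : ℕ → ℂ⟦X⟧ := fun n => Nat.rec f (fun k g => g - PowerSeries.coeff (c + k) g • E k) n
  let t : ℕ → ℂ := fun k => PowerSeries.coeff (c + k) (r k)
  have hr : ∀ k, r (k + 1) = r k - t k • E k := fun k => rfl
  have hr2 : ∀ k, r k ∈ tail (c + k) := by
    intro k
    induction k with
    | zero => exact hf
    | succ k ih =>
      intro i hi
      rw [hr, map_sub, map_smul]
      rcases Nat.lt_succ_iff_lt_or_eq.mp (show i < c + k + 1 by omega) with h | rfl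
      · rw [ih i h, hE2 k i h, smul_zero, sub_zero]
      · rw [hE1, smul_eq_mul, mul_one]; exact sub_self _
  have hsum : ∀ n, f = (∑ k ∈ Finset.range n, t k • E k) + r n := by
    intro n
    induction n with
    | zero => simp [r]
    | succ n ih => rw [Finset.sum_range_succ, hr]; rw [add_assoc, add_sub_cancel]; exact ih
  let A : ℕ → ℂ⟦X⟧ := fun j => PowerSeries.mk fun k => if k % 4 = 0 then t (k + j) else 0
  have hAsum : ∀ n, ∀ j < 4, A j * e j -
      (∑ i ∈ Finset.range n, t (4 * i + j) • E (4 * i + j)) ∈ tail (4 * n) := by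
    intro n j hj
    have h1 : A j - ∑ i ∈ Finset.range n, t (4 * i + j) • (PowerSeries.X : ℂ⟦X⟧) ^ (4 * i) ∈ tail (4 * n) := by
      intro k hk
      rw [map_sub, map_sum, PowerSeries.coeff_mk]
      simp only [map_smul, PowerSeries.coeff_X_pow, smul_eq_mul, mul_ite, mul_one, mul_zero]
      by_cases h4 : k % 4 = 0
      · rw [if_pos h4, Finset.sum_eq_single (k / 4)]
        · rw [if_pos (by omega), show 4 * (k / 4) = k by omega, sub_self]
        · intro i _ hi; rw [if_neg (by omega)]
        · intro hi; simp at hi; omega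
      · rw [if_neg h4, Finset.sum_eq_zero, sub_self]
        intro i _; rw [if_neg (by omega)]
    have h2 := mul_mem_tail_left h1 (e j)
    rw [sub_mul, Finset.sum_mul] at h2
    convert h2 using 3 with i hi
    simp only [E]
    rw [smul_mul_assoc, show (4 * i + j) / 4 = i by omega, show (4 * i + j) % 4 = j by omega]
  have hfin : f = ∑ j ∈ Finset.range 4, A j * e j := by
    rw [← sub_eq_zero]
    have : ∀ n, f - ∑ j ∈ Finset.range 4, A j * e j ∈ tail (4 * n) := by
      intro n
      have h1 : (∑ k ∈ Finset.range (4 * n), t k • E k) =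
          ∑ j ∈ Finset.range 4, ∑ i ∈ Finset.range n, t (4 * i + j) • E (4 * i + j) := by
        induction n with
        | zero => simp
        | succ n ih =>
          rw [show 4 * (n + 1) = 4 * n + 1 + 1 + 1 + 1 by ring, Finset.sum_range_succ,
            Finset.sum_range_succ, Finset.sum_range_succ, Finset.sum_range_succ, ih]
          simp only [Finset.sum_range_succ, Finset.sum_range_zero]
          ring_nf
      have h2 := hsum (4 * n)
      rw [h1] at h2
      have h3 : f - ∑ j ∈ Finset.range 4, A j * e j = r (4 * n) - ∑ j ∈ Finset.range 4, (A j * e j -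
          (∑ i ∈ Finset.range n, t (4 * i + j) • E (4 * i + j))) := by
        rw [Finset.sum_sub_distrib]
        nth_rewrite 1 [h2]
        ring
      rw [h3]
      refine (tail _).sub_mem (tail_anti (by omega) (hr2 _)) ((tail _).sum_mem fun j hj => ?_)
      exact hAsum n j (by simpa using hj)
    ext k
    rw [map_zero]
    exact this (k + 1) k (by omega)
  rw [hfin]
  refine M.sum_mem fun j _ => hA _ (fun k hk => ?_) _ (he j)
  rw [PowerSeries.coeff_mk, if_neg hk]

/-- A standard module contains all power series of order `c` if all `k ≥ c` are valuations of it. -/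
lemma tail_le_module {u v : ℕ} (E : Exponents u v) {M : Submodule (R u v) ℂ⟦X⟧} {c : ℕ}
    (hc : ∀ k, c ≤ k → k ∈ valuations (M : Set ℂ⟦X⟧)) : tail c ≤ M.restrictScalars ℂ :=
  tail_le_of_valuations (fun _ hr _ hf => mul_mem_of_mem_R (mem_R_of_support E.u_pos E.v_pos hr) hf) hc

lemma tail_le_of_isStandard {u v : ℕ} (E : Exponents u v) {M : Submodule (R u v) ℂ⟦X⟧}
    (h0 : IsStandard M) : tail (2 * delta u v) ≤ M.restrictScalars ℂ :=
  tail_le_module E fun _ hk => semigroup_subset_valuations h0 (E.mem_semigroup_of_two_delta hk)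

lemma isStandard_iff_valuations {u v : ℕ} (E : Exponents u v) {M : Submodule (R u v) ℂ⟦X⟧}
    {D : Set ℕ} (hD : D ⊆ gaps u v) :
    (IsStandard M ∧ addedGaps M = D) ↔ valuations (M : Set ℂ⟦X⟧) = semigroup u v ∪ D := by
  constructor
  · rintro ⟨h, rfl⟩
    have := semigroup_subset_valuations h
    rw [addedGaps, gaps]
    ext k
    by_cases hk : k ∈ semigroup u v
    · simp [hk, this hk]
    · simp [hk]
  · intro h
    refine ⟨by rw [IsStandard, h]; exact Or.inl E.zero_mem_semigroup, ?_⟩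
    rw [addedGaps, h, Set.inter_union_distrib_left, gaps, Set.compl_inter_self, Set.empty_union,
      Set.inter_eq_right]
    exact hD

/-! ### Reduced echelon elements and regular families -/

/-- The reduced element of `M` of order `a`: the element whose coefficient at the valuation `a` of `M`
is `1` and whose coefficients at the other valuations of `M` vanish (and `0` if there is none). -/
def red (M : Submodule ℂ ℂ⟦X⟧) (a : ℕ) : ℂ⟦X⟧ :=
  open Classical in
  if h : ∃ f ∈ M, ∀ b ∈ valuations (M : Set ℂ⟦X⟧), PowerSeries.coeff b f = if b = a then 1 else 0 then
    h.choose else 0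

lemma red_eq {M : Submodule ℂ ℂ⟦X⟧} {a : ℕ} {f : ℂ⟦X⟧} (hf : f ∈ M)
    (h : ∀ b ∈ valuations (M : Set ℂ⟦X⟧), PowerSeries.coeff b f = if b = a then 1 else 0) :
    red M a = f := by
  have hex : ∃ f ∈ M, ∀ b ∈ valuations (M : Set ℂ⟦X⟧),
      PowerSeries.coeff b f = if b = a then 1 else 0 := ⟨f, hf, h⟩
  rw [red, dif_pos hex]
  exact eq_of_coeff_valuations hex.choose_spec.1 hf fun b hb => by
    rw [hex.choose_spec.2 b hb, h b hb]

/-- A family of power series whose coefficients belong to the algebra `O` of functions. -/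
def IsRegularFamily {T : Type*} (O : Subalgebra ℂ (T → ℂ)) (F : T → ℂ⟦X⟧) : Prop :=
  ∀ k, (fun x => PowerSeries.coeff k (F x)) ∈ O

namespace IsRegularFamily

variable {T : Type*} {O : Subalgebra ℂ (T → ℂ)} {F G : T → ℂ⟦X⟧}

lemma const (f : ℂ⟦X⟧) : IsRegularFamily O fun _ => f := fun k =>
  O.algebraMap_mem (PowerSeries.coeff k f)

lemma add (hF : IsRegularFamily O F) (hG : IsRegularFamily O G) :
    IsRegularFamily O fun x => F x + G x := fun k => by
  simp only [map_add]; exact O.add_mem (hF k) (hG k)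

lemma sub (hF : IsRegularFamily O F) (hG : IsRegularFamily O G) :
    IsRegularFamily O fun x => F x - G x := fun k => by
  simp only [map_sub]; exact O.sub_mem (hF k) (hG k)

lemma smul {r : T → ℂ} (hr : r ∈ O) (hF : IsRegularFamily O F) :
    IsRegularFamily O fun x => r x • F x := fun k => by
  simp only [map_smul, smul_eq_mul]; exact O.mul_mem hr (hF k)

lemma mul (hF : IsRegularFamily O F) (hG : IsRegularFamily O G) :
    IsRegularFamily O fun x => F x * G x := fun k => by
  simp only [PowerSeries.coeff_mul]
  have : (fun x => ∑ p ∈ Finset.HasAntidiagonal.antidiagonal k, PowerSeries.coeff p.1 (F x) * PowerSeries.coeff p.2 (G x))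
      = ∑ p ∈ Finset.HasAntidiagonal.antidiagonal k, (fun x => PowerSeries.coeff p.1 (F x)) *
        (fun x => PowerSeries.coeff p.2 (G x)) := by
    funext x; simp
  rw [this]
  exact O.sum_mem fun p _ => O.mul_mem (hF _) (hG _)

lemma sum {ι : Type*} {s : Finset ι} {F : ι → T → ℂ⟦X⟧} (hF : ∀ i ∈ s, IsRegularFamily O (F i)) :
    IsRegularFamily O fun x => ∑ i ∈ s, F i x := fun k => by
  simp only [map_sum]
  have : (fun x => ∑ i ∈ s, PowerSeries.coeff k (F i x)) =
      ∑ i ∈ s, fun x => PowerSeries.coeff k (F i x) := by funext x; simp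
  rw [this]
  exact O.sum_mem fun i hi => hF i hi k

lemma inv (hF : IsRegularFamily O F) (h1 : ∀ x, PowerSeries.constantCoeff (F x) = 1) :
    IsRegularFamily O fun x => (F x)⁻¹ := fun k => by
  induction k using Nat.strong_induction_on with
  | _ k ih =>
  have hrec : ∀ x, PowerSeries.coeff k (F x)⁻¹ = _ := fun x => PowerSeries.coeff_inv k (F x)
  simp only [h1, inv_one] at hrec
  simp only [hrec]
  by_cases hk : k = 0
  · simp only [if_pos hk]; exact O.one_mem
  · simp only [if_neg hk]
    have : (fun x => -1 * ∑ p ∈ Finset.HasAntidiagonal.antidiagonal k, if p.2 < k then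
        PowerSeries.coeff p.1 (F x) * PowerSeries.coeff p.2 (F x)⁻¹ else 0) =
        -∑ p ∈ Finset.HasAntidiagonal.antidiagonal k, if p.2 < k then (fun x => PowerSeries.coeff p.1 (F x)) *
        (fun x => PowerSeries.coeff p.2 (F x)⁻¹) else 0 := by
      funext x
      simp only [neg_mul, one_mul, Pi.neg_apply, Finset.sum_apply, neg_inj]
      refine Finset.sum_congr rfl fun p _ => ?_
      split_ifs <;> rfl
    rw [this]
    refine O.neg_mem (O.sum_mem fun p _ => ?_)
    split_ifs with h
    · exact O.mul_mem (hF _) (ih _ h)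
    · exact O.zero_mem

end IsRegularFamily

/-- Gaussian elimination: from a regular family of elements of `M x` of all orders in `Δ` one obtains a
regular family of elements with prescribed coefficients at `Δ`. -/
lemma exists_regularFamily {T : Type*} {O : Subalgebra ℂ (T → ℂ)} {M : T → Submodule ℂ ℂ⟦X⟧}
    {Δ : Set ℕ} {c : ℕ} (hc : ∀ x, tail c ≤ M x) {e : ℕ → T → ℂ⟦X⟧}
    (he : ∀ a ∈ Δ, a < c → IsRegularFamily O (e a) ∧
      ∀ x, e a x ∈ M x ∧ PowerSeries.coeff a (e a x) = 1 ∧ e a x ∈ tail a)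
    {φ : ℕ → T → ℂ} (hφ : ∀ b, φ b ∈ O) :
    ∃ h : T → ℂ⟦X⟧, IsRegularFamily O h ∧
      ∀ x, h x ∈ M x ∧ ∀ b ∈ Δ, PowerSeries.coeff b (h x) = φ b x := by
  have key : ∀ n ≤ c, ∃ h : T → ℂ⟦X⟧, IsRegularFamily O h ∧
      ∀ x, h x ∈ M x ∧ ∀ b ∈ Δ, b < n → PowerSeries.coeff b (h x) = φ b x := by
    intro n
    induction n with
    | zero => exact fun _ => ⟨fun _ => 0, IsRegularFamily.const 0, fun x => ⟨(M x).zero_mem, by simp⟩⟩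
    | succ n ih =>
      intro hn
      obtain ⟨h, hreg, hh⟩ := ih (by omega)
      by_cases hnΔ : n ∈ Δ
      · obtain ⟨he1, he2⟩ := he n hnΔ hn
        refine ⟨fun x => h x + (φ n x - PowerSeries.coeff n (h x)) • e n x,
          hreg.add (IsRegularFamily.smul (O.sub_mem (hφ n) (hreg n)) he1), fun x => ⟨?_, ?_⟩⟩
        · exact (M x).add_mem (hh x).1 ((M x).smul_mem _ (he2 x).1)
        · intro b hb hbn
          rw [map_add, map_smul]
          rcases Nat.lt_succ_iff_lt_or_eq.mp hbn with h1 | rfl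
          · rw [(he2 x).2.2 b h1, smul_zero, add_zero, (hh x).2 b hb h1]
          · rw [(he2 x).2.1, smul_eq_mul, mul_one, add_sub_cancel]
      · refine ⟨h, hreg, fun x => ⟨(hh x).1, fun b hb hbn => (hh x).2 b hb ?_⟩⟩
        rcases Nat.lt_succ_iff_lt_or_eq.mp hbn with h1 | rfl
        · exact h1
        · exact absurd hb hnΔ
  obtain ⟨h, hreg, hh⟩ := key c le_rfl
  refine ⟨fun x => h x + PowerSeries.mk fun k => if k < c then 0 else φ k x - PowerSeries.coeff k (h x),
    hreg.add fun k => ?_, fun x => ⟨(M x).add_mem (hh x).1 (hc x fun k hk => ?_), fun b hb => ?_⟩⟩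
  · simp only [PowerSeries.coeff_mk]
    by_cases hk : k < c
    · simp only [if_pos hk]; exact O.zero_mem
    · simp only [if_neg hk]; exact O.sub_mem (hφ k) (hreg k)
  · rw [PowerSeries.coeff_mk, if_pos hk]
  · rw [map_add, PowerSeries.coeff_mk]
    by_cases hk : b < c
    · rw [if_pos hk, add_zero, (hh x).2 b hb hk]
    · rw [if_neg hk, add_sub_cancel]

lemma exists_mem_of_coeff {M : Submodule ℂ ℂ⟦X⟧} {c : ℕ} (hc : tail c ≤ M) (φ : ℕ → ℂ) :
    ∃ f ∈ M, ∀ b ∈ valuations (M : Set ℂ⟦X⟧), PowerSeries.coeff b f = φ b := by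
  have h : ∀ a, ∃ f : ℂ⟦X⟧, a ∈ valuations (M : Set ℂ⟦X⟧) →
      f ∈ M ∧ PowerSeries.coeff a f = 1 ∧ f ∈ tail a := by
    intro a
    by_cases ha : a ∈ valuations (M : Set ℂ⟦X⟧)
    · obtain ⟨f, hf⟩ := exists_monic_of_mem_valuations ha
      exact ⟨f, fun _ => hf⟩
    · exact ⟨0, fun h => absurd h ha⟩
  choose e he using h
  obtain ⟨h, -, hh⟩ := exists_regularFamily (T := Unit) (O := ⊤) (M := fun _ => M)
    (Δ := valuations (M : Set ℂ⟦X⟧)) (fun _ => hc) (e := fun a _ => e a) (φ := fun b _ => φ b)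
    (fun a ha _ => ⟨fun _ => Algebra.mem_top, fun _ => he a ha⟩) (fun _ => Algebra.mem_top)
  exact ⟨h (), (hh ()).1, (hh ()).2⟩

lemma regularFamily_red {T : Type*} {O : Subalgebra ℂ (T → ℂ)} {M : T → Submodule ℂ ℂ⟦X⟧}
    {Δ : Set ℕ} {c : ℕ} (hc : ∀ x, tail c ≤ M x) (hΔ : ∀ x, valuations (M x : Set ℂ⟦X⟧) = Δ)
    {e : ℕ → T → ℂ⟦X⟧} (he : ∀ a ∈ Δ, a < c → IsRegularFamily O (e a) ∧
      ∀ x, e a x ∈ M x ∧ PowerSeries.coeff a (e a x) = 1 ∧ e a x ∈ tail a) (a : ℕ) :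
    IsRegularFamily O fun x => red (M x) a := by
  obtain ⟨h, hreg, hh⟩ := exists_regularFamily hc he (φ := fun b _ => if b = a then 1 else 0)
    fun b => O.algebraMap_mem (if b = a then 1 else 0)
  have : (fun x => red (M x) a) = h :=
    funext fun x => red_eq (hh x).1 fun b hb => (hh x).2 b (hΔ x ▸ hb)
  rwa [this]

lemma red_eq_zero {M : Submodule ℂ ℂ⟦X⟧} {a : ℕ} (ha : a ∉ valuations (M : Set ℂ⟦X⟧)) : red M a = 0 :=
  red_eq M.zero_mem fun b hb => by
    rw [map_zero, if_neg]; rintro rfl; exact ha hb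

section

variable {M : Submodule ℂ ℂ⟦X⟧} {c : ℕ} (hc : tail c ≤ M)

include hc

lemma red_spec (a : ℕ) : red M a ∈ M ∧ ∀ b ∈ valuations (M : Set ℂ⟦X⟧),
    PowerSeries.coeff b (red M a) = if b = a then 1 else 0 := by
  obtain ⟨f, hf, h⟩ := exists_mem_of_coeff hc fun b => if b = a then 1 else 0
  rw [red_eq hf h]
  exact ⟨hf, h⟩

lemma red_mem (a : ℕ) : red M a ∈ M := (red_spec hc a).1

lemma coeff_red {a b : ℕ} (hb : b ∈ valuations (M : Set ℂ⟦X⟧)) :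
    PowerSeries.coeff b (red M a) = if b = a then 1 else 0 := (red_spec hc a).2 b hb

lemma red_mem_tail (a : ℕ) : red M a ∈ tail a := by
  by_cases ha : a ∈ valuations (M : Set ℂ⟦X⟧)
  · by_contra h
    have h0 : red M a ≠ 0 := by
      intro h0
      have := coeff_red hc (a := a) ha
      rw [h0] at this
      simp at this
    rw [mem_tail] at h
    push Not at h
    obtain ⟨k, hk, hk0⟩ := h
    have h1 := PowerSeries.coeff_order h0
    have h2 : (red M a).order.toNat ∈ valuations (M : Set ℂ⟦X⟧) :=
      mem_valuations_iff.mpr ⟨_, red_mem hc a, h1, fun i hi => PowerSeries.coeff_of_lt_order_toNat i hi⟩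
    rw [coeff_red hc h2] at h1
    have h3 : (red M a).order.toNat = a := by by_contra h3; exact h1 (if_neg h3)
    exact hk0 (PowerSeries.coeff_of_lt_order_toNat k (by omega))
  · rw [red_eq_zero ha]; exact (tail a).zero_mem

lemma red_of_le {a : ℕ} (ha : c ≤ a) : red M a = PowerSeries.X ^ a :=
  red_eq (hc (tail_anti ha (X_pow_mem_tail a))) fun b _ => by rw [PowerSeries.coeff_X_pow]

end

/-- The algebra generated by the coefficients of the reduced elements of a family of (finite tuples of)
spaces of power series. -/
def coordAlg {T I : Type*} (M : T → I → Submodule ℂ ℂ⟦X⟧) : Subalgebra ℂ (T → ℂ) :=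
  Algebra.adjoin ℂ {f | ∃ i a k, f = fun x => PowerSeries.coeff k (red (M x i) a)}

lemma regularFamily_red_coordAlg {T I : Type*} (M : T → I → Submodule ℂ ℂ⟦X⟧) (i : I) (a : ℕ) :
    IsRegularFamily (coordAlg M) fun x => red (M x i) a :=
  fun k => Algebra.subset_adjoin ⟨i, a, k, rfl⟩

/-- Pulling back `coordAlg`: it suffices to control the reduced elements. -/
lemma comp_mem_of_mem_coordAlg {T Z I : Type*} {M : T → I → Submodule ℂ ℂ⟦X⟧} {y : Z → T}
    {O : Subalgebra ℂ (Z → ℂ)} (h : ∀ i a, IsRegularFamily O fun z => red (M (y z) i) a)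
    {f : T → ℂ} (hf : f ∈ coordAlg M) : (fun z => f (y z)) ∈ O := by
  induction hf using Algebra.adjoin_induction with
  | mem f hf => obtain ⟨i, a, k, rfl⟩ := hf; exact h i a k
  | algebraMap r => exact O.algebraMap_mem r
  | add f g _ _ hf hg => exact O.add_mem hf hg
  | mul f g _ _ hf hg => exact O.mul_mem hf hg

/-! ### Plücker coordinates in terms of reduced elements -/

lemma exists_plucker_eq {c k : ℕ} {W : Submodule ℂ (Fin c → ℂ)} {H : Fin k → Fin c → ℂ}
    (hli : LinearIndependent ℂ H) (hsp : Submodule.span ℂ (Set.range H) = W) :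
    ∃ r : ℂ, r ≠ 0 ∧ ∀ S : Fin k ↪o Fin c,
      plucker k W S = r * Matrix.det (Matrix.of fun i j : Fin k => H i (S j)) := by
  subst hsp
  set W := Submodule.span ℂ (Set.range H)
  let b := Module.Basis.span hli
  have hr : Module.finrank ℂ W = k := by
    rw [Module.finrank_eq_card_basis b, Fintype.card_fin]
  let B := Module.finBasisOfFinrankEq ℂ W hr
  let g : Matrix (Fin k) (Fin k) ℂ := (b.toMatrix B).transpose
  refine ⟨g.det, ?_, fun S => ?_⟩
  · rw [Matrix.det_transpose]
    have := b.invertibleToMatrix B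
    exact (Matrix.isUnit_det_of_invertible (b.toMatrix B)).ne_zero
  · rw [plucker, dif_pos hr, ← Matrix.det_mul]
    congr 1
    ext i j
    rw [Matrix.mul_apply, Matrix.of_apply]
    have h1 := b.sum_toMatrix_smul_self (B) i
    have h2 := congrFun (congrArg (Subtype.val) h1) (S j)
    rw [← h2]
    simp only [Matrix.of_apply, Matrix.transpose_apply, g, Submodule.coe_sum, Finset.sum_apply,
      Submodule.coe_smul, Pi.smul_apply, smul_eq_mul]
    refine Finset.sum_congr rfl fun l _ => ?_
    rw [Module.Basis.span_apply]

lemma exists_orderEmb_of_injective {k c : ℕ} {f : Fin k → Fin c} (hf : Function.Injective f) :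
    ∃ (S : Fin k ↪o Fin c) (σ : Equiv.Perm (Fin k)), ∀ j, S j = f (σ j) := by
  refine ⟨OrderEmbedding.ofStrictMono (f ∘ Tuple.sort f)
    ((Tuple.monotone_sort f).strictMono_of_injective (hf.comp (Tuple.sort f).injective)),
    Tuple.sort f, fun j => rfl⟩

/-! ### Cells with polynomial coordinates are isomorphic to affine spaces -/

lemma mem_tail_of_coeff {M : Submodule ℂ ℂ⟦X⟧} {f : ℂ⟦X⟧} (hf : f ∈ M) {c : ℕ}
    (h : ∀ b ∈ valuations (M : Set ℂ⟦X⟧), b < c → PowerSeries.coeff b f = 0) : f ∈ tail c := by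
  intro k
  induction k using Nat.strong_induction_on with
  | _ k ih =>
  intro hk
  by_contra h0
  exact h0 (h k (mem_valuations_iff.mpr ⟨f, hf, h0, fun i hi => ih i hi (hi.trans hk)⟩) hk)

lemma coeff_truncation (c : ℕ) (f : ℂ⟦X⟧) (j : Fin c) :
    truncation c f j = PowerSeries.coeff (j : ℕ) f := rfl

/-- The truncated reduced elements of orders less than `c` form a basis of the image of `M` in
`ℂ[[z]]/(z^c)`. -/
lemma linearIndependent_truncation_red {M : Submodule ℂ ℂ⟦X⟧} {c k : ℕ} (hc : tail c ≤ M)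
    (s : Fin k ↪o Fin c) (hs : ∀ j : Fin c, (j : ℕ) ∈ valuations (M : Set ℂ⟦X⟧) ↔ j ∈ Set.range s) :
    LinearIndependent ℂ (fun a : Fin k => truncation c (red M (s a))) ∧
    Submodule.span ℂ (Set.range fun a : Fin k => truncation c (red M (s a))) = M.map (truncation c) := by
  have hco : ∀ a b, PowerSeries.coeff (s b : ℕ) (red M (s a)) = if b = a then 1 else 0 := by
    intro a b
    rw [coeff_red hc ((hs _).mpr ⟨b, rfl⟩)]
    simp only [Fin.val_inj, EmbeddingLike.apply_eq_iff_eq]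
  constructor
  · rw [Fintype.linearIndependent_iff]
    intro r hr b
    have := congrFun hr (s b)
    rw [Finset.sum_apply, Finset.sum_eq_single b] at this
    · simpa [coeff_truncation, hco] using this
    · intro a _ hab
      simp [coeff_truncation, hco, hab.symm]
    · simp
  · apply le_antisymm
    · rw [Submodule.span_le]
      rintro _ ⟨a, rfl⟩
      exact ⟨_, red_mem hc _, rfl⟩
    · rintro _ ⟨f, hf, rfl⟩
      have h1 : f - ∑ a, PowerSeries.coeff (s a : ℕ) f • red M (s a) ∈ tail c := by
        refine mem_tail_of_coeff (M := M) (M.sub_mem hf (M.sum_mem fun a _ => M.smul_mem _ (red_mem hc _))) ?_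
        intro b hb hbc
        obtain ⟨a, ha⟩ := (hs ⟨b, hbc⟩).mp hb
        have hab : (s a : ℕ) = b := congrArg Fin.val ha
        rw [map_sub, map_sum, ← hab, Finset.sum_eq_single a]
        · simp [hco]
        · intro a' _ ha'
          simp [hco, ha'.symm]
        · simp
      have h2 : truncation c f = ∑ a, PowerSeries.coeff (s a : ℕ) f • truncation c (red M (s a)) := by
        have h3 : truncation c (f - ∑ a, PowerSeries.coeff (s a : ℕ) f • red M (s a)) = 0 := by
          funext j
          exact h1 j j.2
        rw [map_sub, map_sum, sub_eq_zero] at h3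
        simpa using h3
      rw [h2]
      exact Submodule.sum_mem _ fun a _ => Submodule.smul_mem _ _ (Submodule.subset_span ⟨a, rfl⟩)

lemma card_filter_fin {n : ℕ} {A : Set ℕ} [DecidablePred (· ∈ A)] (hA : ∀ k ∈ A, k < n) :
    (Finset.univ.filter fun j : Fin n => (j : ℕ) ∈ A).card = A.ncard := by
  have : A = Fin.val '' {j : Fin n | (j : ℕ) ∈ A} := by
    ext k
    constructor
    · intro hk; exact ⟨⟨k, hA k hk⟩, hk, rfl⟩
    · rintro ⟨j, hj, rfl⟩; exact hj
  conv_rhs => rw [this]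
  rw [Set.ncard_image_of_injective _ Fin.val_injective, ← Set.ncard_coe_finset]
  congr 1
  ext j
  simp

variable {u v : ℕ}

/-- The number of valuations less than `2δ` of a standard module with the set `D` of added gaps. -/
lemma card_filter_valuations (E : Exponents u v) {D : Set ℕ} (hD : D ⊆ gaps u v)
    [DecidablePred (· ∈ semigroup u v ∪ D)] :
    (Finset.univ.filter fun j : Fin (2 * delta u v) => (j : ℕ) ∈ semigroup u v ∪ D).card =
      delta u v + D.ncard := by
  classical
  have h1 : (Finset.univ.filter fun j : Fin (2 * delta u v) => (j : ℕ) ∈ gaps u v).card = delta u v :=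
    card_filter_fin fun k hk => E.lt_two_delta hk
  have h2 : (Finset.univ.filter fun j : Fin (2 * delta u v) => (j : ℕ) ∈ D).card = D.ncard :=
    card_filter_fin fun k hk => E.lt_two_delta (hD hk)
  have h3 := Finset.card_filter_add_card_filter_not (s := Finset.univ)
    (fun j : Fin (2 * delta u v) => (j : ℕ) ∈ gaps u v)
  have h4 : (Finset.univ.filter fun j : Fin (2 * delta u v) => (j : ℕ) ∈ semigroup u v ∪ D) =
      (Finset.univ.filter fun j : Fin (2 * delta u v) => ¬ (j : ℕ) ∈ gaps u v) ∪
      (Finset.univ.filter fun j : Fin (2 * delta u v) => (j : ℕ) ∈ D) := by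
    ext j
    simp [gaps]
  rw [h4, Finset.card_union_of_disjoint, h2]
  · simp only [Finset.card_univ, Fintype.card_fin] at h3
    omega
  · rw [Finset.disjoint_filter]
    intro j _ hj hj2
    exact hj (hD hj2)

lemma dset_subset_gaps {m : ℕ} {D : Set ℕ} {g : Fin m → ℕ} (hD : IsDFlag u v D g) (i : Fin (m + 1)) :
    dset D g i ⊆ gaps u v := by
  rintro k (hk | ⟨j, -, rfl⟩)
  · exact hD.subset_gaps hk
  · exact (hD.mem_gaps j).1

lemma valuations_flagCell (E : Exponents u v) {m : ℕ} {D : Set ℕ} {g : Fin m → ℕ}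
    (hD : IsDFlag u v D g) (F : FlagCell u v D g) (i : Fin (m + 1)) :
    valuations (F.1 i : Set ℂ⟦X⟧) = semigroup u v ∪ dset D g i :=
  (isStandard_iff_valuations E (dset_subset_gaps hD i)).mp (F.2.2 i)

/-- The algebra of regular functions on a flagged cell. -/
def flagAlg (u v : ℕ) {m : ℕ} (D : Set ℕ) (g : Fin m → ℕ) : Subalgebra ℂ (FlagCell u v D g → ℂ) :=
  coordAlg fun F i => (F.1 i).restrictScalars ℂ

lemma Coordinates.coord_div_mem_fractions {T : Type} (A : Coordinates T) (s t : A.Idx)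
    (hst : A.weight s = A.weight t) (h0 : ∀ x, A.coord x t ≠ 0) (c : ℂ) :
    (fun x => c * (A.coord x s / A.coord x t)) ∈ A.fractions := by
  refine Subalgebra.mul_mem _ (Subalgebra.algebraMap_mem _ c) ⟨A.weight t, MvPolynomial.X s, MvPolynomial.X t,
    hst ▸ MvPolynomial.isWeightedHomogeneous_X ℂ A.weight s,
    MvPolynomial.isWeightedHomogeneous_X ℂ A.weight t, fun x => ?_, fun x => ?_⟩
  · rw [MvPolynomial.eval_X]; exact h0 x
  · rw [MvPolynomial.eval_X, MvPolynomial.eval_X]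

/-- If `k` is not a valuation of `M` then each coefficient at `z^k` of a reduced element is, up to sign,
a maximal minor of the reduced echelon matrix: replace one pivot column by the `k`-th one. -/
lemma exists_minor_eq_coeff_red {M : Submodule ℂ ℂ⟦X⟧} {c k : ℕ} (hc : tail c ≤ M) (s : Fin k ↪o Fin c)
    (hs : ∀ j : Fin c, (j : ℕ) ∈ valuations (M : Set ℂ⟦X⟧) ↔ j ∈ Set.range s)
    (S : Fin k ↪o Fin c) (σ : Equiv.Perm (Fin k)) (i₀ : Fin k) (l : Fin c)
    (hS : ∀ j, S j = Function.update s i₀ l (σ j)) :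
    (Equiv.Perm.sign σ : ℂ) * Matrix.det (Matrix.of fun i j : Fin k =>
      truncation c (red M (s i)) (S j)) = PowerSeries.coeff (l : ℕ) (red M (s i₀)) := by
  have h1 : (Matrix.of fun i j : Fin k => truncation c (red M (s i)) (S j)) =
      ((1 : Matrix (Fin k) (Fin k) ℂ).updateCol i₀
        fun i => PowerSeries.coeff (l : ℕ) (red M (s i))).submatrix id σ := by
    ext i j
    rw [Matrix.of_apply, Matrix.submatrix_apply, hS, coeff_truncation, id, Matrix.updateCol_apply,
      Function.update_apply]
    split_ifs with h
    · rfl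
    · rw [coeff_red hc ((hs _).mpr ⟨_, rfl⟩), Matrix.one_apply]
      simp only [Fin.val_inj, EmbeddingLike.apply_eq_iff_eq, eq_comm]
  rw [h1, Matrix.det_permute', ← mul_assoc, ← Matrix.cramer_apply, Matrix.cramer_one]
  have : ((Equiv.Perm.sign σ : ℤ) : ℂ) * ((Equiv.Perm.sign σ : ℤ) : ℂ) = 1 := by
    rw [← Int.cast_mul, Int.units_coe_mul_self, Int.cast_one]
  rw [this, one_mul]
  rfl

/-- A flagged cell whose algebra of echelon coordinates is a polynomial algebra is isomorphic to an
affine space: on the cell, the Plücker coordinates are polynomials in the echelon coordinates up to a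
common scalar, and the echelon coordinates are quotients of Plücker coordinates by the nonvanishing one
belonging to the pivots. -/
theorem isomorphic_of_isAffineCell (E : Exponents u v) {m : ℕ} {D : Set ℕ} {g : Fin m → ℕ}
    (hD : IsDFlag u v D g) {N : ℕ} (h : IsAffineCell (flagAlg u v D g) N) :
    (flagCellVariety u v D g).Isomorphic (affineSpace N) := by
  classical
  obtain ⟨e, he1, he2⟩ := h
  have hv := valuations_flagCell E hD
  have ht : ∀ (F : FlagCell u v D g) i, tail (2 * delta u v) ≤ (F.1 i).restrictScalars ℂ :=
    fun F i => tail_le_of_isStandard E (F.2.2 i).1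
  let s : ∀ i : Fin (m + 1), Fin (delta u v + (dset D g i).ncard) ↪o Fin (2 * delta u v) := fun i =>
    (Finset.univ.filter fun j : Fin (2 * delta u v) =>
      (j : ℕ) ∈ semigroup u v ∪ dset D g i).orderEmbOfFin
        (card_filter_valuations E (dset_subset_gaps hD i))
  have hs : ∀ (F : FlagCell u v D g) i (j : Fin (2 * delta u v)),
      (j : ℕ) ∈ valuations (((F.1 i).restrictScalars ℂ : Submodule ℂ ℂ⟦X⟧) : Set ℂ⟦X⟧) ↔
        j ∈ Set.range (s i) := by
    intro F i j
    rw [Finset.range_orderEmbOfFin, Submodule.coe_restrictScalars, hv]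
    simp
  let T' : ∀ i, (Fin (delta u v + (dset D g i).ncard) ↪o Fin (2 * delta u v)) → FlagCell u v D g → ℂ :=
    fun i S F => Matrix.det (Matrix.of fun a b => truncation (2 * delta u v)
      (red ((F.1 i).restrictScalars ℂ) (s i a)) (S b))
  have hT' : ∀ i S, T' i S ∈ flagAlg u v D g := by
    intro i S
    have : T' i S = ∑ σ : Equiv.Perm (Fin (delta u v + (dset D g i).ncard)),
        algebraMap ℂ (FlagCell u v D g → ℂ) (Equiv.Perm.sign σ : ℂ) *
        ∏ a, fun F : FlagCell u v D g => PowerSeries.coeff (S a : ℕ) (red ((F.1 i).restrictScalars ℂ) (s i (σ a))) := by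
      funext F
      simp only [T', Matrix.det_apply, Finset.sum_apply, Pi.mul_apply, Finset.prod_apply]
      refine Finset.sum_congr rfl fun σ _ => ?_
      rw [Units.smul_def, zsmul_eq_mul]
      rfl
    rw [this]
    refine Subalgebra.sum_mem _ fun σ _ => Subalgebra.mul_mem _ (Subalgebra.algebraMap_mem _ _)
      (Subalgebra.prod_mem _ fun a _ => ?_)
    exact regularFamily_red_coordAlg (fun (F : FlagCell u v D g) i => (F.1 i).restrictScalars ℂ) i _ _
  choose T hT using fun i S => mem_polyFun_iff.mp (he2 _ (hT' i S))
  have hpl : ∀ (F : FlagCell u v D g) i, ∃ r : ℂ, r ≠ 0 ∧ ∀ S, plucker _ (imageMod (F.1 i)) S = r * T' i S F := by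
    intro F i
    obtain ⟨h1, h2⟩ := linearIndependent_truncation_red (ht F i) (s i) (hs F i)
    exact exists_plucker_eq h1 h2
  choose r hr0 hr using hpl
  have hpivot : ∀ (F : FlagCell u v D g) i, T' i (s i) F = 1 := by
    intro F i
    have : (Matrix.of fun a b => truncation (2 * delta u v)
      (red ((F.1 i).restrictScalars ℂ) (s i a)) (s i b)) = 1 := by
      ext a b
      rw [Matrix.of_apply, coeff_truncation, coeff_red (ht F i) ((hs F i _).mpr ⟨b, rfl⟩), Matrix.one_apply]
      simp only [Fin.val_inj, EmbeddingLike.apply_eq_iff_eq, eq_comm]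
    simp only [T', this, Matrix.det_one]
  let : Fintype (flagCellVariety u v D g).Factor := inferInstanceAs (Fintype (Fin (m + 1)))
  refine Coordinates.isomorphic_affineSpace (flagCellVariety u v D g) e (fun F i => r F i) (fun F i => hr0 F i)
    (fun S => T S.1 S.2) ?_ ?_
  · rintro F ⟨i, S⟩
    have h1 : (∏ l : Fin (m + 1), r F l ^ (Pi.single i 1 : Fin (m + 1) → ℕ) l) = r F i := by
      rw [Finset.prod_eq_single i]
      · simp
      · intro l _ hl; simp [hl]
      · simp
    have h2 : MvPolynomial.eval (e F) (T i S) = T' i S F := by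
      rw [← hT, Equiv.symm_apply_apply]
    change plucker _ (imageMod (F.1 i)) S =
      (∏ l : Fin (m + 1), r F l ^ (Pi.single i 1 : Fin (m + 1) → ℕ) l) * MvPolynomial.eval (e F) (T i S)
    rw [hr, h2, h1]
  · intro j
    refine (Algebra.adjoin_le ?_ : flagAlg u v D g ≤ _) (he1 j)
    rintro _ ⟨i, a, k, rfl⟩
    have hconst : ∀ c : ℂ, (∀ F : FlagCell u v D g, PowerSeries.coeff k (red ((F.1 i).restrictScalars ℂ) a) = c) →
        (fun F : FlagCell u v D g => PowerSeries.coeff k (red ((F.1 i).restrictScalars ℂ) a)) ∈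
          (flagCellVariety u v D g).fractions := by
      intro c hc
      rw [show (fun F : FlagCell u v D g => PowerSeries.coeff k (red ((F.1 i).restrictScalars ℂ) a)) =
        algebraMap ℂ _ c from funext hc]
      exact Subalgebra.algebraMap_mem _ _
    by_cases ha : a ∈ semigroup u v ∪ dset D g i
    swap
    · refine hconst 0 fun F => ?_
      rw [red_eq_zero (by rwa [Submodule.coe_restrictScalars, hv]), map_zero]
    by_cases hk : k ∈ semigroup u v ∪ dset D g i
    · exact hconst (if k = a then 1 else 0) fun F =>
        coeff_red (ht F i) (by rwa [Submodule.coe_restrictScalars, hv])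
    have hkc : k < 2 * delta u v := E.lt_two_delta fun h => hk (Or.inl h)
    by_cases hac : 2 * delta u v ≤ a
    · exact hconst (PowerSeries.coeff k (PowerSeries.X ^ a)) fun F => by rw [red_of_le (ht F i) hac]
    obtain ⟨i₀, hi₀⟩ : ∃ i₀, s i i₀ = ⟨a, not_le.mp hac⟩ := by
      have : (⟨a, not_le.mp hac⟩ : Fin (2 * delta u v)) ∈ Set.range (s i) := by
        rw [Finset.range_orderEmbOfFin]; simpa using ha
      exact this
    have hkr : (⟨k, hkc⟩ : Fin (2 * delta u v)) ∉ Set.range (s i) := by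
      rw [Finset.range_orderEmbOfFin]; simpa using hk
    obtain ⟨S, σ, hS⟩ := exists_orderEmb_of_injective
      (f := Function.update (s i) i₀ ⟨k, hkc⟩) (by
        intro a b hab
        simp only [Function.update_apply] at hab
        split_ifs at hab with h1 h2 h2
        · rw [h1, h2]
        · exact absurd ⟨b, hab.symm⟩ hkr
        · exact absurd ⟨a, hab⟩ hkr
        · exact (s i).injective hab)
    have h1 := (flagCellVariety u v D g).coord_div_mem_fractions ⟨i, S⟩ ⟨i, s i⟩ rfl
      (fun F => by
        change plucker _ (imageMod (F.1 i)) (s i) ≠ 0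
        rw [hr, hpivot, mul_one]
        exact hr0 F i) (Equiv.Perm.sign σ : ℂ)
    refine (congrArg (· ∈ (flagCellVariety u v D g).fractions) ?_).mpr h1
    funext F
    have h2 := exists_minor_eq_coeff_red (ht F i) (s i) (hs F i) S σ i₀ ⟨k, hkc⟩ hS
    rw [hi₀] at h2
    change PowerSeries.coeff k (red ((F.1 i).restrictScalars ℂ) a) = (Equiv.Perm.sign σ : ℂ) *
      (plucker _ (imageMod (F.1 i)) S / plucker _ (imageMod (F.1 i)) (s i))
    rw [hr, hr, hpivot, mul_one, mul_div_cancel_left₀ _ (hr0 F i)]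
    exact h2.symm

/-! ### Adding one valuation to a module -/

section AddValuation

variable {M M' : Submodule ℂ ℂ⟦X⟧} {g c : ℕ} (hc : tail c ≤ M) (hle : M ≤ M')
  (hv : valuations (M' : Set ℂ⟦X⟧) = valuations (M : Set ℂ⟦X⟧) ∪ {g})

include hc hle hv

lemma mem_of_mem_tail_succ {f : ℂ⟦X⟧} (hf : f ∈ M') (hg : f ∈ tail (g + 1)) : f ∈ M := by
  obtain ⟨h, hh, hb⟩ := exists_mem_of_coeff hc fun b => PowerSeries.coeff b f
  have h1 : h ∈ tail (g + 1) := mem_tail_of_coeff hh fun b hbv hbg => by rw [hb b hbv]; exact hg b hbg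
  have h2 : f - h = 0 := by
    refine eq_zero_of_coeff_valuations (M'.sub_mem hf (hle hh)) fun b hbv => ?_
    rw [map_sub]
    rw [hv] at hbv
    rcases hbv with hbv | rfl
    · rw [hb b hbv, sub_self]
    · rw [hg _ (Nat.lt_succ_self _), h1 _ (Nat.lt_succ_self _), sub_self]
  rw [sub_eq_zero.mp h2]
  exact hh

lemma exists_eq_add_smul_red (hgM : g ∉ valuations (M : Set ℂ⟦X⟧)) {m : ℂ⟦X⟧} (hm : m ∈ M') :
    ∃ h ∈ M, ∃ r : ℂ, m = h + r • red M' g := by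
  obtain ⟨h, hh, hb⟩ := exists_mem_of_coeff hc fun b => PowerSeries.coeff b m
  have hc' := hc.trans hle
  refine ⟨h, hh, PowerSeries.coeff g (m - h), ?_⟩
  rw [← sub_eq_iff_eq_add']
  refine eq_of_coeff_valuations (M'.sub_mem hm (hle hh)) (M'.smul_mem _ (red_mem hc' g)) fun b hbv => ?_
  rw [map_smul, coeff_red hc' hbv, smul_eq_mul]
  rw [hv] at hbv
  rcases hbv with hbv | rfl
  · rw [if_neg (by rintro rfl; exact hgM hbv), mul_zero, map_sub, hb b hbv, sub_self]
  · rw [if_pos rfl, mul_one]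

lemma le_of_red_mem (hgM : g ∉ valuations (M : Set ℂ⟦X⟧)) {M'' : Submodule ℂ ℂ⟦X⟧} (hle' : M ≤ M'')
    (h : red M' g ∈ M'') : M' ≤ M'' := by
  intro m hm
  obtain ⟨h, hh, r, rfl⟩ := exists_eq_add_smul_red hc hle hv hgM hm
  exact M''.add_mem (hle' hh) (M''.smul_mem _ ‹_›)

end AddValuation

/-- Division by `z^4` (discarding the terms of order less than `4`). -/
def divFour (f : ℂ⟦X⟧) : ℂ⟦X⟧ := PowerSeries.mk fun k => PowerSeries.coeff (k + 4) f

lemma coeff_divFour (f : ℂ⟦X⟧) (k : ℕ) : PowerSeries.coeff k (divFour f) = PowerSeries.coeff (k + 4) f :=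
  PowerSeries.coeff_mk _ _

lemma X_pow_four_mul_divFour {f : ℂ⟦X⟧} (hf : f ∈ tail 4) : PowerSeries.X ^ 4 * divFour f = f := by
  ext k
  rw [PowerSeries.coeff_X_pow_mul']
  split_ifs with h
  · rw [coeff_divFour, Nat.sub_add_cancel h]
  · exact (hf k (not_le.mp h)).symm

lemma divFour_X_pow_four_mul (f : ℂ⟦X⟧) : divFour (PowerSeries.X ^ 4 * f) = f := by
  ext k
  rw [coeff_divFour, PowerSeries.coeff_X_pow_mul]

/-- The general candidate for `z^4 f`, where `f` is the reduced element of the new order `g`. -/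
def stepElem (M : Submodule ℂ ℂ⟦X⟧) (g : ℕ) (K : Finset ℕ) (r : K → ℂ) : ℂ⟦X⟧ :=
  red M (g + 4) + ∑ k : K, r k • red M (k + 4)

section Step

variable {M M' : Submodule ℂ ℂ⟦X⟧} {g c : ℕ} {K : Finset ℕ} (hc : tail c ≤ M)
  (hK : ∀ k, k ∈ K ↔ g < k ∧ k ∉ valuations (M : Set ℂ⟦X⟧) ∧ k + 4 ∈ valuations (M : Set ℂ⟦X⟧))
  (hgM : g ∉ valuations (M : Set ℂ⟦X⟧)) (hg4 : g + 4 ∈ valuations (M : Set ℂ⟦X⟧))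

include hc hK

omit hK in
lemma stepElem_mem (r : K → ℂ) : stepElem M g K r ∈ M :=
  M.add_mem (red_mem hc _) (M.sum_mem fun _ _ => M.smul_mem _ (red_mem hc _))

lemma stepElem_mem_tail (r : K → ℂ) : stepElem M g K r ∈ tail (g + 4) := by
  refine (tail (g + 4)).add_mem (red_mem_tail hc _) (Submodule.sum_mem _ fun k _ => Submodule.smul_mem _ _ ?_)
  have := ((hK k).mp k.2).1
  exact tail_anti (by omega) (red_mem_tail hc _)

lemma coeff_stepElem (r : K → ℂ) {b : ℕ} (hb : b + 4 ∈ valuations (M : Set ℂ⟦X⟧)) :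
    PowerSeries.coeff (b + 4) (stepElem M g K r) =
      if b = g then 1 else if h : b ∈ K then r ⟨b, h⟩ else 0 := by
  rw [stepElem, map_add, coeff_red hc hb, map_sum]
  simp only [map_smul, coeff_red hc hb, smul_eq_mul, mul_ite, mul_one, mul_zero, add_left_inj]
  by_cases hbg : b = g
  · rw [if_pos hbg, if_pos hbg, Finset.sum_eq_zero, add_zero]
    intro k _
    have := ((hK k).mp k.2).1
    rw [if_neg (by omega)]
  · rw [if_neg hbg, if_neg hbg, zero_add]
    split_ifs with h
    · rw [Finset.sum_eq_single ⟨b, h⟩]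
      · rw [if_pos rfl]
      · intro k _ hk
        rw [if_neg]
        intro h2
        exact hk (Subtype.ext h2.symm)
      · simp
    · refine Finset.sum_eq_zero fun k _ => if_neg ?_
      rintro rfl
      exact h k.2

lemma X_pow_four_mul_divFour_stepElem (r : K → ℂ) :
    PowerSeries.X ^ 4 * divFour (stepElem M g K r) = stepElem M g K r :=
  X_pow_four_mul_divFour (tail_anti (by omega) (stepElem_mem_tail hc hK r))

include hg4 in
lemma divFour_stepElem (r : K → ℂ) : PowerSeries.coeff g (divFour (stepElem M g K r)) = 1 ∧
    divFour (stepElem M g K r) ∈ tail g ∧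
    ∀ k : K, PowerSeries.coeff k (divFour (stepElem M g K r)) = r k := by
  refine ⟨?_, fun k hk => ?_, fun k => ?_⟩
  · rw [coeff_divFour, coeff_stepElem hc hK r hg4, if_pos rfl]
  · rw [coeff_divFour]
    exact stepElem_mem_tail hc hK r _ (by omega)
  · rw [coeff_divFour, coeff_stepElem hc hK r ((hK k).mp k.2).2.2, if_neg, dif_pos k.2]
    have := ((hK k).mp k.2).1
    omega

include hgM in
lemma divFour_stepElem_coeff (h4 : ∀ b ∈ valuations (M : Set ℂ⟦X⟧), b + 4 ∈ valuations (M : Set ℂ⟦X⟧))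
    (r : K → ℂ) {b : ℕ} (hb : b ∈ valuations (M : Set ℂ⟦X⟧)) :
    PowerSeries.coeff b (divFour (stepElem M g K r)) = 0 := by
  rw [coeff_divFour, coeff_stepElem hc hK r (h4 b hb), if_neg, dif_neg]
  · intro h
    exact ((hK b).mp h).2.1 hb
  · rintro rfl
    exact hgM hb

/-- The reduced element of the new order is determined by its coefficients at `K`. -/
lemma red_eq_divFour_stepElem (hle : M ≤ M')
    (hv : valuations (M' : Set ℂ⟦X⟧) = valuations (M : Set ℂ⟦X⟧) ∪ {g})
    (hx : ∀ f ∈ M', PowerSeries.X ^ 4 * f ∈ M') :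
    red M' g = divFour (stepElem M g K fun k => PowerSeries.coeff k (red M' g)) := by
  have hc' := hc.trans hle
  have h1 : PowerSeries.X ^ 4 * red M' g ∈ M := by
    refine mem_of_mem_tail_succ hc hle hv (hx _ (red_mem hc' g)) ?_
    have := mul_mem_tail (X_pow_mem_tail 4) (red_mem_tail hc' g)
    exact tail_anti (by omega) this
  have h2 : PowerSeries.X ^ 4 * red M' g = stepElem M g K fun k => PowerSeries.coeff k (red M' g) := by
    refine eq_of_coeff_valuations h1 (stepElem_mem hc _) fun b hb => ?_
    by_cases hb4 : b < 4
    · rw [stepElem_mem_tail hc hK _ _ (by omega), PowerSeries.coeff_X_pow_mul', if_neg (by omega)]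
    · obtain ⟨b, rfl⟩ : ∃ b', b = b' + 4 := ⟨b - 4, by omega⟩
      rw [PowerSeries.coeff_X_pow_mul, coeff_stepElem hc hK _ hb]
      split_ifs with h3 h4
      · rw [h3, coeff_red hc' (by rw [hv]; exact Or.inr rfl), if_pos rfl]
      · rfl
      · by_cases h5 : b < g
        · exact red_mem_tail hc' g b h5
        · have h6 : b ∈ valuations (M : Set ℂ⟦X⟧) := by
            by_contra h6
            exact h4 ((hK b).mpr ⟨by omega, h6, hb⟩)
          rw [coeff_red hc' (by rw [hv]; exact Or.inl h6), if_neg h3]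
  rw [← h2, divFour_X_pow_four_mul]

end Step

lemma X_pow_four_mul_mem (E : Exponents u v) {M : Submodule (R u v) ℂ⟦X⟧} {f : ℂ⟦X⟧} (hf : f ∈ M) :
    PowerSeries.X ^ 4 * f ∈ M := mul_mem_of_mem_R (X_pow_four_mem E.u_pos E.v_pos) hf

lemma genY_mul_mem (E : Exponents u v) {M : Submodule (R u v) ℂ⟦X⟧} {f : ℂ⟦X⟧} (hf : f ∈ M) :
    genY u v * f ∈ M := mul_mem_of_mem_R (genY_mem E.u_pos E.v_pos) hf

/-- If `z^4 f` and `(z^{2u}+z^v) f` lie in `M`, then `M + ℂ f` is a module. -/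
lemma exists_submodule_add (E : Exponents u v) {M : Submodule (R u v) ℂ⟦X⟧} {c g : ℕ} {f : ℂ⟦X⟧}
    (hc : tail c ≤ M.restrictScalars ℂ) (hgM : g ∉ valuations (M : Set ℂ⟦X⟧))
    (h1 : PowerSeries.coeff g f = 1) (hfg : f ∈ tail g)
    (hx : PowerSeries.X ^ 4 * f ∈ M) (hy : genY u v * f ∈ M) :
    ∃ M' : Submodule (R u v) ℂ⟦X⟧, M ≤ M' ∧ f ∈ M' ∧
      valuations (M' : Set ℂ⟦X⟧) = valuations (M : Set ℂ⟦X⟧) ∪ {g} := by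
  let S : Submodule ℂ ℂ⟦X⟧ := M.restrictScalars ℂ ⊔ Submodule.span ℂ {f}
  have hS : ∀ x, x ∈ S ↔ ∃ m ∈ M, ∃ r : ℂ, m + r • f = x := by
    intro x
    simp only [S, Submodule.mem_sup, Submodule.mem_span_singleton, Submodule.restrictScalars_mem]
    constructor
    · rintro ⟨m, hm, _, ⟨r, rfl⟩, h⟩
      exact ⟨m, hm, r, h⟩
    · rintro ⟨m, hm, r, h⟩
      exact ⟨m, hm, _, ⟨r, rfl⟩, h⟩
  have hmul : ∀ t : ℂ⟦X⟧, t ∈ R u v → t * f ∈ M → ∀ x ∈ S, t * x ∈ S := by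
    intro t ht htf x hx
    obtain ⟨m, hm, r, rfl⟩ := (hS x).mp hx
    rw [mul_add, mul_smul_comm]
    refine S.add_mem ((hS _).mpr ⟨t * m, mul_mem_of_mem_R ht hm, 0, by simp⟩)
      (S.smul_mem _ ((hS _).mpr ⟨_, htf, 0, by simp⟩))
  obtain ⟨M', hM'⟩ := exists_submodule E.u_pos E.v_pos (S := S) (hc.trans le_sup_left)
    (hmul _ (X_pow_four_mem E.u_pos E.v_pos) hx) (hmul _ (genY_mem E.u_pos E.v_pos) hy)
  have hmem : ∀ x, x ∈ M' ↔ ∃ m ∈ M, ∃ r : ℂ, m + r • f = x := by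
    intro x
    rw [← hS, ← hM', Submodule.restrictScalars_mem]
  have hfM : f ∈ M' := (hmem f).mpr ⟨0, M.zero_mem, 1, by simp⟩
  have hle : M ≤ M' := fun m hm => (hmem m).mpr ⟨m, hm, 0, by simp⟩
  refine ⟨M', hle, hfM, Set.Subset.antisymm ?_ ?_⟩
  · intro k hk
    obtain ⟨x, hxM, hx0, hxk⟩ := mem_valuations_iff.mp hk
    obtain ⟨m, hm, r, rfl⟩ := (hmem x).mp hxM
    rcases lt_trichotomy k g with hkg | rfl | hkg
    · refine Or.inl (mem_valuations_iff.mpr ⟨m, hm, ?_, fun i hi => ?_⟩)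
      · simpa [hfg k hkg] using hx0
      · simpa [hfg i (hi.trans hkg)] using hxk i hi
    · exact Or.inr rfl
    · have hr : r = 0 := by
        by_contra hr
        refine hgM (mem_valuations_iff.mpr ⟨m, hm, ?_, fun i hi => ?_⟩)
        · intro h
          have := hxk g hkg
          simp [h, h1, hr] at this
        · simpa [hfg i hi] using hxk i (hi.trans hkg)
      subst hr
      refine Or.inl (mem_valuations_iff.mpr ⟨m, hm, ?_, fun i hi => ?_⟩)
      · simpa using hx0
      · simpa using hxk i hi
  · rintro k (hk | rfl)
    · obtain ⟨x, hx, h⟩ := mem_valuations_iff.mp hk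
      exact mem_valuations_iff.mpr ⟨x, hle hx, h⟩
    · exact mem_valuations_of_mem hfM h1 hfg

/-- The free step: if `z^4 f ∈ M` implies `(z^{2u}+z^v) f ∈ M` for all `f` of order `g`, then the modules
`M' ⊇ M` with the additional valuation `g` form an affine space, whose coordinates are the coefficients
at `K` of the reduced element of order `g` of `M'`. -/
theorem isAffineCell_of_free_step (E : Exponents u v) {X Y I J : Type}
    {MX : X → J → Submodule (R u v) ℂ⟦X⟧} {MY : Y → I → Submodule (R u v) ℂ⟦X⟧} {i₁ : I} {j₁ : J}
    {Δ : Set ℕ} {c g : ℕ} {K : Finset ℕ} (hc : ∀ y, tail c ≤ (MY y i₁).restrictScalars ℂ)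
    (hΔ : ∀ y, valuations (MY y i₁ : Set ℂ⟦X⟧) = Δ)
    (hK : ∀ k, k ∈ K ↔ g < k ∧ k ∉ Δ ∧ k + 4 ∈ Δ) (hgΔ : g ∉ Δ) (hg4 : g + 4 ∈ Δ)
    (hfree : ∀ y f, PowerSeries.coeff g f = 1 → f ∈ tail g → PowerSeries.X ^ 4 * f ∈ MY y i₁ →
      genY u v * f ∈ MY y i₁)
    (π : X → Y)
    (hπ : ∀ i a, IsRegularFamily (coordAlg fun x j => (MX x j).restrictScalars ℂ)
      fun x => red ((MY (π x) i).restrictScalars ℂ) a)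
    (hX : ∀ j, j = j₁ ∨ ∃ i, ∀ x, MX x j = MY (π x) i)
    (hle : ∀ x, MY (π x) i₁ ≤ MX x j₁) (hΔX : ∀ x, valuations (MX x j₁ : Set ℂ⟦X⟧) = Δ ∪ {g})
    (hinj : ∀ x x', π x = π x' → MX x j₁ = MX x' j₁ → x = x')
    (hsurj : ∀ y (M' : Submodule (R u v) ℂ⟦X⟧), MY y i₁ ≤ M' → valuations (M' : Set ℂ⟦X⟧) = Δ ∪ {g} →
      ∃ x, π x = y ∧ MX x j₁ = M')
    {N : ℕ} (hY : IsAffineCell (coordAlg fun y i => (MY y i).restrictScalars ℂ) N) :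
    IsAffineCell (coordAlg fun x j => (MX x j).restrictScalars ℂ) (N + K.card) := by
  have hK' : ∀ y k, k ∈ K ↔ g < k ∧ k ∉ valuations ((MY y i₁).restrictScalars ℂ : Set ℂ⟦X⟧) ∧
      k + 4 ∈ valuations ((MY y i₁).restrictScalars ℂ : Set ℂ⟦X⟧) := by
    intro y k
    rw [Submodule.coe_restrictScalars, hΔ, hK]
  have hg' : ∀ y, g ∉ valuations ((MY y i₁).restrictScalars ℂ : Set ℂ⟦X⟧) := by
    intro y; rwa [Submodule.coe_restrictScalars, hΔ]
  have hg4' : ∀ y, g + 4 ∈ valuations ((MY y i₁).restrictScalars ℂ : Set ℂ⟦X⟧) := by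
    intro y; rwa [Submodule.coe_restrictScalars, hΔ]
  have h4' : ∀ y, ∀ b ∈ valuations ((MY y i₁).restrictScalars ℂ : Set ℂ⟦X⟧),
      b + 4 ∈ valuations ((MY y i₁).restrictScalars ℂ : Set ℂ⟦X⟧) := by
    intro y b hb
    rw [add_comm]
    exact add_mem_valuations (E.mem_semigroup_of_four rfl) hb
  have hle' : ∀ x, (MY (π x) i₁).restrictScalars ℂ ≤ (MX x j₁).restrictScalars ℂ := fun x => hle x
  have hv' : ∀ x, valuations ((MX x j₁).restrictScalars ℂ : Set ℂ⟦X⟧) =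
      valuations ((MY (π x) i₁).restrictScalars ℂ : Set ℂ⟦X⟧) ∪ {g} := by
    intro x
    rw [Submodule.coe_restrictScalars, Submodule.coe_restrictScalars, hΔ, hΔX]
  have hred : ∀ x, red ((MX x j₁).restrictScalars ℂ) g = divFour (stepElem ((MY (π x) i₁).restrictScalars ℂ) g K
      fun k => PowerSeries.coeff k (red ((MX x j₁).restrictScalars ℂ) g)) := fun x =>
    red_eq_divFour_stepElem (hc _) (hK' _) (hle' x) (hv' x)
      fun f hf => X_pow_four_mul_mem E hf
  let φ₀ : X → Y × (K → ℂ) := fun x => (π x, fun k => PowerSeries.coeff k (red ((MX x j₁).restrictScalars ℂ) g))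
  have hφ : Function.Bijective φ₀ := by
    constructor
    · intro x x' h
      have h1 : π x = π x' := congrArg Prod.fst h
      have h2 := congrArg Prod.snd h
      have h3 : red ((MX x j₁).restrictScalars ℂ) g = red ((MX x' j₁).restrictScalars ℂ) g := by
        rw [hred x, hred x', ← h1]
        exact congrArg _ (congrArg _ h2)
      refine hinj x x' h1 (le_antisymm ?_ ?_)
      · refine le_of_red_mem (hc _) (hle' x) (hv' x) (hg' _)
          (M'' := (MX x' j₁).restrictScalars ℂ) (by rw [h1]; exact hle' x') ?_
        rw [h3]
        exact red_mem ((hc _).trans (hle' x')) _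
      · refine le_of_red_mem (hc _) (hle' x') (hv' x') (hg' _)
          (M'' := (MX x j₁).restrictScalars ℂ) (by rw [← h1]; exact hle' x) ?_
        rw [← h3]
        exact red_mem ((hc _).trans (hle' x)) _
    · rintro ⟨y, r⟩
      obtain ⟨h1, h2, h3⟩ := divFour_stepElem (hc y) (hK' y) (hg4' y) r
      have h4 : PowerSeries.X ^ 4 * divFour (stepElem ((MY y i₁).restrictScalars ℂ) g K r) ∈ MY y i₁ := by
        rw [X_pow_four_mul_divFour_stepElem (hc y) (hK' y)]
        exact stepElem_mem (hc y) r
      obtain ⟨M', hM1, hM2, hM3⟩ := exists_submodule_add E (hc y) (hg' y) h1 h2 h4 (hfree y _ h1 h2 h4)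
      obtain ⟨x, rfl, rfl⟩ := hsurj y M' hM1 (by rw [hM3, hΔ])
      refine ⟨x, Prod.ext rfl (funext fun k => ?_)⟩
      refine (congrArg (PowerSeries.coeff (k : ℕ)) (red_eq hM2 fun b hb => ?_)).trans (h3 k)
      rw [hv'] at hb
      rcases hb with hb | rfl
      · rw [divFour_stepElem_coeff (hc _) (hK' _) (hg' _) (h4' _) r hb, if_neg]
        rintro rfl
        exact hg' _ hb
      · rw [h1, if_pos rfl]
  let φ := Equiv.ofBijective φ₀ hφ
  refine hY.of_prod φ (fun f hf => comp_mem_of_mem_coordAlg hπ hf)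
    (fun k => regularFamily_red_coordAlg (fun x j => (MX x j).restrictScalars ℂ) j₁ g k) ?_
    (by rw [Fintype.card_coe])
  intro f hf Z P y r hy hr
  refine comp_mem_of_mem_coordAlg (fun j a => ?_) hf
  have hφ1 : ∀ z, π (φ.symm (y z, r z)) = y z := fun z =>
    congrArg Prod.fst (φ.apply_symm_apply (y z, r z))
  have hφ2 : ∀ z, (fun k : K => PowerSeries.coeff k (red ((MX (φ.symm (y z, r z)) j₁).restrictScalars ℂ) g)) = r z :=
    fun z => congrArg Prod.snd (φ.apply_symm_apply (y z, r z))
  have hYreg : ∀ i a, IsRegularFamily P fun z => red ((MY (y z) i).restrictScalars ℂ) a := fun i a k =>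
    hy _ (regularFamily_red_coordAlg (fun y i => (MY y i).restrictScalars ℂ) i a k)
  rcases hX j with rfl | ⟨i, hi⟩
  · have hfreg : IsRegularFamily P fun z => red ((MX (φ.symm (y z, r z)) j).restrictScalars ℂ) g := by
      have : (fun z => red ((MX (φ.symm (y z, r z)) j).restrictScalars ℂ) g) =
          fun z => divFour (stepElem ((MY (y z) i₁).restrictScalars ℂ) g K (r z)) := by
        funext z
        rw [hred, hφ1, hφ2]
      rw [this]
      intro k
      simp only [coeff_divFour]
      exact ((hYreg i₁ _).add (IsRegularFamily.sum fun k _ => IsRegularFamily.smul (hr k) (hYreg i₁ _))) _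
    refine regularFamily_red (Δ := Δ ∪ {g}) (c := c) (fun z => (hc _).trans (hle' _))
      (fun z => by rw [Submodule.coe_restrictScalars, hΔX])
      (e := fun a z => if a = g then red ((MX (φ.symm (y z, r z)) j).restrictScalars ℂ) g
        else red ((MY (y z) i₁).restrictScalars ℂ) a) ?_ a
    intro b hb _
    by_cases hbg : b = g
    · subst hbg
      simp only [if_true]
      refine ⟨hfreg, fun z => ⟨red_mem ((hc _).trans (hle' _)) _, ?_, red_mem_tail ((hc _).trans (hle' _)) _⟩⟩
      rw [coeff_red ((hc _).trans (hle' _)) (by rw [hv']; exact Or.inr rfl), if_pos rfl]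
    · simp only [if_neg hbg]
      have hb' : b ∈ Δ := hb.resolve_right hbg
      refine ⟨hYreg i₁ b, fun z => ⟨?_, ?_, red_mem_tail (hc _) _⟩⟩
      · have := hle' (φ.symm (y z, r z))
        rw [hφ1] at this
        exact this (red_mem (hc _) _)
      · rw [coeff_red (hc _) (by rwa [Submodule.coe_restrictScalars, hΔ]), if_pos rfl]
  · have : (fun z => red ((MX (φ.symm (y z, r z)) j).restrictScalars ℂ) a) =
        fun z => red ((MY (y z) i).restrictScalars ℂ) a := by
      funext z
      rw [hi, hφ1]
    rw [this]
    exact hYreg i a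

/-! ### When the step is free -/

lemma X_pow_mem_of_one_mem (E : Exponents u v) {M : Submodule (R u v) ℂ⟦X⟧} (h1 : (1 : ℂ⟦X⟧) ∈ M) {k : ℕ}
    (hk : k % 4 = 0) : (PowerSeries.X ^ k : ℂ⟦X⟧) ∈ M := by
  rw [← mul_one (PowerSeries.X ^ k)]
  refine mul_mem_of_mem_R (mem_R_of_support E.u_pos E.v_pos fun i hi => ?_) h1
  rw [PowerSeries.coeff_X_pow, if_neg]
  rintro rfl
  exact hi hk

lemma X_pow_mul_mem (E : Exponents u v) {M : Submodule (R u v) ℂ⟦X⟧} {f : ℂ⟦X⟧} (hf : f ∈ M) {k : ℕ}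
    (hk : k % 4 = 0) : PowerSeries.X ^ k * f ∈ M := by
  refine mul_mem_of_mem_R (mem_R_of_support E.u_pos E.v_pos fun i hi => ?_) hf
  rw [PowerSeries.coeff_X_pow, if_neg]
  rintro rfl
  exact hi hk

lemma smul_mem_complex {M : Submodule (R u v) ℂ⟦X⟧} {f : ℂ⟦X⟧} (hf : f ∈ M) (r : ℂ) : r • f ∈ M :=
  (M.restrictScalars ℂ).smul_mem r hf

lemma genY_mem_tail (E : Exponents u v) : genY u v ∈ tail (2 * u) :=
  (tail _).add_mem (X_pow_mem_tail _) (tail_anti E.lt.le (X_pow_mem_tail _))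

lemma coeff_genY (E : Exponents u v) : PowerSeries.coeff (2 * u) (genY u v) = 1 := by
  have := E.lt
  rw [genY, map_add, PowerSeries.coeff_X_pow_self, PowerSeries.coeff_X_pow, if_neg (by omega), add_zero]

lemma mem_tail_succ {k : ℕ} {f : ℂ⟦X⟧} (hf : f ∈ tail k) (h : PowerSeries.coeff k f = 0) :
    f ∈ tail (k + 1) := by
  intro i hi
  rcases Nat.lt_succ_iff_lt_or_eq.mp hi with h1 | rfl
  · exact hf i h1
  · exact h

/-- Subtracting a multiple of a monic element of the same order raises the order. -/
lemma sub_smul_mem_tail_succ {k : ℕ} {f e : ℂ⟦X⟧} (hf : f ∈ tail k) (he : e ∈ tail k)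
    (h : PowerSeries.coeff k e = 1) : f - PowerSeries.coeff k f • e ∈ tail (k + 1) := by
  refine mem_tail_succ ((tail k).sub_mem hf ((tail k).smul_mem _ he)) ?_
  rw [map_sub, map_smul, h, smul_eq_mul, mul_one, sub_self]

lemma genY_mul_genY (u v : ℕ) : genY u v * genY u v =
    PowerSeries.X ^ (4 * u) + 2 * PowerSeries.X ^ (2 * u + v) + PowerSeries.X ^ (2 * v) := by
  rw [genY]; ring

/-- Steps at odd `g` are free, since then all numbers from `2u + g` on are valuations. -/
lemma genY_mul_mem_of_large (E : Exponents u v) {M : Submodule (R u v) ℂ⟦X⟧} {g : ℕ}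
    (hl : ∀ k, 2 * u + g ≤ k → k ∈ valuations (M : Set ℂ⟦X⟧)) {f : ℂ⟦X⟧} (hf : f ∈ tail g) :
    genY u v * f ∈ M :=
  tail_le_module E hl (mul_mem_tail (genY_mem_tail E) hf)

section Even

variable (E : Exponents u v) {M : Submodule (R u v) ℂ⟦X⟧} (h1 : (1 : ℂ⟦X⟧) ∈ M) {g S n : ℕ}
  (hS : 4 * S + g = 2 * u) (hnv : n ≤ v)
  (hn : ∀ k ∈ valuations (M : Set ℂ⟦X⟧), k % 2 = 1 → 2 * u ≤ k → n ≤ k)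
  (hl : ∀ k, g + n ≤ k → k ∈ valuations (M : Set ℂ⟦X⟧))

include E h1 hS hnv hl

/-- The square `y² = z^{4u} + 2 z^{2u+v} + z^{2v}` lies in `x^S M`, since all numbers from `g + n` on are valuations. -/
lemma exists_genY_sq_eq {t : ℕ} (ht : t % 4 = 0) : ∃ m ∈ M,
    PowerSeries.X ^ t * (genY u v * genY u v) = PowerSeries.X ^ (4 * S) * m := by
  have huv := E.lt
  have htail : tail (g + n) ≤ M.restrictScalars ℂ := tail_le_module E hl
  have hX : ∀ k, g + n ≤ k → (PowerSeries.X ^ k : ℂ⟦X⟧) ∈ M := fun k hk =>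
    htail (tail_anti hk (X_pow_mem_tail k))
  refine ⟨PowerSeries.X ^ (t + (4 * u - 4 * S)) + (2 : ℂ) • PowerSeries.X ^ (t + (g + v)) +
    PowerSeries.X ^ (t + (2 * v - 4 * S)), M.add_mem (M.add_mem ?_ ?_) ?_, ?_⟩
  · exact X_pow_mem_of_one_mem E h1 (by omega)
  · exact smul_mem_complex (hX _ (by omega)) _
  · exact hX _ (by omega)
  · have e1 : (PowerSeries.X : ℂ⟦X⟧) ^ (4 * u) = PowerSeries.X ^ (4 * S) * PowerSeries.X ^ (4 * u - 4 * S) := by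
      rw [← pow_add]; congr 1; omega
    have e2 : (PowerSeries.X : ℂ⟦X⟧) ^ (2 * u + v) = PowerSeries.X ^ (4 * S) * PowerSeries.X ^ (g + v) := by
      rw [← pow_add]; congr 1; omega
    have e3 : (PowerSeries.X : ℂ⟦X⟧) ^ (2 * v) = PowerSeries.X ^ (4 * S) * PowerSeries.X ^ (2 * v - 4 * S) := by
      rw [← pow_add]; congr 1; omega
    rw [genY_mul_genY, e1, e2, e3, two_smul]
    ring

include hn

/-- If `w ∈ M` has order greater than `2u`, then `y w ∈ x^S M`. Below `n` all valuations of `M` are even, so that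
`w` can be reduced by multiples of `1` and `y` until its order is at least `n`. -/
lemma exists_genY_mul_eq (d : ℕ) : ∀ k, 2 * u < k → n ≤ k + d → ∀ w ∈ M, w ∈ tail k →
    ∃ m ∈ M, genY u v * w = PowerSeries.X ^ (4 * S) * m := by
  have htail : tail (g + n) ≤ M.restrictScalars ℂ := tail_le_module E hl
  have hbase : ∀ w, w ∈ tail n → ∃ m ∈ M, genY u v * w = PowerSeries.X ^ (4 * S) * m := by
    intro w hw
    obtain ⟨q, hq⟩ := mem_tail_iff_dvd.mp (mul_mem_tail (genY_mem_tail E) hw)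
    refine ⟨PowerSeries.X ^ (g + n) * q, htail (mem_tail_iff_dvd.mpr ⟨q, rfl⟩), ?_⟩
    rw [hq, ← mul_assoc, ← pow_add]
    congr 2
    omega
  induction d with
  | zero => exact fun k _ hk w _ hwk => hbase w (tail_anti (by omega) hwk)
  | succ d ih =>
    intro k hk hkn w hw hwk
    by_cases hkn' : n ≤ k
    · exact hbase w (tail_anti hkn' hwk)
    by_cases h0 : PowerSeries.coeff k w = 0
    · exact ih (k + 1) (by omega) (by omega) w hw (mem_tail_succ hwk h0)
    have hkv : k ∈ valuations (M : Set ℂ⟦X⟧) := mem_valuations_iff.mpr ⟨w, hw, h0, hwk⟩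
    have hk2 : k % 2 = 0 := by
      by_contra h
      exact hkn' (hn k hkv (by omega) hk.le)
    -- It suffices to subtract from `w` an element `e ∈ M` of order `k` for which the claim is known.
    have hred : ∀ e ∈ M, e ∈ tail k → PowerSeries.coeff k e = 1 →
        (∃ m ∈ M, genY u v * e = PowerSeries.X ^ (4 * S) * m) →
        ∃ m ∈ M, genY u v * w = PowerSeries.X ^ (4 * S) * m := by
      rintro e he hek he1 ⟨m₁, hm₁, h₁⟩
      obtain ⟨m₂, hm₂, h₂⟩ := ih (k + 1) (by omega) (by omega) (w - PowerSeries.coeff k w • e)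
        (M.sub_mem hw (smul_mem_complex he _)) (sub_smul_mem_tail_succ hwk hek he1)
      refine ⟨m₂ + PowerSeries.coeff k w • m₁, M.add_mem hm₂ (smul_mem_complex hm₁ _), ?_⟩
      rw [mul_add, ← h₂, mul_smul_comm, ← h₁, mul_sub, mul_smul_comm, sub_add_cancel]
    by_cases hk4 : k % 4 = 0
    · refine hred (PowerSeries.X ^ k) (X_pow_mem_of_one_mem E h1 hk4) (X_pow_mem_tail k)
        (PowerSeries.coeff_X_pow_self k) ⟨PowerSeries.X ^ (k - 4 * S) * (genY u v * 1), ?_, ?_⟩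
      · exact X_pow_mul_mem E (genY_mul_mem E h1) (by omega)
      · have : k = 4 * S + (k - 4 * S) := by omega
        conv_lhs => rw [this]
        ring
    · have hu := E.u_mod
      refine hred (PowerSeries.X ^ (k - 2 * u) * (genY u v * 1)) (X_pow_mul_mem E (genY_mul_mem E h1) (by omega))
        ?_ ?_ ?_
      · have := mul_mem_tail (X_pow_mem_tail (k - 2 * u)) (mul_mem_tail_left (genY_mem_tail E) 1)
        exact tail_anti (by omega) this
      · rw [mul_one, PowerSeries.coeff_X_pow_mul', if_pos (by omega)]
        rw [show k - (k - 2 * u) = 2 * u by omega, coeff_genY E]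
      · obtain ⟨m, hm, h⟩ := exists_genY_sq_eq E h1 hS hnv hl (t := k - 2 * u) (by omega)
        refine ⟨m, hm, ?_⟩
        rw [← h]
        ring

/-- The step is free if `[g + n, ∞)` contains no gaps: with `x = z^4`, `y = z^{2u}+z^v` and
`w = y - x^S f ∈ M` one has `x^S y f = y² - y w`, and both terms lie in `x^S M`. -/
lemma genY_mul_mem_of_even (hg : g < 2 * u) {f : ℂ⟦X⟧} (hf1 : PowerSeries.coeff g f = 1) (hfg : f ∈ tail g)
    (hf : PowerSeries.X ^ 4 * f ∈ M) : genY u v * f ∈ M := by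
  have hxf : PowerSeries.X ^ (4 * S) * f ∈ M := by
    rw [show 4 * S = 4 * (S - 1) + 4 by omega, pow_add, mul_assoc]
    exact X_pow_mul_mem E hf (by omega)
  have hY : genY u v ∈ M := by rw [← mul_one (genY u v)]; exact genY_mul_mem E h1
  have hxt : PowerSeries.X ^ (4 * S) * f ∈ tail (2 * u) := by
    rw [← hS]; exact mul_mem_tail (X_pow_mem_tail _) hfg
  have hwt : genY u v - PowerSeries.X ^ (4 * S) * f ∈ tail (2 * u + 1) := by
    refine mem_tail_succ ((tail _).sub_mem (genY_mem_tail E) hxt) ?_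
    rw [map_sub, coeff_genY E, PowerSeries.coeff_X_pow_mul', if_pos (by omega),
      show 2 * u - 4 * S = g by omega, hf1, sub_self]
  obtain ⟨m₁, hm₁, h₁⟩ := exists_genY_mul_eq E h1 hS hnv hn hl n (2 * u + 1) (by omega) (by omega) _
    (M.sub_mem hY hxf) hwt
  obtain ⟨m₂, hm₂, h₂⟩ := exists_genY_sq_eq E h1 hS hnv hl (t := 0) rfl
  have h3 : (PowerSeries.X : ℂ⟦X⟧) ^ (4 * S) * (genY u v * f) = PowerSeries.X ^ (4 * S) * (m₂ - m₁) := by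
    rw [mul_sub, ← h₁, ← h₂]
    ring
  rw [mul_left_cancel₀ (pow_ne_zero _ PowerSeries.X_ne_zero) h3]
  exact M.sub_mem hm₂ hm₁

end Even

/-! ### Multiplication of modules by units -/

/-- The module `p M`. -/
def scale (p : ℂ⟦X⟧) (M : Submodule (R u v) ℂ⟦X⟧) : Submodule (R u v) ℂ⟦X⟧ :=
  M.map (LinearMap.mulLeft (R u v) p)

lemma mem_scale {p : ℂ⟦X⟧} {M : Submodule (R u v) ℂ⟦X⟧} {f : ℂ⟦X⟧} : f ∈ scale p M ↔ ∃ m ∈ M, p * m = f :=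
  Iff.rfl

lemma mul_inv_of_constantCoeff {p : ℂ⟦X⟧} (hp : PowerSeries.constantCoeff p = 1) : p * p⁻¹ = 1 :=
  PowerSeries.mul_inv_cancel p (by rw [hp]; exact one_ne_zero)

lemma inv_constantCoeff {p : ℂ⟦X⟧} (hp : PowerSeries.constantCoeff p = 1) :
    PowerSeries.constantCoeff p⁻¹ = 1 := by
  rw [PowerSeries.constantCoeff_inv, hp, inv_one]

lemma mem_scale_iff {p : ℂ⟦X⟧} (hp : PowerSeries.constantCoeff p = 1) {M : Submodule (R u v) ℂ⟦X⟧}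
    {f : ℂ⟦X⟧} : f ∈ scale p M ↔ p⁻¹ * f ∈ M := by
  rw [mem_scale]
  constructor
  · rintro ⟨m, hm, rfl⟩
    rwa [← mul_assoc, mul_comm p⁻¹, mul_inv_of_constantCoeff hp, one_mul]
  · intro h
    exact ⟨_, h, by rw [← mul_assoc, mul_inv_of_constantCoeff hp, one_mul]⟩

lemma scale_scale_inv {p : ℂ⟦X⟧} (hp : PowerSeries.constantCoeff p = 1) (M : Submodule (R u v) ℂ⟦X⟧) :
    scale p (scale p⁻¹ M) = M := by
  ext f
  have h : p⁻¹⁻¹ * p⁻¹ = 1 := by rw [mul_comm, mul_inv_of_constantCoeff (inv_constantCoeff hp)]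
  rw [mem_scale_iff hp, mem_scale_iff (inv_constantCoeff hp), ← mul_assoc, h, one_mul]

lemma scale_injective {p : ℂ⟦X⟧} (hp : PowerSeries.constantCoeff p = 1) {M M' : Submodule (R u v) ℂ⟦X⟧}
    (h : scale p M = scale p M') : M = M' := by
  ext f
  have h1 : p * f ∈ scale p M ↔ p * f ∈ scale p M' := by rw [h]
  rwa [mem_scale_iff hp, mem_scale_iff hp, ← mul_assoc, mul_comm p⁻¹, mul_inv_of_constantCoeff hp,
    one_mul] at h1

lemma scale_mono {p : ℂ⟦X⟧} {M M' : Submodule (R u v) ℂ⟦X⟧} (h : M ≤ M') : scale p M ≤ scale p M' :=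
  Submodule.map_mono h

lemma coeff_mul_of_mem_tail {p f : ℂ⟦X⟧} {k : ℕ} (hp : PowerSeries.constantCoeff p = 1) (hf : f ∈ tail k) :
    PowerSeries.coeff k (p * f) = PowerSeries.coeff k f := by
  rw [PowerSeries.coeff_mul, Finset.sum_eq_single (0, k)]
  · rw [PowerSeries.coeff_zero_eq_constantCoeff, hp, one_mul]
  · rintro ⟨i, j⟩ hij hne
    rw [Finset.HasAntidiagonal.mem_antidiagonal] at hij
    simp only at hij
    have : j < k := by
      by_contra hjk
      exact hne (by ext <;> simp only <;> omega)
    rw [hf j this, mul_zero]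
  · intro h
    exact absurd (Finset.HasAntidiagonal.mem_antidiagonal.mpr (zero_add k)) h

lemma valuations_subset_scale {p : ℂ⟦X⟧} (hp : PowerSeries.constantCoeff p = 1)
    (M : Submodule (R u v) ℂ⟦X⟧) : valuations (M : Set ℂ⟦X⟧) ⊆ valuations (scale p M : Set ℂ⟦X⟧) := by
  intro k hk
  obtain ⟨m, hm, h0, hmk⟩ := mem_valuations_iff.mp hk
  exact mem_valuations_iff.mpr ⟨p * m, mem_scale.mpr ⟨m, hm, rfl⟩,
    by rwa [coeff_mul_of_mem_tail hp hmk], mul_mem_tail_right hmk p⟩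

lemma valuations_scale {p : ℂ⟦X⟧} (hp : PowerSeries.constantCoeff p = 1) (M : Submodule (R u v) ℂ⟦X⟧) :
    valuations (scale p M : Set ℂ⟦X⟧) = valuations (M : Set ℂ⟦X⟧) := by
  refine Set.Subset.antisymm ?_ (valuations_subset_scale hp M)
  have h := valuations_subset_scale (inv_constantCoeff hp) (scale p M)
  have h2 : scale p⁻¹ (scale p M) = M := by
    refine scale_injective hp ?_
    rw [scale_scale_inv hp]
  rwa [h2] at h

lemma exists_unit_mem {M : Submodule (R u v) ℂ⟦X⟧} (h0 : 0 ∈ valuations (M : Set ℂ⟦X⟧)) :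
    ∃ p ∈ M, PowerSeries.constantCoeff p = 1 := by
  obtain ⟨p, hp, h1, -⟩ := exists_monic_of_mem_valuations (M := M.restrictScalars ℂ) h0
  exact ⟨p, hp, by rwa [← PowerSeries.coeff_zero_eq_constantCoeff_apply]⟩

lemma one_mem_scale_inv {M : Submodule (R u v) ℂ⟦X⟧} {p : ℂ⟦X⟧} (hpM : p ∈ M)
    (hp : PowerSeries.constantCoeff p = 1) : (1 : ℂ⟦X⟧) ∈ scale p⁻¹ M :=
  mem_scale.mpr ⟨p, hpM, by rw [mul_comm, mul_inv_of_constantCoeff hp]⟩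

/-- The case of a general standard module follows by multiplying with the inverse of a unit in `M`. -/
lemma genY_mul_mem_of_even_of_isStandard (E : Exponents u v) {M : Submodule (R u v) ℂ⟦X⟧}
    (h0 : 0 ∈ valuations (M : Set ℂ⟦X⟧)) {g S n : ℕ}
    (hS : 4 * S + g = 2 * u) (hnv : n ≤ v)
    (hn : ∀ k ∈ valuations (M : Set ℂ⟦X⟧), k % 2 = 1 → 2 * u ≤ k → n ≤ k)
    (hl : ∀ k, g + n ≤ k → k ∈ valuations (M : Set ℂ⟦X⟧)) (hg : g < 2 * u) {f : ℂ⟦X⟧}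
    (hf1 : PowerSeries.coeff g f = 1) (hfg : f ∈ tail g)
    (hf : PowerSeries.X ^ 4 * f ∈ M) : genY u v * f ∈ M := by
  obtain ⟨p, hpM, hp⟩ := exists_unit_mem h0
  have hp' := inv_constantCoeff hp
  have hv := valuations_scale hp' M
  have := genY_mul_mem_of_even E (one_mem_scale_inv hpM hp) hS hnv (by rwa [hv]) (by rwa [hv]) hg
    (f := p⁻¹ * f) (by rw [coeff_mul_of_mem_tail hp' hfg, hf1]) (mul_mem_tail_right hfg _)
    (mem_scale.mpr ⟨_, hf, by ring⟩)
  obtain ⟨m, hm, h⟩ := mem_scale.mp this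
  have h2 : p * (p⁻¹ * m) = p * (genY u v * (p⁻¹ * f)) := by rw [h]
  rw [← mul_assoc, mul_inv_of_constantCoeff hp, one_mul, show p * (genY u v * (p⁻¹ * f)) =
    (p * p⁻¹) * (genY u v * f) by ring, mul_inv_of_constantCoeff hp, one_mul] at h2
  rwa [← h2]

/-- If a module containing `1` has an even valuation `g ≡ 2 (mod 4)` less than `2u` and no odd valuation
up to `v`, then it has the valuation `v + g`. -/
lemma add_mem_valuations_of_odd (E : Exponents u v) {M : Submodule (R u v) ℂ⟦X⟧} (h1 : (1 : ℂ⟦X⟧) ∈ M)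
    {g S : ℕ} (hS : 4 * S + g = 2 * u) (hgM : g ∈ valuations (M : Set ℂ⟦X⟧))
    (hodd : ∀ k ∈ valuations (M : Set ℂ⟦X⟧), k % 2 = 1 → v < k) : v + g ∈ valuations (M : Set ℂ⟦X⟧) := by
  have huv := E.lt
  have hu := E.u_mod
  have hY : genY u v ∈ M := by rw [← mul_one (genY u v)]; exact genY_mul_mem E h1
  have key : ∀ d, 2 * u + 1 + d ≤ v + 1 → ∃ f ∈ M, f ∈ tail g ∧ PowerSeries.coeff g f = 1 ∧
      genY u v - PowerSeries.X ^ (4 * S) * f ∈ tail (2 * u + 1 + d) := by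
    intro d
    induction d with
    | zero =>
      intro _
      obtain ⟨f, hf, hf1, hfg⟩ := exists_monic_of_mem_valuations (M := M.restrictScalars ℂ) hgM
      refine ⟨f, hf, hfg, hf1, mem_tail_succ ((tail _).sub_mem (genY_mem_tail E) ?_) ?_⟩
      · rw [← hS]; exact mul_mem_tail (X_pow_mem_tail _) hfg
      · rw [map_sub, coeff_genY E, PowerSeries.coeff_X_pow_mul', if_pos (by omega),
          show 2 * u - 4 * S = g by omega, hf1, sub_self]
    | succ d ih =>
      intro hd
      obtain ⟨f, hf, hfg, hf1, hw⟩ := ih (by omega)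
      set w := genY u v - PowerSeries.X ^ (4 * S) * f with hw_def
      have hwM : w ∈ M := M.sub_mem hY (X_pow_mul_mem E hf (by omega))
      -- Correct `f` by an element `e` of order greater than `g`.
      have hred : ∀ e ∈ M, e ∈ tail (g + 1) →
          PowerSeries.X ^ (4 * S) * e ∈ tail (2 * u + 1 + d) →
          PowerSeries.coeff (2 * u + 1 + d) (PowerSeries.X ^ (4 * S) * e) = 1 →
          ∃ f ∈ M, f ∈ tail g ∧ PowerSeries.coeff g f = 1 ∧
            genY u v - PowerSeries.X ^ (4 * S) * f ∈ tail (2 * u + 1 + (d + 1)) := by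
        intro e he heg het he1
        refine ⟨f + PowerSeries.coeff (2 * u + 1 + d) w • e, M.add_mem hf (smul_mem_complex he _),
          (tail g).add_mem hfg ((tail g).smul_mem _ (tail_anti (by omega) heg)), ?_, ?_⟩
        · rw [map_add, map_smul, heg g (by omega), smul_zero, add_zero, hf1]
        · have := sub_smul_mem_tail_succ hw het he1
          rw [mul_add, mul_smul_comm, ← sub_sub]
          exact this
      by_cases h0 : PowerSeries.coeff (2 * u + 1 + d) w = 0
      · exact ⟨f, hf, hfg, hf1, mem_tail_succ hw h0⟩
      have hk2 : (2 * u + 1 + d) % 2 = 0 := by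
        by_contra h
        have := hodd _ (mem_valuations_iff.mpr ⟨w, hwM, h0, hw⟩) (by omega)
        omega
      by_cases hk4 : (2 * u + 1 + d) % 4 = 0
      · have he : (PowerSeries.X : ℂ⟦X⟧) ^ (4 * S) * PowerSeries.X ^ (g + 1 + d) =
            PowerSeries.X ^ (2 * u + 1 + d) := by rw [← pow_add]; congr 1; omega
        refine hred (PowerSeries.X ^ (g + 1 + d)) (X_pow_mem_of_one_mem E h1 (by omega))
          (tail_anti (by omega) (X_pow_mem_tail _)) ?_ ?_
        · rw [he]; exact X_pow_mem_tail _
        · rw [he]; exact PowerSeries.coeff_X_pow_self _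
      · have he : (PowerSeries.X : ℂ⟦X⟧) ^ (4 * S) * (PowerSeries.X ^ (d + 1) * f) =
            PowerSeries.X ^ (4 * S + (d + 1)) * f := by rw [← mul_assoc, ← pow_add]
        refine hred (PowerSeries.X ^ (d + 1) * f) (X_pow_mul_mem E hf (by omega)) ?_ ?_ ?_
        · exact tail_anti (by omega) (mul_mem_tail (X_pow_mem_tail (d + 1)) hfg)
        · rw [he]
          exact tail_anti (by omega) (mul_mem_tail (X_pow_mem_tail (4 * S + (d + 1))) hfg)
        · rw [he, PowerSeries.coeff_X_pow_mul', if_pos (by omega),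
            show 2 * u + 1 + d - (4 * S + (d + 1)) = g by omega, hf1]
  obtain ⟨f, hf, hfg, hf1, hw⟩ := key (v - 2 * u) (by omega)
  set w := genY u v - PowerSeries.X ^ (4 * S) * f with hw_def
  have h2 : (PowerSeries.X : ℂ⟦X⟧) ^ (4 * S) * (genY u v * f - PowerSeries.X ^ (4 * u - 4 * S)) =
      2 * PowerSeries.X ^ (4 * S + (v + g)) + (PowerSeries.X ^ (2 * v) - genY u v * w) := by
    have h3 : (PowerSeries.X : ℂ⟦X⟧) ^ (4 * S) * PowerSeries.X ^ (4 * u - 4 * S) =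
      PowerSeries.X ^ (4 * u) := by rw [← pow_add]; congr 1; omega
    have h4 : 4 * S + (v + g) = 2 * u + v := by omega
    rw [mul_sub, h3, h4, hw_def]
    linear_combination genY_mul_genY u v
  have h5 : PowerSeries.X ^ (2 * v) - genY u v * w ∈ tail (4 * S + (v + g) + 1) := by
    refine (tail _).sub_mem (tail_anti (by omega) (X_pow_mem_tail _)) ?_
    exact tail_anti (by omega) (mul_mem_tail (genY_mem_tail E) hw)
  have h6 : ∀ i, PowerSeries.coeff i (genY u v * f - PowerSeries.X ^ (4 * u - 4 * S)) =
      PowerSeries.coeff (i + 4 * S) (2 * PowerSeries.X ^ (4 * S + (v + g)) +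
        (PowerSeries.X ^ (2 * v) - genY u v * w)) := by
    intro i
    rw [← h2, PowerSeries.coeff_X_pow_mul]
  have h7 : ∀ i, PowerSeries.coeff i (2 * PowerSeries.X ^ (4 * S + (v + g)) : ℂ⟦X⟧) =
      if i = 4 * S + (v + g) then 2 else 0 := by
    intro i
    rw [two_mul, map_add, PowerSeries.coeff_X_pow]
    split_ifs <;> norm_num
  refine mem_valuations_iff.mpr ⟨_, M.sub_mem (genY_mul_mem E hf)
    (X_pow_mem_of_one_mem E h1 (k := 4 * u - 4 * S) (by omega)), ?_, fun i hi => ?_⟩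
  · rw [h6, map_add, h7, if_pos (by omega), h5 _ (by omega), add_zero]
    exact two_ne_zero
  · rw [h6, map_add, h7, if_neg (by omega), h5 _ (by omega), add_zero]

/-! ### Normalised cells -/

/-- The modules containing `1` with the set `D` of added gaps. -/
def NormCell (u v : ℕ) (D : Set ℕ) : Type :=
  {M : Submodule (R u v) ℂ⟦X⟧ // (1 : ℂ⟦X⟧) ∈ M ∧ valuations (M : Set ℂ⟦X⟧) = semigroup u v ∪ D}

/-- The algebra of regular functions on a normalised cell. -/
def normAlg (u v : ℕ) (D : Set ℕ) : Subalgebra ℂ (NormCell u v D → ℂ) :=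
  coordAlg fun (M : NormCell u v D) (_ : Unit) => M.1.restrictScalars ℂ

lemma zero_mem_valuations_of_one_mem {M : Set ℂ⟦X⟧} (h1 : (1 : ℂ⟦X⟧) ∈ M) : 0 ∈ valuations M :=
  mem_valuations_of_mem h1 (by simp) fun _ h => absurd h (Nat.not_lt_zero _)

lemma tail_le_of_one_mem (E : Exponents u v) {M : Submodule (R u v) ℂ⟦X⟧} (h1 : (1 : ℂ⟦X⟧) ∈ M) :
    tail (2 * delta u v) ≤ M.restrictScalars ℂ :=
  tail_le_of_isStandard E (zero_mem_valuations_of_one_mem h1)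

lemma mem_of_mem_R {M : Submodule (R u v) ℂ⟦X⟧} (h1 : (1 : ℂ⟦X⟧) ∈ M) {r : ℂ⟦X⟧} (hr : r ∈ R u v) : r ∈ M := by
  rw [← mul_one r]; exact mul_mem_of_mem_R hr h1

/-- The power series of order at least `c`, as an `R`-module. -/
def tailModule (u v c : ℕ) : Submodule (R u v) ℂ⟦X⟧ where
  carrier := tail c
  add_mem' := (tail c).add_mem
  zero_mem' := (tail c).zero_mem
  smul_mem' r _ hf := mul_mem_tail_right hf (r : ℂ⟦X⟧)

/-- The module is `R + {f ∈ M' | ord f > g}`. -/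
lemma exists_smaller_module {M' : Submodule (R u v) ℂ⟦X⟧} {D : Set ℕ} {g : ℕ}
    (h1 : (1 : ℂ⟦X⟧) ∈ M') (hv : valuations (M' : Set ℂ⟦X⟧) = semigroup u v ∪ (D ∪ {g}))
    (hg : g ∉ semigroup u v) (hgD : ∀ d ∈ D, g < d) :
    ∃ M ≤ M', (1 : ℂ⟦X⟧) ∈ M ∧ valuations (M : Set ℂ⟦X⟧) = semigroup u v ∪ D := by
  let M : Submodule (R u v) ℂ⟦X⟧ := Submodule.span (R u v) {(1 : ℂ⟦X⟧)} ⊔ (M' ⊓ tailModule u v (g + 1))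
  have hM1 : (1 : ℂ⟦X⟧) ∈ M := (le_sup_left : _ ≤ M) (Submodule.mem_span_singleton_self _)
  have hle : M ≤ M' := sup_le (by rwa [Submodule.span_le, Set.singleton_subset_iff]) inf_le_left
  refine ⟨M, hle, hM1, Set.Subset.antisymm ?_ ?_⟩
  · intro k hk
    obtain ⟨f, hf, hf0, hfk⟩ := mem_valuations_iff.mp hk
    have hk' : k ∈ semigroup u v ∪ (D ∪ {g}) := by
      rw [← hv]; exact mem_valuations_iff.mpr ⟨f, hle hf, hf0, hfk⟩
    rcases hk' with hk' | hk' | rfl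
    · exact Or.inl hk'
    · exact Or.inr hk'
    · exfalso
      obtain ⟨r, hr, m, hm, rfl⟩ := Submodule.mem_sup.mp hf
      obtain ⟨r, rfl⟩ := Submodule.mem_span_singleton.mp hr
      have hm' : ∀ i ≤ k, PowerSeries.coeff i m = 0 := fun i hi => hm.2 i (by omega)
      refine hg (mem_valuations_iff.mpr ⟨r, r.2, ?_, fun i hi => ?_⟩)
      · rw [map_add, hm' k le_rfl, add_zero] at hf0
        simpa [Algebra.smul_def] using hf0
      · have := hfk i hi
        rw [map_add, hm' i hi.le, add_zero] at this
        simpa [Algebra.smul_def] using this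
  · rintro k (hk | hk)
    · exact semigroup_subset_valuations (zero_mem_valuations_of_one_mem (M := (M : Set ℂ⟦X⟧)) hM1) hk
    · have hk' : k ∈ valuations (M' : Set ℂ⟦X⟧) := by rw [hv]; exact Or.inr (Or.inl hk)
      obtain ⟨f, hf, hf0, hfk⟩ := mem_valuations_iff.mp hk'
      refine mem_valuations_iff.mpr ⟨f, (le_sup_right : _ ≤ M) ⟨hf, ?_⟩, hf0, hfk⟩
      exact fun i hi => hfk i (by have := hgD k hk; omega)

section Canonical

variable (E : Exponents u v) {D : Set ℕ} {g : ℕ} (hg : g ∈ gaps u v \ D) (hgD : ∀ d ∈ D, g < d)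

include E in
lemma smaller_module_unique {M₁ M₂ M' : Submodule (R u v) ℂ⟦X⟧} (hle₁ : M₁ ≤ M') (hle₂ : M₂ ≤ M')
    (h₁ : (1 : ℂ⟦X⟧) ∈ M₁) (h₂ : (1 : ℂ⟦X⟧) ∈ M₂) (hv₁ : valuations (M₁ : Set ℂ⟦X⟧) = semigroup u v ∪ D)
    (hv₂ : valuations (M₂ : Set ℂ⟦X⟧) = semigroup u v ∪ D)
    (hv : valuations (M' : Set ℂ⟦X⟧) = semigroup u v ∪ (D ∪ {g})) (hgD : ∀ d ∈ D, g < d) : M₁ ≤ M₂ := by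
  have hvM : ∀ M : Submodule (R u v) ℂ⟦X⟧, valuations (M : Set ℂ⟦X⟧) = semigroup u v ∪ D →
      valuations (M' : Set ℂ⟦X⟧) = valuations (M : Set ℂ⟦X⟧) ∪ {g} := by
    intro M h; rw [hv, h, Set.union_assoc]
  intro f hf
  -- Choose `r ∈ R` with `f - r` of order greater than `g`.
  have key : ∀ n ≤ g + 1, ∃ r ∈ R u v, f - r ∈ tail n := by
    intro n
    induction n with
    | zero => exact fun _ => ⟨0, (R u v).zero_mem, fun _ h => absurd h (Nat.not_lt_zero _)⟩
    | succ n ih =>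
      intro hn
      obtain ⟨r, hr, hfr⟩ := ih (by omega)
      by_cases h0 : PowerSeries.coeff n (f - r) = 0
      · exact ⟨r, hr, mem_tail_succ hfr h0⟩
      have hnv : n ∈ semigroup u v ∪ D := by
        rw [← hv₁]
        exact mem_valuations_iff.mpr ⟨f - r, M₁.sub_mem hf (mem_of_mem_R h₁ hr), h0, hfr⟩
      have hnΓ : n ∈ semigroup u v := hnv.resolve_right fun h => by have := hgD n h; omega
      obtain ⟨e, he, he1, hen⟩ := exists_monic_of_mem_valuations (M := (R u v).toSubmodule) hnΓ
      refine ⟨r + PowerSeries.coeff n (f - r) • e, (R u v).add_mem hr ((R u v).smul_mem he _), ?_⟩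
      rw [← sub_sub]
      exact sub_smul_mem_tail_succ hfr hen he1
  obtain ⟨r, hr, hfr⟩ := key (g + 1) le_rfl
  have := mem_of_mem_tail_succ (M := M₂.restrictScalars ℂ) (M' := M'.restrictScalars ℂ)
    (tail_le_of_one_mem E h₂) hle₂ (hvM M₂ hv₂)
    (M'.sub_mem (hle₁ hf) (mem_of_mem_R (hle₂ h₂) hr)) hfr
  have h3 : f - r + r ∈ M₂ := M₂.add_mem this (mem_of_mem_R h₂ hr)
  rwa [sub_add_cancel] at h3

/-- For `g` smaller than all elements of `D`, the unique submodule with valuations `Γ ∪ D` that contains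
`1`. -/
def smaller (M' : NormCell u v (D ∪ {g})) : NormCell u v D :=
  ⟨(exists_smaller_module M'.2.1 M'.2.2 hg.1 hgD).choose,
    (exists_smaller_module M'.2.1 M'.2.2 hg.1 hgD).choose_spec.2⟩

lemma smaller_le (M' : NormCell u v (D ∪ {g})) : (smaller hg hgD M').1 ≤ M'.1 :=
  (exists_smaller_module M'.2.1 M'.2.2 hg.1 hgD).choose_spec.1

include E in
lemma eq_smaller (M' : NormCell u v (D ∪ {g})) (M : NormCell u v D) (h : M.1 ≤ M'.1) :
    smaller hg hgD M' = M :=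
  Subtype.ext (le_antisymm
    (smaller_module_unique E (smaller_le hg hgD M') h (smaller hg hgD M').2.1 M.2.1
      (smaller hg hgD M').2.2 M.2.2 M'.2.2 hgD)
    (smaller_module_unique E h (smaller_le hg hgD M') M.2.1 (smaller hg hgD M').2.1
      M.2.2 (smaller hg hgD M').2.2 M'.2.2 hgD))

include E in
/-- The passage from `M'` to its submodule is algebraic: reduced elements of orders less than `g` come
from `R`, the others from `M'`. -/
lemma regularFamily_red_smaller (a : ℕ) :
    IsRegularFamily (normAlg u v (D ∪ {g})) fun M' => red ((smaller hg hgD M').1.restrictScalars ℂ) a := by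
  have hR : ∀ a, ∃ e : ℂ⟦X⟧, a ∈ semigroup u v → e ∈ R u v ∧ PowerSeries.coeff a e = 1 ∧ e ∈ tail a := by
    intro a
    by_cases ha : a ∈ semigroup u v
    · obtain ⟨e, he⟩ := exists_monic_of_mem_valuations (M := (R u v).toSubmodule) ha
      exact ⟨e, fun _ => he⟩
    · exact ⟨0, fun h => absurd h ha⟩
  choose e he using hR
  refine regularFamily_red (Δ := semigroup u v ∪ D) (c := 2 * delta u v)
    (fun M' => tail_le_of_one_mem E (smaller hg hgD M').2.1)
    (fun M' => by rw [Submodule.coe_restrictScalars]; exact (smaller hg hgD M').2.2)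
    (e := fun a M' => if a < g then e a else red (M'.1.restrictScalars ℂ) a) ?_ a
  intro a ha _
  by_cases hag : a < g
  · have haΓ : a ∈ semigroup u v := ha.resolve_right fun h => by have := hgD a h; omega
    simp only [if_pos hag]
    exact ⟨IsRegularFamily.const _, fun M' => ⟨mem_of_mem_R (smaller hg hgD M').2.1 (he a haΓ).1,
      (he a haΓ).2⟩⟩
  · simp only [if_neg hag]
    have hag' : a ≠ g := by rintro rfl; exact ha.elim hg.1 hg.2
    refine ⟨regularFamily_red_coordAlg (fun (M : NormCell u v (D ∪ {g})) (_ : Unit) => M.1.restrictScalars ℂ) () a,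
      fun M' => ⟨?_, ?_, red_mem_tail (tail_le_of_one_mem E M'.2.1) a⟩⟩
    · refine mem_of_mem_tail_succ (g := g) (tail_le_of_one_mem E (smaller hg hgD M').2.1)
        (smaller_le hg hgD M') ?_ (red_mem (tail_le_of_one_mem E M'.2.1) a)
        (tail_anti (by omega) (red_mem_tail (tail_le_of_one_mem E M'.2.1) a))
      rw [Submodule.coe_restrictScalars, Submodule.coe_restrictScalars, M'.2.2, (smaller hg hgD M').2.2,
        Set.union_assoc]
    · rw [coeff_red (tail_le_of_one_mem E M'.2.1), if_pos rfl]
      rw [Submodule.coe_restrictScalars, M'.2.2]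
      exact ha.imp_right Or.inl

include E hg hgD in
/-- A free step of normalised cells: all elements of `D` being greater than `g`, every `M'` has a canonical submodule
`smaller M'`, and the fibres of `M' ↦ smaller M'` are affine spaces of dimension `|K|`. -/
theorem normCell_step {K : Finset ℕ}
    (hK : ∀ k, k ∈ K ↔ g < k ∧ k ∉ semigroup u v ∪ D ∧ k + 4 ∈ semigroup u v ∪ D)
    (hg4 : g + 4 ∈ semigroup u v ∪ D)
    (hfree : ∀ M : NormCell u v D, ∀ f, PowerSeries.coeff g f = 1 → f ∈ tail g →
      PowerSeries.X ^ 4 * f ∈ M.1 → genY u v * f ∈ M.1)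
    {N : ℕ} (hY : IsAffineCell (normAlg u v D) N) : IsAffineCell (normAlg u v (D ∪ {g})) (N + K.card) := by
  refine isAffineCell_of_free_step E (MX := fun (M : NormCell u v (D ∪ {g})) (_ : Unit) => M.1)
    (MY := fun (M : NormCell u v D) (_ : Unit) => M.1) (i₁ := ()) (j₁ := ())
    (fun y => tail_le_of_one_mem E y.2.1) (fun y => y.2.2) hK (fun h => h.elim hg.1 hg.2) hg4 hfree
    (smaller hg hgD) (fun _ a => regularFamily_red_smaller E hg hgD a) (fun _ => Or.inl rfl)
    (smaller_le hg hgD) (fun x => by rw [x.2.2, Set.union_assoc]) (fun _ _ _ h => Subtype.ext h) ?_ hY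
  intro y M' hle hv
  let x : NormCell u v (D ∪ {g}) := ⟨M', hle y.2.1, by rw [hv, Set.union_assoc]⟩
  exact ⟨x, eq_smaller E hg hgD x y hle, rfl⟩

end Canonical

/-- Normalisation: if the members of a family `MX` are the modules `p M`, with `M` in the family `MY` and
`p` any power series with constant term `1`, then `MX` is the product of `MY` and an affine space whose
coordinates are the nontrivial coefficients of the reduced element of order `0`. -/
theorem isAffineCell_of_scale {X Y J : Type} {MX : X → J → Submodule (R u v) ℂ⟦X⟧}
    {MY : Y → J → Submodule (R u v) ℂ⟦X⟧} {j₀ : J} {Δ : J → Set ℕ} {c : ℕ} {G : Finset ℕ}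
    {OY : Subalgebra ℂ (Y → ℂ)}
    (hcX : ∀ x j, tail c ≤ (MX x j).restrictScalars ℂ) (hcY : ∀ y j, tail c ≤ (MY y j).restrictScalars ℂ)
    (hX : ∀ x j, valuations (MX x j : Set ℂ⟦X⟧) = Δ j) (hY : ∀ y j, valuations (MY y j : Set ℂ⟦X⟧) = Δ j)
    (h1 : ∀ y, (1 : ℂ⟦X⟧) ∈ MY y j₀) (h0 : 0 ∈ Δ j₀) (hG : ∀ k, k ∈ G ↔ k ∉ Δ j₀)
    (hiX : Function.Injective MX) (hiY : Function.Injective MY)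
    (hA : ∀ y p, PowerSeries.constantCoeff p = 1 → ∃ x, ∀ j, MX x j = scale p (MY y j))
    (hB : ∀ x p, PowerSeries.constantCoeff p = 1 → p ∈ MX x j₀ → ∃ y, ∀ j, MX x j = scale p (MY y j))
    (hO : OY ≤ coordAlg fun y j => (MY y j).restrictScalars ℂ)
    (hO' : ∀ j a, IsRegularFamily OY fun y => red ((MY y j).restrictScalars ℂ) a)
    {N : ℕ} (h : IsAffineCell OY N) :
    IsAffineCell (coordAlg fun x j => (MX x j).restrictScalars ℂ) (N + G.card) := by
  let p₀ : X → ℂ⟦X⟧ := fun x => red ((MX x j₀).restrictScalars ℂ) 0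
  have hp₀ : ∀ x, PowerSeries.constantCoeff (p₀ x) = 1 := by
    intro x
    rw [← PowerSeries.coeff_zero_eq_constantCoeff_apply]
    exact (coeff_red (hcX x j₀) (by rwa [Submodule.coe_restrictScalars, hX])).trans (if_pos rfl)
  choose y₀ hy₀ using fun x => hB x (p₀ x) (hp₀ x) (red_mem (hcX x j₀) 0)
  -- The series with constant term `1` and prescribed coefficients at `G`.
  let P : (G → ℂ) → ℂ⟦X⟧ := fun r => PowerSeries.mk fun k =>
    if k = 0 then 1 else if hk : k ∈ G then r ⟨k, hk⟩ else 0
  have hG0 : 0 ∉ G := fun h => (hG 0).mp h h0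
  have hP : ∀ r, PowerSeries.constantCoeff (P r) = 1 := by
    intro r
    rw [← PowerSeries.coeff_zero_eq_constantCoeff_apply, PowerSeries.coeff_mk, if_pos rfl]
  have hPG : ∀ r (k : G), PowerSeries.coeff k (P r) = r k := by
    intro r k
    rw [PowerSeries.coeff_mk, if_neg, dif_pos k.2]
    intro h
    exact hG0 (h ▸ k.2)
  have hPΔ : ∀ r, ∀ b ∈ Δ j₀, PowerSeries.coeff b (P r) = if b = 0 then 1 else 0 := by
    intro r b hb
    rw [PowerSeries.coeff_mk, dif_neg fun h => (hG b).mp h hb]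
  have hredP : ∀ x y r, MX x j₀ = scale (P r) (MY y j₀) → p₀ x = P r := by
    intro x y r hx
    refine red_eq ?_ fun b hb => hPΔ r b (by rwa [Submodule.coe_restrictScalars, hX] at hb)
    rw [Submodule.restrictScalars_mem, hx]
    exact mem_scale.mpr ⟨1, h1 y, mul_one _⟩
  have hp₀P : ∀ x, p₀ x = P fun k => PowerSeries.coeff k (p₀ x) := by
    intro x
    ext k
    by_cases hk : k ∈ G
    · exact (hPG (fun k => PowerSeries.coeff k (p₀ x)) ⟨k, hk⟩).symm
    · have hk' : k ∈ Δ j₀ := by by_contra h; exact hk ((hG k).mpr h)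
      refine Eq.trans ?_ (hPΔ (fun k => PowerSeries.coeff k (p₀ x)) k hk').symm
      exact coeff_red (hcX x j₀) (by rwa [Submodule.coe_restrictScalars, hX])
  let φ₀ : X → Y × (G → ℂ) := fun x => (y₀ x, fun k => PowerSeries.coeff k (p₀ x))
  have hφ : Function.Bijective φ₀ := by
    constructor
    · intro x x' hxx
      have e1 : y₀ x = y₀ x' := congrArg Prod.fst hxx
      have e2 : p₀ x = p₀ x' := by
        rw [hp₀P x, hp₀P x']
        exact congrArg P (congrArg Prod.snd hxx)
      refine hiX (funext fun j => ?_)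
      rw [hy₀, hy₀, e1, e2]
    · rintro ⟨y, r⟩
      obtain ⟨x, hx⟩ := hA y (P r) (hP r)
      have e2 := hredP x y r (hx j₀)
      refine ⟨x, Prod.ext (hiY (funext fun j => ?_)) (funext fun k => ?_)⟩
      · have := hy₀ x j
        rw [hx, e2] at this
        exact (scale_injective (hP r) this).symm
      · exact (congrArg (PowerSeries.coeff (k : ℕ)) e2).trans (hPG r k)
  let φ := Equiv.ofBijective φ₀ hφ
  have hXreg := regularFamily_red_coordAlg fun x j => (MX x j).restrictScalars ℂ
  have hscale : ∀ x j, MY (y₀ x) j = scale (p₀ x)⁻¹ (MX x j) := by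
    intro x j
    refine scale_injective (hp₀ x) ?_
    rw [scale_scale_inv (hp₀ x), hy₀]
  refine h.of_prod φ (fun f hf => comp_mem_of_mem_coordAlg (fun j a => ?_) (hO hf))
    (fun k => hXreg j₀ 0 k) ?_ (by rw [Fintype.card_coe])
  · refine regularFamily_red (Δ := Δ j) (c := c) (fun x => hcY _ j)
      (fun x => by rw [Submodule.coe_restrictScalars, hY])
      (e := fun a x => (p₀ x)⁻¹ * red ((MX x j).restrictScalars ℂ) a) (fun b hb _ => ⟨?_, fun x => ⟨?_, ?_, ?_⟩⟩) a
    · exact (IsRegularFamily.inv (hXreg j₀ 0) hp₀).mul (hXreg j b)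
    · change _ ∈ MY (y₀ x) j
      rw [hscale]
      exact mem_scale.mpr ⟨_, red_mem (hcX x j) b, rfl⟩
    · rw [coeff_mul_of_mem_tail (inv_constantCoeff (hp₀ x)) (red_mem_tail (hcX x j) b),
        coeff_red (hcX x j) (by rwa [Submodule.coe_restrictScalars, hX]), if_pos rfl]
    · exact mul_mem_tail_right (red_mem_tail (hcX x j) b) _
  · intro f hf Z Q y r hy hr
    refine comp_mem_of_mem_coordAlg (fun j a => ?_) hf
    have e1 : ∀ z, y₀ (φ.symm (y z, r z)) = y z := fun z => congrArg Prod.fst (φ.apply_symm_apply (y z, r z))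
    have e2 : ∀ z, p₀ (φ.symm (y z, r z)) = P (r z) := fun z => by
      rw [hp₀P]
      exact congrArg P (congrArg Prod.snd (φ.apply_symm_apply (y z, r z)))
    have e3 : ∀ z j, MX (φ.symm (y z, r z)) j = scale (P (r z)) (MY (y z) j) := fun z j => by
      rw [hy₀, e1, e2]
    have hPreg : IsRegularFamily Q fun z => P (r z) := by
      intro k
      simp only [P, PowerSeries.coeff_mk]
      by_cases hk0 : k = 0
      · simp only [if_pos hk0]; exact Q.one_mem
      · simp only [if_neg hk0]
        by_cases hk : k ∈ G
        · simp only [dif_pos hk]; exact hr ⟨k, hk⟩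
        · simp only [dif_neg hk]; exact Q.zero_mem
    refine regularFamily_red (Δ := Δ j) (c := c) (fun z => hcX _ j)
      (fun z => by rw [Submodule.coe_restrictScalars, hX])
      (e := fun a z => P (r z) * red ((MY (y z) j).restrictScalars ℂ) a) (fun b hb _ => ⟨?_, fun z => ⟨?_, ?_, ?_⟩⟩) a
    · exact hPreg.mul fun k => hy _ (hO' j b k)
    · rw [Submodule.restrictScalars_mem, e3]
      exact mem_scale.mpr ⟨_, red_mem (hcY (y z) j) b, rfl⟩
    · rw [coeff_mul_of_mem_tail (hP _) (red_mem_tail (hcY (y z) j) b),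
        coeff_red (hcY (y z) j) (by rwa [Submodule.coe_restrictScalars, hY]), if_pos rfl]
    · exact mul_mem_tail_right (red_mem_tail (hcY (y z) j) b) _

/-! ### Cells of flags -/

section Flags

variable {m : ℕ} {D : Set ℕ}

lemma dset_castSucc (g : Fin (m + 1) → ℕ) (i : Fin (m + 1)) :
    dset D g i.castSucc = dset D (fun j => g j.castSucc) i := by
  ext k
  refine or_congr_right ⟨?_, ?_⟩
  · rintro ⟨j, hj, rfl⟩
    have hj' : (j : ℕ) < m := by
      have h1 : (j : ℕ) < i := hj
      omega
    exact ⟨⟨j, hj'⟩, hj, rfl⟩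
  · rintro ⟨j, hj, rfl⟩
    exact ⟨j.castSucc, hj, rfl⟩

lemma dset_last (g : Fin (m + 1) → ℕ) :
    dset D g (Fin.last (m + 1)) = dset D (fun j => g j.castSucc) (Fin.last m) ∪ {g (Fin.last m)} := by
  ext k
  constructor
  · rintro (hk | ⟨j, -, rfl⟩)
    · exact Or.inl (Or.inl hk)
    · induction j using Fin.lastCases with
      | last => exact Or.inr rfl
      | cast j => exact Or.inl (Or.inr ⟨j, Fin.castSucc_lt_last j, rfl⟩)
  · rintro ((hk | ⟨j, -, rfl⟩) | rfl)
    · exact Or.inl hk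
    · exact Or.inr ⟨j.castSucc, Fin.castSucc_lt_last _, rfl⟩
    · exact Or.inr ⟨Fin.last m, Fin.castSucc_lt_last _, rfl⟩

lemma dset_zero (g : Fin m → ℕ) : dset D g 0 = D := by
  ext k
  constructor
  · rintro (hk | ⟨j, hj, -⟩)
    · exact hk
    · exact absurd hj (Fin.not_lt_zero _)
  · exact Or.inl

lemma dset_empty (i : Fin 1) : dset D (![] : Fin 0 → ℕ) i = D := by
  rw [Subsingleton.elim i 0, dset_zero]

lemma dset_singleton_one (g : ℕ) : dset D ![g] 1 = D ∪ {g} := by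
  have h := dset_last (D := D) ![g]
  rw [show Fin.last 1 = 1 from rfl] at h
  rw [h, show (Fin.last 0 : Fin 1) = 0 from rfl, dset_zero]
  rfl

lemma IsDFlag.init {g : Fin (m + 1) → ℕ} (hD : IsDFlag u v D g) : IsDFlag u v D fun j => g j.castSucc where
  subset_gaps := hD.subset_gaps
  strictMono := fun _ _ h => hD.strictMono (Fin.castSucc_lt_castSucc_iff.mpr h)
  mem_gaps := fun j => hD.mem_gaps _
  isModule := fun i => by rw [← dset_castSucc]; exact hD.isModule _

lemma IsDFlag.last_notMem {g : Fin (m + 1) → ℕ} (hD : IsDFlag u v D g) :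
    g (Fin.last m) ∉ semigroup u v ∪ dset D (fun j => g j.castSucc) (Fin.last m) := by
  rintro (h | h | ⟨j, -, h⟩)
  · exact (hD.mem_gaps _).1 h
  · exact (hD.mem_gaps _).2 h
  · exact absurd h (hD.strictMono (Fin.castSucc_lt_last j)).ne

/-- Forgetting the last module of a flag. -/
def FlagCell.init {g : Fin (m + 1) → ℕ} (F : FlagCell u v D g) : FlagCell u v D fun j => g j.castSucc :=
  ⟨fun i => F.1 i.castSucc, fun _ _ h => F.2.1 (Fin.castSucc_le_castSucc_iff.mpr h), fun i => by
    rw [← dset_castSucc]; exact F.2.2 _⟩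

lemma tail_le_flagCell (E : Exponents u v) {g : Fin m → ℕ} (F : FlagCell u v D g) (i : Fin (m + 1)) :
    tail (2 * delta u v) ≤ (F.1 i).restrictScalars ℂ :=
  tail_le_of_isStandard E (F.2.2 i).1

lemma FlagCell.exists_extension (E : Exponents u v) {g : Fin (m + 1) → ℕ} (hD : IsDFlag u v D g)
    (F : FlagCell u v D fun j => g j.castSucc) {M' : Submodule (R u v) ℂ⟦X⟧} (hle : F.1 (Fin.last m) ≤ M')
    (hv : valuations (M' : Set ℂ⟦X⟧) =
      semigroup u v ∪ dset D (fun j => g j.castSucc) (Fin.last m) ∪ {g (Fin.last m)}) :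
    ∃ F' : FlagCell u v D g, F'.init = F ∧ F'.1 (Fin.last (m + 1)) = M' := by
  have h1 : ∀ i : Fin (m + 1), (Fin.snoc F.1 M' : Fin (m + 2) → Submodule (R u v) ℂ⟦X⟧) i.castSucc = F.1 i :=
    fun i => Fin.snoc_castSucc (α := fun _ => Submodule (R u v) ℂ⟦X⟧) _ _ _
  have h2 : (Fin.snoc F.1 M' : Fin (m + 2) → Submodule (R u v) ℂ⟦X⟧) (Fin.last (m + 1)) = M' :=
    Fin.snoc_last (α := fun _ => Submodule (R u v) ℂ⟦X⟧) _ _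
  refine ⟨⟨Fin.snoc F.1 M', ?_, ?_⟩, ?_, h2⟩
  · intro i j hij
    induction j using Fin.lastCases with
    | last =>
      induction i using Fin.lastCases with
      | last => exact le_rfl
      | cast i => rw [h1, h2]; exact (F.2.1 (Fin.le_last i)).trans hle
    | cast j =>
      induction i using Fin.lastCases with
      | last => exact absurd (Fin.castSucc_lt_last j) (not_lt.mpr hij)
      | cast i => rw [h1, h1]; exact F.2.1 (Fin.castSucc_le_castSucc_iff.mp hij)
  · intro i
    induction i using Fin.lastCases with
    | last =>
      rw [h2, isStandard_iff_valuations E (dset_subset_gaps hD _), hv, dset_last, Set.union_assoc]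
    | cast i => rw [h1, dset_castSucc]; exact F.2.2 i
  · exact Subtype.ext (funext h1)

/-- Extending flags by a free step multiplies the flagged cell by an affine space of dimension `|K|`. -/
theorem flagCell_step (E : Exponents u v) {g : Fin (m + 1) → ℕ} (hD : IsDFlag u v D g) {K : Finset ℕ}
    (hK : ∀ k, k ∈ K ↔ g (Fin.last m) < k ∧
      k ∉ semigroup u v ∪ dset D (fun j => g j.castSucc) (Fin.last m) ∧
      k + 4 ∈ semigroup u v ∪ dset D (fun j => g j.castSucc) (Fin.last m))
    (hfree : ∀ M : Submodule (R u v) ℂ⟦X⟧, valuations (M : Set ℂ⟦X⟧) =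
        semigroup u v ∪ dset D (fun j => g j.castSucc) (Fin.last m) →
      ∀ f, PowerSeries.coeff (g (Fin.last m)) f = 1 → f ∈ tail (g (Fin.last m)) →
        PowerSeries.X ^ 4 * f ∈ M → genY u v * f ∈ M)
    {N : ℕ} (hY : IsAffineCell (flagAlg u v D fun j => g j.castSucc) N) :
    IsAffineCell (flagAlg u v D g) (N + K.card) := by
  have hv := valuations_flagCell E hD.init
  have hg4 : g (Fin.last m) + 4 ∈ semigroup u v ∪ dset D (fun j => g j.castSucc) (Fin.last m) := by
    have h := (hD.isModule (Fin.last (m + 1))).2 4 (E.mem_semigroup_of_four rfl) (g (Fin.last m))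
      (by rw [dset_last]; exact Or.inr (Or.inr rfl))
    rw [dset_last, ← Set.union_assoc, add_comm] at h
    exact h.resolve_right (by simp)
  refine isAffineCell_of_free_step E (MX := fun (F : FlagCell u v D g) i => F.1 i)
    (MY := fun (F : FlagCell u v D fun j => g j.castSucc) i => F.1 i) (i₁ := Fin.last m)
    (j₁ := Fin.last (m + 1)) (fun y => tail_le_flagCell E y _) (fun y => hv y _) hK hD.last_notMem hg4
    (fun y => hfree _ (hv y _)) FlagCell.init
    (fun i a => regularFamily_red_coordAlg
      (fun (F : FlagCell u v D g) i => (F.1 i).restrictScalars ℂ) i.castSucc a) ?_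
    (fun x => x.2.1 (Fin.le_last _)) ?_ ?_ (fun y M' h1 h2 => y.exists_extension E hD h1 h2) hY
  · intro j
    induction j using Fin.lastCases with
    | last => exact Or.inl rfl
    | cast j => exact Or.inr ⟨j, fun _ => rfl⟩
  · intro x
    rw [valuations_flagCell E hD, dset_last, Set.union_assoc]
  · intro x x' h1 h2
    refine Subtype.ext (funext fun i => ?_)
    induction i using Fin.lastCases with
    | last => exact h2
    | cast i => exact congrFun (congrArg Subtype.val h1) i

end Flags

section Normalisation

variable (E : Exponents u v) {D : Set ℕ}

include E

omit E in
lemma isDFlag_empty (hD : D ⊆ gaps u v) (hΔ : IsStandardGammaModule u v (semigroup u v ∪ D)) :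
    IsDFlag u v D (![] : Fin 0 → ℕ) where
  subset_gaps := hD
  strictMono := fun i => i.elim0
  mem_gaps := fun i => i.elim0
  isModule := fun i => by rw [dset_empty]; exact hΔ

lemma exists_finset_compl (Δ : Set ℕ) : ∃ G : Finset ℕ, ∀ k, k ∈ G ↔ k ∉ semigroup u v ∪ Δ := by
  have hfin : {k | k ∉ semigroup u v ∪ Δ}.Finite :=
    E.gaps_finite.subset fun k hk h => hk (Or.inl h)
  exact ⟨hfin.toFinset, fun k => hfin.mem_toFinset⟩

/-- The cell of `D` is the product of the normalised cell and the space of units with coefficients at the gaps of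
`Γ ∪ D`. -/
theorem flagCell_empty_of_normCell (hD : IsDFlag u v D (![] : Fin 0 → ℕ)) {G : Finset ℕ}
    (hG : ∀ k, k ∈ G ↔ k ∉ semigroup u v ∪ D) {N : ℕ} (h : IsAffineCell (normAlg u v D) N) :
    IsAffineCell (flagAlg u v D (![] : Fin 0 → ℕ)) (N + G.card) := by
  have hv := valuations_flagCell E hD
  simp only [dset_empty] at hv
  refine isAffineCell_of_scale (MX := fun (F : FlagCell u v D (![] : Fin 0 → ℕ)) i => F.1 i)
    (MY := fun (y : NormCell u v D) _ => y.1) (j₀ := 0) (Δ := fun _ => semigroup u v ∪ D)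
    (c := 2 * delta u v) (tail_le_flagCell E) (fun y _ => tail_le_of_one_mem E y.2.1) hv
    (fun y _ => y.2.2) (fun y => y.2.1) (Or.inl E.zero_mem_semigroup) hG (fun _ _ h => Subtype.ext h)
    (fun _ _ h => Subtype.ext (congrFun h 0)) ?_ ?_ ?_ ?_ h
  · intro y p hp
    refine ⟨⟨fun _ => scale p y.1, fun _ _ _ => le_rfl, fun i => ?_⟩, fun _ => rfl⟩
    rw [dset_empty, isStandard_iff_valuations E hD.subset_gaps, valuations_scale hp, y.2.2]
  · intro x p hp hpx
    refine ⟨⟨scale p⁻¹ (x.1 0), one_mem_scale_inv hpx hp, ?_⟩, fun j => ?_⟩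
    · rw [valuations_scale (inv_constantCoeff hp), hv]
    · rw [scale_scale_inv hp, Subsingleton.elim (α := Fin 1) j 0]
  · refine Algebra.adjoin_mono ?_
    rintro _ ⟨_, a, k, rfl⟩
    exact ⟨0, a, k, rfl⟩
  · exact fun _ a => regularFamily_red_coordAlg _ () a

/-- If all elements of `D` are greater than `g`, then a flag `M ⊂ M'` with `1 ∈ M` is determined by `M'`, hence the
flagged cell is the product of the normalised cell of `D ∪ {g}` and a space of units. -/
theorem flagCell_singleton_of_normCell {g : ℕ} (hD : IsDFlag u v D ![g]) (hgD : ∀ d ∈ D, g < d) {G : Finset ℕ}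
    (hG : ∀ k, k ∈ G ↔ k ∉ semigroup u v ∪ D) {N : ℕ} (h : IsAffineCell (normAlg u v (D ∪ {g})) N) :
    IsAffineCell (flagAlg u v D ![g]) (N + G.card) := by
  have hg : g ∈ gaps u v \ D := hD.mem_gaps 0
  have hv := valuations_flagCell E hD
  have hv0 : ∀ F : FlagCell u v D ![g], valuations (F.1 0 : Set ℂ⟦X⟧) = semigroup u v ∪ D := fun F => by
    rw [hv F 0, dset_zero]
  have hv1 : ∀ F : FlagCell u v D ![g], valuations (F.1 1 : Set ℂ⟦X⟧) = semigroup u v ∪ (D ∪ {g}) :=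
    fun F => by rw [hv F 1, dset_singleton_one]
  have hpr : ∀ (p : ℂ⟦X⟧), PowerSeries.constantCoeff p = 1 → ∀ y : NormCell u v (D ∪ {g}),
      ∀ i : Fin 2, valuations (scale p ((![(smaller hg hgD y).1, y.1] : Fin 2 → _) i) : Set ℂ⟦X⟧) =
        semigroup u v ∪ dset D ![g] i := by
    intro p hp y i
    rw [valuations_scale hp]
    fin_cases i
    · exact ((smaller hg hgD y).2.2).trans (by rw [show (⟨0, _⟩ : Fin 2) = 0 from rfl, dset_zero])
    · exact y.2.2.trans (by rw [show (⟨1, _⟩ : Fin 2) = 1 from rfl, dset_singleton_one])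
  refine isAffineCell_of_scale (MX := fun (F : FlagCell u v D ![g]) i => F.1 i)
    (MY := fun (y : NormCell u v (D ∪ {g})) => ![(smaller hg hgD y).1, y.1]) (j₀ := 0)
    (Δ := fun i => semigroup u v ∪ dset D ![g] i)
    (c := 2 * delta u v) (tail_le_flagCell E) ?_ hv ?_ (fun y => (smaller hg hgD y).2.1)
    (Or.inl E.zero_mem_semigroup) (fun k => by rw [hG]; simp only [dset_zero]) (fun _ _ h => Subtype.ext h)
    (fun _ _ h => Subtype.ext (congrFun h 1)) ?_ ?_ ?_ ?_ h
  · intro y j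
    fin_cases j
    · exact tail_le_of_one_mem E (smaller hg hgD y).2.1
    · exact tail_le_of_one_mem E y.2.1
  · intro y j
    fin_cases j
    · exact ((smaller hg hgD y).2.2).trans (by rw [show (⟨0, _⟩ : Fin 2) = 0 from rfl, dset_zero])
    · exact y.2.2.trans (by rw [show (⟨1, _⟩ : Fin 2) = 1 from rfl, dset_singleton_one])
  · intro y p hp
    refine ⟨⟨fun i => scale p ((![(smaller hg hgD y).1, y.1] : Fin 2 → _) i), ?_, fun i => ?_⟩, fun _ => rfl⟩
    · refine Fin.monotone_iff_le_succ.mpr fun i => ?_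
      fin_cases i
      exact scale_mono (smaller_le hg hgD y)
    · rw [isStandard_iff_valuations E (dset_subset_gaps hD i), hpr p hp]
  · intro x p hp hpx
    have hle : x.1 0 ≤ x.1 1 := x.2.1 (by decide)
    let y : NormCell u v (D ∪ {g}) := ⟨scale p⁻¹ (x.1 1), one_mem_scale_inv (hle hpx) hp, by
      rw [valuations_scale (inv_constantCoeff hp), hv1]⟩
    let y' : NormCell u v D := ⟨scale p⁻¹ (x.1 0), one_mem_scale_inv hpx hp, by
      rw [valuations_scale (inv_constantCoeff hp), hv0]⟩
    have hyy : smaller hg hgD y = y' := eq_smaller E hg hgD y y' (scale_mono hle)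
    refine ⟨y, fun j => ?_⟩
    fin_cases j
    · change x.1 0 = scale p (smaller hg hgD y).1
      rw [hyy]
      exact (scale_scale_inv hp _).symm
    · exact (scale_scale_inv hp _).symm
  · refine Algebra.adjoin_mono ?_
    rintro _ ⟨_, a, k, rfl⟩
    exact ⟨1, a, k, rfl⟩
  · intro j a
    fin_cases j
    · exact regularFamily_red_smaller E hg hgD a
    · exact regularFamily_red_coordAlg (fun (M : NormCell u v (D ∪ {g})) (_ : Unit) => M.1.restrictScalars ℂ) () a

end Normalisation

/-! ### Combinatorics of the free and of the exceptional steps -/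

/-- The difference `γ(l) - γ(l + 4)` counts the gaps `k ≥ l` for which `k + 4` is not a gap. -/
lemma gapCount_sub_gapCount {Δ : Set ℕ} (hfin : Δᶜ.Finite) (h4 : ∀ k ∈ Δ, k + 4 ∈ Δ) (l : ℕ) :
    gapCount Δ l - gapCount Δ (l + 4) = ({k | l ≤ k ∧ k ∉ Δ ∧ k + 4 ∈ Δ}.ncard : ℤ) := by
  have h1 : Set.Ici l \ Δ = {k | l ≤ k ∧ k ∉ Δ ∧ k + 4 ∈ Δ} ∪ {k | l ≤ k ∧ k + 4 ∉ Δ} := by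
    ext k
    simp only [Set.mem_sdiff, Set.mem_Ici, Set.mem_union, Set.mem_ofPred_eq]
    have := h4 k
    tauto
  have h2 : Set.Ici (l + 4) \ Δ = (· + 4) '' {k | l ≤ k ∧ k + 4 ∉ Δ} := by
    ext k
    simp only [Set.mem_sdiff, Set.mem_Ici, Set.mem_image, Set.mem_ofPred_eq]
    constructor
    · rintro ⟨h, h'⟩
      exact ⟨k - 4, ⟨by omega, by rwa [Nat.sub_add_cancel (by omega)]⟩, by omega⟩
    · rintro ⟨k, ⟨h, h'⟩, rfl⟩
      exact ⟨by omega, h'⟩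
  have hf1 : {k | l ≤ k ∧ k ∉ Δ ∧ k + 4 ∈ Δ}.Finite := hfin.subset fun k hk => hk.2.1
  have hf2 : {k | l ≤ k ∧ k + 4 ∉ Δ}.Finite := hfin.subset fun k hk h => hk.2 (h4 k h)
  rw [gapCount, gapCount, h1, h2, Set.ncard_image_of_injective _ (add_left_injective 4),
    Set.ncard_union_eq _ hf1 hf2]
  · push_cast; ring
  · rw [Set.disjoint_left]
    exact fun k hk hk' => hk'.2 hk.2.2

lemma smallestOdd_spec (E : Exponents u v) (D : Set ℕ) :
    smallestOdd u v D % 2 = 1 ∧ (smallestOdd u v D ∈ semigroup u v ∪ D ∨ smallestOdd u v D = v) ∧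
      2 * u ≤ smallestOdd u v D ∧ smallestOdd u v D ≤ v ∧
      ∀ k ∈ semigroup u v ∪ D, k % 2 = 1 → 2 * u ≤ k → smallestOdd u v D ≤ k := by
  have hv : v ∈ {k | Odd k ∧ k ∈ (semigroup u v ∪ D) ∪ {v} ∧ 2 * u ≤ k} := ⟨E.odd_v, Or.inr rfl, E.lt.le⟩
  obtain ⟨h1, h2, h3⟩ := Nat.sInf_mem ⟨v, hv⟩
  exact ⟨Nat.odd_iff.mp h1, h2, h3, Nat.sInf_le hv, fun k hk hk2 hku =>
    Nat.sInf_le ⟨Nat.odd_iff.mpr hk2, Or.inl hk, hku⟩⟩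

/-- The hypotheses on a step `D ⊂ D ∪ {g}`. -/
structure IsStep (u v : ℕ) (D : Set ℕ) (g : ℕ) : Prop where
  exponents : Exponents u v
  subset_gaps : D ⊆ gaps u v
  mem_gaps : g ∈ gaps u v \ D
  isModule : IsStandardGammaModule u v (semigroup u v ∪ D)
  isModule' : IsStandardGammaModule u v (semigroup u v ∪ (D ∪ {g}))

/-- The step is free: either `g` is odd or there are no gaps of `Γ ∪ D` from `g + n` on. -/
def IsFree (u v : ℕ) (D : Set ℕ) (g : ℕ) : Prop :=
  g % 4 = 2 → ∀ k, g + smallestOdd u v D ≤ k → k ∈ semigroup u v ∪ D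

namespace IsStep

variable {D : Set ℕ} {g : ℕ} (S : IsStep u v D g)

include S

lemma notMem : g ∉ semigroup u v ∪ D := fun h => h.elim S.mem_gaps.1 S.mem_gaps.2

set_option linter.unusedSectionVars false in
lemma mem_of_mem_union {k : ℕ} (hk : k ∈ semigroup u v ∪ (D ∪ {g})) (hkg : k ≠ g) : k ∈ semigroup u v ∪ D := by
  rcases hk with hk | hk | hk
  · exact Or.inl hk
  · exact Or.inr hk
  · exact absurd hk hkg

set_option linter.unusedSectionVars false in
lemma mem_union {k : ℕ} (hk : k ∈ semigroup u v ∪ D) : k ∈ semigroup u v ∪ (D ∪ {g}) := hk.imp_right Or.inl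

lemma add_mem_of_pos {a : ℕ} (ha : a ∈ semigroup u v) (h0 : a ≠ 0) : g + a ∈ semigroup u v ∪ D := by
  rw [add_comm]
  exact S.mem_of_mem_union (S.isModule'.2 a ha g (Or.inr (Or.inr rfl))) (by omega)

lemma mod_four_ne_zero : g % 4 ≠ 0 := fun h => S.mem_gaps.1 (S.exponents.mem_semigroup_of_four h)

lemma lt_two_mul (h : g % 2 = 0) : g < 2 * u := by
  by_contra hg
  exact S.mem_gaps.1 (S.exponents.mem_semigroup_of_even h (by omega))

/-- A free step satisfies the freeness condition of `isAffineCell_of_free_step`. -/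
lemma free_of_isFree (hf : IsFree u v D g) {M : Submodule (R u v) ℂ⟦X⟧}
    (hv : valuations (M : Set ℂ⟦X⟧) = semigroup u v ∪ D) {f : ℂ⟦X⟧} (h1 : PowerSeries.coeff g f = 1)
    (hfg : f ∈ tail g) (hx : PowerSeries.X ^ 4 * f ∈ M) : genY u v * f ∈ M := by
  have E := S.exponents
  have hu := E.u_mod
  have h4 := S.mod_four_ne_zero
  by_cases h2 : g % 4 = 2
  · have hg := S.lt_two_mul (by omega)
    obtain ⟨n1, n2, n3, n4, n5⟩ := smallestOdd_spec E D
    refine genY_mul_mem_of_even_of_isStandard E (S := (2 * u - g) / 4) (n := smallestOdd u v D)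
      (by rw [hv]; exact Or.inl E.zero_mem_semigroup) (by omega) n4
      (by rw [hv]; exact n5) (by rw [hv]; exact hf h2) hg h1 hfg hx
  · refine genY_mul_mem_of_large E (fun k hk => ?_) hfg
    rw [hv]
    by_cases hk2 : k % 2 = 0
    · exact Or.inl (E.mem_semigroup_of_even hk2 (by omega))
    · have hu := E.u_pos
      have := S.add_mem_of_pos (a := k - g) (E.mem_semigroup_of_even (by omega) (by omega)) (by omega)
      rwa [show g + (k - g) = k by omega] at this

lemma compl_finite : (semigroup u v ∪ (D ∪ {g}))ᶜ.Finite :=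
  S.exponents.gaps_finite.subset fun _ hk h => hk (Or.inl h)

lemma add_four_mem {k : ℕ} (hk : k ∈ semigroup u v ∪ (D ∪ {g})) : k + 4 ∈ semigroup u v ∪ (D ∪ {g}) := by
  rw [add_comm]
  exact S.isModule'.2 4 (S.exponents.mem_semigroup_of_four rfl) k hk

lemma gapCount_sub (l : ℕ) : gapCount (semigroup u v ∪ D ∪ {g}) l - gapCount (semigroup u v ∪ D ∪ {g}) (l + 4) =
    ({k | l ≤ k ∧ k ∉ semigroup u v ∪ (D ∪ {g}) ∧ k + 4 ∈ semigroup u v ∪ (D ∪ {g})}.ncard : ℤ) := by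
  rw [Set.union_assoc]
  exact gapCount_sub_gapCount S.compl_finite (fun k hk => S.add_four_mem hk) l

lemma exists_finset : ∃ K : Finset ℕ, ∀ k, k ∈ K ↔
    g < k ∧ k ∉ semigroup u v ∪ D ∧ k + 4 ∈ semigroup u v ∪ D := by
  have hfin : {k | g < k ∧ k ∉ semigroup u v ∪ D ∧ k + 4 ∈ semigroup u v ∪ D}.Finite :=
    S.exponents.gaps_finite.subset fun k hk h => hk.2.1 (Or.inl h)
  exact ⟨hfin.toFinset, fun k => hfin.mem_toFinset⟩

/-- For a free step the correction term in `μ` vanishes. -/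
lemma mu_of_isFree (hf : IsFree u v D g) {K : Finset ℕ}
    (hK : ∀ k, k ∈ K ↔ g < k ∧ k ∉ semigroup u v ∪ D ∧ k + 4 ∈ semigroup u v ∪ D) :
    mu u v D g = K.card := by
  have h1 : {k | g ≤ k ∧ k ∉ semigroup u v ∪ (D ∪ {g}) ∧ k + 4 ∈ semigroup u v ∪ (D ∪ {g})} = (K : Set ℕ) := by
    ext k
    rw [Finset.mem_coe, hK]
    constructor
    · rintro ⟨h1, h2, h3⟩
      have hkg : k ≠ g := by rintro rfl; exact h2 (Or.inr (Or.inr rfl))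
      exact ⟨by omega, fun h => h2 (S.mem_union h), S.mem_of_mem_union h3 (by omega)⟩
    · rintro ⟨h1, h2, h3⟩
      exact ⟨h1.le, fun h => h2 (S.mem_of_mem_union h h1.ne'), S.mem_union h3⟩
  have h2 := S.gapCount_sub g
  rw [h1, Set.ncard_coe_finset] at h2
  simp only [mu]
  split_ifs with h
  · have h3 := S.gapCount_sub (g + smallestOdd u v D)
    have h4 : {k | g + smallestOdd u v D ≤ k ∧ k ∉ semigroup u v ∪ (D ∪ {g}) ∧
        k + 4 ∈ semigroup u v ∪ (D ∪ {g})} = ∅ := by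
      ext k
      simp only [Set.mem_ofPred_eq, Set.mem_empty_iff_false, iff_false, not_and]
      exact fun hk hk' => absurd (S.mem_union (hf h k hk)) hk'
    rw [h4, Set.ncard_empty] at h3
    rw [show g + 4 + smallestOdd u v D = g + smallestOdd u v D + 4 by omega, h2, h3]
    simp
  · exact h2

end IsStep

lemma exists_min_class {Δ : Set ℕ} (h4 : ∀ k ∈ Δ, k + 4 ∈ Δ) {c : ℕ} (hex : ∃ k ∈ Δ, k % 4 = c) :
    ∃ a, a % 4 = c ∧ ∀ k, k % 4 = c → (k ∈ Δ ↔ a ≤ k) := by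
  classical
  obtain ⟨h1, h2⟩ := Nat.find_spec hex
  refine ⟨Nat.find hex, h2, fun k hk => ⟨fun h => Nat.find_min' hex ⟨h, hk⟩, fun h => ?_⟩⟩
  have : ∀ i, Nat.find hex + 4 * i ∈ Δ := by
    intro i
    induction i with
    | zero => exact h1
    | succ i ih => exact h4 _ ih
  have h3 := this ((k - Nat.find hex) / 4)
  rwa [show Nat.find hex + 4 * ((k - Nat.find hex) / 4) = k by omega] at h3

/-- The combinatorial situation of an exceptional (non-free) step: `α` and `β` are the least odd elements
of `Γ ∪ D` in their classes modulo `4`, and `n` is the number `n(D)`. -/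
structure Exceptional (u v : ℕ) (D : Set ℕ) (g α β n : ℕ) : Prop where
  odd_α : α % 2 = 1
  β_mod : β % 4 = (α + 2) % 4
  mem_α : ∀ k, k % 4 = α % 4 → (k ∈ semigroup u v ∪ D ↔ α ≤ k)
  mem_β : ∀ k, k % 4 = β % 4 → (k ∈ semigroup u v ∪ D ↔ β ≤ k)
  le_α : g + 4 ≤ α
  α_lt_β : α < β
  β_le : β ≤ α + 2 * u
  le_β : g + n + 4 ≤ β
  le_n : 2 * u ≤ n
  α_le_n : α ≤ v → α ≤ n
  n_eq : v < α → n = v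
  α_mod : v < α → α % 4 = (v + 2) % 4
  α_le : v < α → α ≤ v + g

/-- If the step is not free, an odd gap `≥ g + n` exists, and its class modulo `4` is that of `β`. For `v < α` the last
two properties come from the existence of a module: it has the valuation `v + g`. -/
lemma IsStep.exists_exceptional {D : Set ℕ} {g : ℕ} (S : IsStep u v D g) (hf : ¬ IsFree u v D g)
    (hne : Nonempty (NormCell u v (D ∪ {g}))) :
    ∃ α β, Exceptional u v D g α β (smallestOdd u v D) := by
  have E := S.exponents
  have hu := E.u_mod
  have huv := E.lt
  simp only [IsFree, not_forall, exists_prop] at hf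
  obtain ⟨h2, k, hk, hkΔ⟩ := hf
  have hg := S.lt_two_mul (by omega)
  obtain ⟨n1, n2, n3, n4, n5⟩ := smallestOdd_spec E D
  set n := smallestOdd u v D
  have hk2 : k % 2 = 1 := by
    by_contra h
    exact hkΔ (Or.inl (E.mem_semigroup_of_even (by omega) (by omega)))
  have h4 : ∀ k ∈ semigroup u v ∪ D, k + 4 ∈ semigroup u v ∪ D := fun k hk => by
    rw [add_comm]; exact S.isModule.2 4 (E.mem_semigroup_of_four rfl) k hk
  obtain ⟨β, hβ, hβk⟩ := exists_min_class h4 (c := k % 4)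
    ⟨k + 4 * (4 * u + v), Or.inl (E.mem_semigroup_of_large (by omega)), by omega⟩
  obtain ⟨α, hα, hαk⟩ := exists_min_class h4 (c := (k + 2) % 4)
    ⟨(k + 2) + 4 * (4 * u + v), Or.inl (E.mem_semigroup_of_large (by omega)), by omega⟩
  have hβ1 : k < β := by
    by_contra h
    exact hkΔ ((hβk k rfl).mpr (by omega))
  have hβα : β ≤ α + 2 * u := by
    refine (hβk _ (by omega)).mp ?_
    rw [add_comm]
    exact S.isModule.2 _ (two_mul_mem_semigroup E.u_pos huv) _ ((hαk α hα).mpr le_rfl)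
  have hnα : n ∈ semigroup u v ∪ D → α ≤ n := by
    intro h
    by_cases hc : n % 4 = k % 4
    · have := (hβk n hc).mp h
      omega
    · exact (hαk n (by omega)).mp h
  have hv1 : v < α → n = v := fun h => n2.resolve_left fun h' => by have := hnα h'; omega
  have hv2 : v < α → v < β := fun h => by have := hv1 h; omega
  have hvg : v < α → v + g ∈ semigroup u v ∪ D := by
    intro h
    obtain ⟨M, hM1, hMv⟩ := hne
    have := add_mem_valuations_of_odd E hM1 (g := g) (S := (2 * u - g) / 4) (by omega)
      (by rw [hMv]; exact Or.inr (Or.inr rfl)) (fun i hi hi2 => ?_)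
    · rw [hMv] at this
      exact S.mem_of_mem_union this (by omega)
    · rw [hMv] at hi
      have hi' := S.mem_of_mem_union hi (by omega)
      by_cases hc : i % 4 = k % 4
      · have := (hβk i hc).mp hi'
        have := hv2 h
        omega
      · have := (hαk i (by omega)).mp hi'
        omega
  have hvα : v < α → α ≤ v + g ∧ α % 4 = (v + 2) % 4 := by
    intro h
    have h1 := hvg h
    by_cases hc : (v + g) % 4 = k % 4
    · have := (hβk _ hc).mp h1
      have := hv1 h
      omega
    · have hv := E.v_mod
      have := (hαk _ (by omega)).mp h1
      omega
  have hαn : α ≤ v → α ≤ n := by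
    intro h
    rcases n2 with h' | h'
    · exact hnα h'
    · omega
  refine ⟨α, β, ⟨by omega, by omega, ?_, ?_, by omega, ?_, hβα, by omega, n3, hαn, hv1,
    fun h => (hvα h).2, fun h => (hvα h).1⟩⟩
  · rw [hα]; exact hαk
  · rw [hβ]; exact hβk
  · by_cases h : v < α
    · have := hv1 h
      have := (hvα h).1
      omega
    · have := hαn (by omega)
      omega

lemma IsStep.mod_four_of_not_isFree {D : Set ℕ} {g : ℕ} (hf : ¬ IsFree u v D g) : g % 4 = 2 := by
  simp only [IsFree, not_forall, exists_prop] at hf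
  exact hf.1

/-- In an exceptional step `g` is smaller than all elements of `D`. -/
lemma Exceptional.lt_of_mem {D : Set ℕ} {g α β n : ℕ} (S : IsStep u v D g) (h2 : g % 4 = 2)
    (X : Exceptional u v D g α β n) {d : ℕ} (hd : d ∈ semigroup u v ∪ D) (hd4 : d % 4 ≠ 0) : g < d := by
  have h1 := X.le_α
  have h3 := X.α_lt_β
  have h4 := X.odd_α
  have h5 := X.β_mod
  by_cases hα : d % 4 = α % 4
  · have := (X.mem_α d hα).mp hd
    omega
  by_cases hβ : d % 4 = β % 4
  · have := (X.mem_β d hβ).mp hd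
    omega
  by_contra hdg
  refine S.notMem ?_
  have := S.isModule.2 (g - d) (S.exponents.mem_semigroup_of_four (by omega)) d hd
  rwa [show g - d + d = g by omega] at this

/-- The numbers counted by `γ(g) - γ(g + 4)` are `α - 4` and `β - 4`, and only the second one is at least `g + n`. -/
lemma Exceptional.mu_eq {D : Set ℕ} {g α β : ℕ} (S : IsStep u v D g) (h2 : g % 4 = 2)
    (X : Exceptional u v D g α β (smallestOdd u v D)) : mu u v D g = 1 := by
  have x1 := X.le_α
  have x2 := X.le_β
  have x3 := X.odd_α
  have x4 := X.β_mod
  have x5 := X.α_lt_β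
  have x6 := X.le_n
  have x7 := X.α_le_n
  have x8 := X.n_eq
  have x9 := X.α_le
  have hmem : ∀ k, g ≤ k → (k ∉ semigroup u v ∪ (D ∪ {g}) ∧ k + 4 ∈ semigroup u v ∪ (D ∪ {g}) ↔
      k = α - 4 ∨ k = β - 4) := by
    intro k hk
    by_cases hk2 : k % 2 = 0
    · constructor
      · rintro ⟨h, -⟩
        exfalso
        by_cases hk4 : k % 4 = 0
        · exact h (Or.inl (S.exponents.mem_semigroup_of_four hk4))
        · by_cases hkg : k = g
          · exact h (Or.inr (Or.inr hkg))
          · have := S.add_mem_of_pos (a := k - g) (S.exponents.mem_semigroup_of_four (by omega)) (by omega)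
            rw [show g + (k - g) = k by omega] at this
            exact h (S.mem_union this)
      · omega
    · have e : ∀ j, j % 2 = 1 → (j ∈ semigroup u v ∪ (D ∪ {g}) ↔ j ∈ semigroup u v ∪ D) := fun j hj =>
        ⟨fun h => S.mem_of_mem_union h (by omega), S.mem_union⟩
      rw [e k (by omega), e (k + 4) (by omega)]
      by_cases hα : k % 4 = α % 4
      · rw [X.mem_α k hα, X.mem_α (k + 4) (by omega)]
        omega
      · rw [X.mem_β k (by omega), X.mem_β (k + 4) (by omega)]
        omega
  have e1 : {k | g ≤ k ∧ k ∉ semigroup u v ∪ (D ∪ {g}) ∧ k + 4 ∈ semigroup u v ∪ (D ∪ {g})} =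
      {α - 4, β - 4} := by
    ext k
    simp only [Set.mem_ofPred_eq, Set.mem_insert_iff, Set.mem_singleton_iff]
    constructor
    · rintro ⟨h, h'⟩
      exact (hmem k h).mp h'
    · intro h
      have : g ≤ k := by omega
      exact ⟨this, (hmem k this).mpr h⟩
  have e2 : {k | g + smallestOdd u v D ≤ k ∧ k ∉ semigroup u v ∪ (D ∪ {g}) ∧
      k + 4 ∈ semigroup u v ∪ (D ∪ {g})} = {β - 4} := by
    ext k
    simp only [Set.mem_ofPred_eq, Set.mem_singleton_iff]
    constructor
    · rintro ⟨h, h'⟩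
      have := (hmem k (by omega)).mp h'
      omega
    · intro h
      exact ⟨by omega, (hmem k (by omega)).mpr (Or.inr h)⟩
  have h3 := S.gapCount_sub g
  have h4 := S.gapCount_sub (g + smallestOdd u v D)
  rw [e1, Set.ncard_pair (by omega)] at h3
  rw [e2, Set.ncard_singleton] at h4
  rw [mu, if_pos h2, show g + 4 + smallestOdd u v D = g + smallestOdd u v D + 4 by omega, h3, h4]
  rfl

/-! ### Supports of power series -/

lemma coeff_mul_eq_zero {f g : ℂ⟦X⟧} {k : ℕ}
    (h : ∀ i j, i + j = k → PowerSeries.coeff i f = 0 ∨ PowerSeries.coeff j g = 0) :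
    PowerSeries.coeff k (f * g) = 0 := by
  rw [PowerSeries.coeff_mul]
  refine Finset.sum_eq_zero fun p hp => ?_
  rcases h p.1 p.2 (Finset.HasAntidiagonal.mem_antidiagonal.mp hp) with h | h
  · rw [h, zero_mul]
  · rw [h, mul_zero]

/-- The power series `f` only involves exponents congruent to `r` modulo `4`. -/
def IsClass (r : ℕ) (f : ℂ⟦X⟧) : Prop := ∀ k, k % 4 ≠ r → PowerSeries.coeff k f = 0

/-- The power series `f` only involves odd exponents. -/
def IsOddSeries (f : ℂ⟦X⟧) : Prop := ∀ k, k % 2 = 0 → PowerSeries.coeff k f = 0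

lemma IsClass.mul {r t q : ℕ} {f g : ℂ⟦X⟧} (hf : IsClass r f) (hg : IsClass t g) (hq : (r + t) % 4 = q) :
    IsClass q (f * g) := by
  intro k hk
  refine coeff_mul_eq_zero fun i j hij => ?_
  by_cases hi : i % 4 = r
  · exact Or.inr (hg j (by omega))
  · exact Or.inl (hf i hi)

lemma IsClass.add {r : ℕ} {f g : ℂ⟦X⟧} (hf : IsClass r f) (hg : IsClass r g) : IsClass r (f + g) :=
  fun k hk => by rw [map_add, hf k hk, hg k hk, add_zero]

lemma IsClass.smul {r : ℕ} {f : ℂ⟦X⟧} (c : ℂ) (hf : IsClass r f) : IsClass r (c • f) :=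
  fun k hk => by rw [map_smul, hf k hk, smul_zero]

lemma IsClass.zero (r : ℕ) : IsClass r 0 := fun _ _ => map_zero _

lemma IsClass.X_pow {r k : ℕ} (h : k % 4 = r) : IsClass r (PowerSeries.X ^ k) := fun i hi => by
  rw [PowerSeries.coeff_X_pow, if_neg]
  rintro rfl
  exact hi h

lemma IsOddSeries.add {f g : ℂ⟦X⟧} (hf : IsOddSeries f) (hg : IsOddSeries g) : IsOddSeries (f + g) :=
  fun k hk => by rw [map_add, hf k hk, hg k hk, add_zero]

lemma IsOddSeries.sub {f g : ℂ⟦X⟧} (hf : IsOddSeries f) (hg : IsOddSeries g) : IsOddSeries (f - g) :=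
  fun k hk => by rw [map_sub, hf k hk, hg k hk, sub_zero]

lemma IsOddSeries.smul {f : ℂ⟦X⟧} (c : ℂ) (hf : IsOddSeries f) : IsOddSeries (c • f) :=
  fun k hk => by rw [map_smul, hf k hk, smul_zero]

lemma IsOddSeries.zero : IsOddSeries 0 := fun _ _ => map_zero _

lemma IsOddSeries.X_pow {k : ℕ} (h : k % 2 = 1) : IsOddSeries (PowerSeries.X ^ k) := fun i hi => by
  rw [PowerSeries.coeff_X_pow, if_neg]
  rintro rfl
  omega

lemma IsOddSeries.class_mul {r : ℕ} {f g : ℂ⟦X⟧} (hr : r % 2 = 0) (hf : IsClass r f) (hg : IsOddSeries g) :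
    IsOddSeries (f * g) := by
  intro k hk
  refine coeff_mul_eq_zero fun i j hij => ?_
  by_cases hi : i % 4 = r
  · exact Or.inr (hg j (by omega))
  · exact Or.inl (hf i hi)

/-- The part of `f` with exponents satisfying `p`. -/
def part (p : ℕ → Prop) [DecidablePred p] (f : ℂ⟦X⟧) : ℂ⟦X⟧ :=
  PowerSeries.mk fun k => if p k then PowerSeries.coeff k f else 0

lemma coeff_part (p : ℕ → Prop) [DecidablePred p] (f : ℂ⟦X⟧) (k : ℕ) :
    PowerSeries.coeff k (part p f) = if p k then PowerSeries.coeff k f else 0 := PowerSeries.coeff_mk _ _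

/-- `z^{-a}` times the part of `f` with exponents `≥ a` congruent to `a` modulo `4`. -/
def quot (a : ℕ) (f : ℂ⟦X⟧) : ℂ⟦X⟧ :=
  PowerSeries.mk fun k => if k % 4 = 0 then PowerSeries.coeff (k + a) f else 0

lemma coeff_quot (a : ℕ) (f : ℂ⟦X⟧) (k : ℕ) :
    PowerSeries.coeff k (quot a f) = if k % 4 = 0 then PowerSeries.coeff (k + a) f else 0 :=
  PowerSeries.coeff_mk _ _

lemma quot_isClass (a : ℕ) (f : ℂ⟦X⟧) : IsClass 0 (quot a f) := fun k hk => by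
  rw [coeff_quot, if_neg hk]

lemma coeff_X_pow_mul_quot (a : ℕ) (f : ℂ⟦X⟧) (k : ℕ) :
    PowerSeries.coeff k (PowerSeries.X ^ a * quot a f) =
      if a ≤ k ∧ (k - a) % 4 = 0 then PowerSeries.coeff k f else 0 := by
  rw [PowerSeries.coeff_X_pow_mul', coeff_quot]
  by_cases h1 : a ≤ k
  · by_cases h2 : (k - a) % 4 = 0
    · rw [if_pos h1, if_pos h2, if_pos ⟨h1, h2⟩, Nat.sub_add_cancel h1]
    · rw [if_pos h1, if_neg h2, if_neg fun h => h2 h.2]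
  · rw [if_neg h1, if_neg fun h => h1 h.1]

lemma quot_mem_tail {a c : ℕ} {f : ℂ⟦X⟧} (hf : f ∈ tail (c + a)) : quot a f ∈ tail c := by
  intro k hk
  rw [coeff_quot, hf _ (by omega), ite_self]

/-! ### The modules in the exceptional case -/

/-- The odd non-members of a set whose least odd elements in their classes modulo `4` are `α` and `β`. -/
def OddGap (α β k : ℕ) : Prop := (k % 4 = α % 4 ∧ k < α) ∨ (k % 4 = β % 4 ∧ k < β)

instance (α β : ℕ) : DecidablePred (OddGap α β) := fun k => by unfold OddGap; infer_instance

/-- The space spanned over `ℂ[[z^4]]` by `1`, `z^a + o`, `z^α (1 + Λ)` and `z^β`, described by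
equations. -/
def specialSpace (a α β : ℕ) (L o : ℂ⟦X⟧) : Submodule ℂ ℂ⟦X⟧ where
  carrier := {f | ∃ p e w, IsClass 0 p ∧ IsClass 0 e ∧ IsOddSeries w ∧
    (∀ k, OddGap α β k → PowerSeries.coeff k ((1 - L) * w) = 0) ∧ f = p + e * (PowerSeries.X ^ a + o) + w}
  add_mem' := by
    rintro _ _ ⟨p, e, w, hp, he, hw, h, rfl⟩ ⟨p', e', w', hp', he', hw', h', rfl⟩
    refine ⟨p + p', e + e', w + w', hp.add hp', he.add he', hw.add hw', fun k hk => ?_, by ring⟩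
    rw [mul_add, map_add, h k hk, h' k hk, add_zero]
  zero_mem' := ⟨0, 0, 0, IsClass.zero 0, IsClass.zero 0, IsOddSeries.zero, by simp, by simp⟩
  smul_mem' := by
    rintro c _ ⟨p, e, w, hp, he, hw, h, rfl⟩
    refine ⟨c • p, c • e, c • w, hp.smul c, he.smul c, hw.smul c, fun k hk => ?_, ?_⟩
    · rw [mul_smul_comm, map_smul, h k hk, smul_zero]
    · rw [smul_add, smul_add, smul_mul_assoc]

/-- The numerical conditions of the exceptional case. The numbers `a = 2u - 4s` and `α < β` are the least valuations
in the class of `2` and in the two odd classes modulo `4`. -/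
structure Special (u v s a α β : ℕ) : Prop where
  exponents : Exponents u v
  a_add : a + 4 * s = 2 * u
  odd_α : α % 2 = 1
  β_mod : β % 4 = (α + 2) % 4
  a_lt : a < α
  α_lt : α < β
  β_le : β ≤ α + 2 * u
  le_β : a + 2 * u ≤ β
  cases : (α ≤ v ∧ α + a ≤ β) ∨ (v < α ∧ α % 4 = (v + 2) % 4 ∧ α ≤ v + a ∧ v + a ≤ β)

/-- The parameters `Λ` and `o` have the supports of the nontrivial parts of the reduced elements of
orders `α` and `a`. -/
structure IsParam (a α β : ℕ) (L o : ℂ⟦X⟧) : Prop where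
  coeff_L : ∀ k, ¬ (k % 4 = 2 ∧ α + k < β) → PowerSeries.coeff k L = 0
  coeff_o : ∀ k, ¬ (OddGap α β k ∧ a < k) → PowerSeries.coeff k o = 0

lemma OddGap.sub_of_dvd {α β k i : ℕ} (hk : OddGap α β k) (hi : i % 4 = 0) : OddGap α β (k - i) ∨ k < i := by
  unfold OddGap at *
  omega

lemma IsParam.isClass_L {a α β : ℕ} {L o : ℂ⟦X⟧} (P : IsParam a α β L o) : IsClass 2 L := fun k hk => P.coeff_L k fun h => hk h.1

lemma IsParam.L_mem_tail {a α β : ℕ} {L o : ℂ⟦X⟧} (P : IsParam a α β L o) : L ∈ tail 2 := fun k hk => P.coeff_L k (by omega)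

lemma IsParam.o_mem_tail {a α β : ℕ} {L o : ℂ⟦X⟧} (P : IsParam a α β L o) : o ∈ tail (a + 1) := fun k hk => P.coeff_o k (by omega)

lemma class_mem_specialSpace {a α β : ℕ} {p L o : ℂ⟦X⟧} (hp : IsClass 0 p) : p ∈ specialSpace a α β L o :=
  ⟨p, 0, 0, hp, IsClass.zero 0, IsOddSeries.zero, by simp, by simp⟩

lemma second_mem_specialSpace {a α β : ℕ} {L o : ℂ⟦X⟧} : PowerSeries.X ^ a + o ∈ specialSpace a α β L o :=
  ⟨0, 1, 0, IsClass.zero 0, by simpa using IsClass.X_pow (k := 0) rfl, IsOddSeries.zero, by simp, by simp⟩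

lemma IsParam.constantCoeff_one_sub {a α β : ℕ} {L o : ℂ⟦X⟧} (P : IsParam a α β L o) : PowerSeries.constantCoeff (1 - L) = 1 := by
  rw [map_sub, ← PowerSeries.coeff_zero_eq_constantCoeff_apply L, P.L_mem_tail 0 (by omega)]
  simp

lemma class_mul_mem_specialSpace {a α β : ℕ} {L o : ℂ⟦X⟧} {g f : ℂ⟦X⟧} (hg : IsClass 0 g) (hf : f ∈ specialSpace a α β L o) :
    g * f ∈ specialSpace a α β L o := by
  obtain ⟨p, e, w, hp, he, hw, h, rfl⟩ := hf
  refine ⟨g * p, g * e, g * w, hg.mul hp rfl, hg.mul he rfl, IsOddSeries.class_mul rfl hg hw, fun k hk => ?_, by ring⟩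
  rw [← mul_assoc, mul_comm _ g, mul_assoc]
  refine coeff_mul_eq_zero fun i j hij => ?_
  by_cases hi : i % 4 = 0
  · refine Or.inr ?_
    rcases hk.sub_of_dvd hi with h' | h'
    · rw [show j = k - i by omega]; exact h _ h'
    · omega
  · exact Or.inl (hg i hi)

lemma IsParam.coeff_X_pow_mul_second {a α β : ℕ} {L o : ℂ⟦X⟧} (P : IsParam a α β L o) {k : ℕ} (hk : a ≤ k) :
    PowerSeries.coeff k (PowerSeries.X ^ (k - a) * (PowerSeries.X ^ a + o)) = 1 ∧
      PowerSeries.X ^ (k - a) * (PowerSeries.X ^ a + o) ∈ tail k := by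
  constructor
  · rw [PowerSeries.coeff_X_pow_mul', if_pos (by omega), show k - (k - a) = a by omega, map_add,
      PowerSeries.coeff_X_pow_self, P.o_mem_tail a (by omega), add_zero]
  · have h1 : PowerSeries.X ^ a + o ∈ tail a :=
      (tail a).add_mem (X_pow_mem_tail a) (tail_anti (by omega) (P.o_mem_tail))
    exact tail_anti (by omega) (mul_mem_tail (X_pow_mem_tail (k - a)) h1)

lemma IsParam.coeff_X_pow_mul_third {a α β : ℕ} {L o : ℂ⟦X⟧} (P : IsParam a α β L o) (k : ℕ) :
    PowerSeries.coeff k (PowerSeries.X ^ k * (1 + L)) = 1 ∧ PowerSeries.X ^ k * (1 + L) ∈ tail k := by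
  constructor
  · rw [PowerSeries.coeff_X_pow_mul', if_pos le_rfl, Nat.sub_self, map_add, P.L_mem_tail 0 (by omega)]
    simp
  · exact mul_mem_tail_left (X_pow_mem_tail k) _

lemma IsParam.mem_tail_of_one_sub_mul {a α β : ℕ} {L o : ℂ⟦X⟧} (P : IsParam a α β L o) {w : ℂ⟦X⟧} {c : ℕ} (h : (1 - L) * w ∈ tail c) : w ∈ tail c := by
  have h1 := mul_mem_tail_right h (1 - L)⁻¹
  rwa [← mul_assoc, mul_comm _⁻¹, mul_inv_of_constantCoeff (P.constantCoeff_one_sub), one_mul] at h1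

namespace Special

variable {s a α β : ℕ} (S : Special u v s a α β) {L o : ℂ⟦X⟧} (P : IsParam a α β L o)

include S

lemma a_mod : a % 4 = 2 := by
  have := S.a_add
  have := S.exponents.u_mod
  omega

lemma oddGap_mod {k : ℕ} (hk : OddGap α β k) : k % 2 = 1 := by
  have := S.odd_α
  have := S.β_mod
  unfold OddGap at hk
  omega

lemma oddGap_of_lt {k : ℕ} (hk : k % 2 = 1) (h : k < α) : OddGap α β k := by
  have := S.odd_α
  have := S.β_mod
  have := S.α_lt
  unfold OddGap
  omega

lemma oddGap_lt {k : ℕ} (hk : OddGap α β k) : k < β := by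
  have := S.α_lt
  unfold OddGap at hk
  omega

include P

lemma o_isOdd : IsOddSeries o := fun k hk => P.coeff_o k fun h => by
  have := S.oddGap_mod h.1
  omega

omit P in
lemma one_sub_mul_mem_tail {w : ℂ⟦X⟧} (hL : IsClass 2 L) (hw : IsOddSeries w)
    (h : ∀ k, OddGap α β k → PowerSeries.coeff k ((1 - L) * w) = 0) :
    (1 - L) * w ∈ tail α := by
  intro k hk
  by_cases hk2 : k % 2 = 1
  · exact h k (S.oddGap_of_lt hk2 hk)
  · rw [sub_mul, one_mul, map_sub, hw k (by omega), IsOddSeries.class_mul rfl hL hw k (by omega), sub_zero]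

lemma mem_tail_of_cond {w : ℂ⟦X⟧} (hw : IsOddSeries w)
    (h : ∀ k, OddGap α β k → PowerSeries.coeff k ((1 - L) * w) = 0) : w ∈ tail α :=
  P.mem_tail_of_one_sub_mul (S.one_sub_mul_mem_tail (P.isClass_L) hw h)

lemma tail_le_specialSpace : tail β ≤ specialSpace a α β L o := by
  intro f hf
  have ha := S.a_mod
  have hα := S.a_lt
  have hβ := S.α_lt
  refine ⟨part (· % 4 = 0) f, quot a f, part (· % 2 = 1) f - quot a f * o, ?_, quot_isClass a f, ?_, ?_, ?_⟩
  · intro k hk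
    rw [coeff_part, if_neg hk]
  · refine IsOddSeries.sub (fun k hk => ?_) (IsOddSeries.class_mul rfl (quot_isClass a f) (S.o_isOdd P))
    rw [coeff_part, if_neg (by omega)]
  · intro k hk
    have h1 : part (· % 2 = 1) f ∈ tail β := fun i hi => by rw [coeff_part, hf i hi, ite_self]
    have h2 : quot a f ∈ tail (β - a) := quot_mem_tail (tail_anti (by omega) hf)
    have h3 := mul_mem_tail h2 (P.o_mem_tail)
    exact mul_mem_tail_right ((tail β).sub_mem h1 (tail_anti (by omega) h3)) (1 - L) k (S.oddGap_lt hk)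
  · have h1 : f = part (· % 4 = 0) f + PowerSeries.X ^ a * quot a f + part (· % 2 = 1) f := by
      ext k
      rw [map_add, map_add, coeff_part, coeff_part, coeff_X_pow_mul_quot]
      by_cases hkβ : k < β
      · simp [hf k hkβ]
      rcases (by omega : k % 4 = 0 ∨ k % 4 = 2 ∨ k % 2 = 1) with h | h | h
      · rw [if_pos h, if_neg (by omega), if_neg (by omega), add_zero, add_zero]
      · rw [if_neg (by omega), if_pos (by omega), if_neg (by omega), add_zero, zero_add]
      · rw [if_neg (by omega), if_neg (by omega), if_pos h, zero_add, zero_add]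
    nth_rewrite 1 [h1]
    ring

/-- The decomposition of an element of the special space is unique. -/
lemma cond_of_mem {p e w : ℂ⟦X⟧} (hp : IsClass 0 p) (he : IsClass 0 e) (hw : IsOddSeries w)
    (h : p + e * (PowerSeries.X ^ a + o) + w ∈ specialSpace a α β L o) :
    ∀ k, OddGap α β k → PowerSeries.coeff k ((1 - L) * w) = 0 := by
  obtain ⟨p', e', w', hp', he', hw', h', heq⟩ := h
  have ha := S.a_mod
  have hdecomp : ∀ {p e w : ℂ⟦X⟧}, IsClass 0 p → IsClass 0 e → IsOddSeries w → ∀ k, k % 4 = 2 →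
      PowerSeries.coeff k (p + e * (PowerSeries.X ^ a + o) + w) = PowerSeries.coeff k (PowerSeries.X ^ a * e) := by
    intro p e w hp he hw k hk
    rw [map_add, map_add, mul_add, map_add, hp k (by omega), hw k (by omega),
      IsOddSeries.class_mul rfl he (S.o_isOdd P) k (by omega), zero_add, add_zero, add_zero, mul_comm]
  have h1 : PowerSeries.X ^ a * e = PowerSeries.X ^ a * e' := by
    ext k
    by_cases hk : k % 4 = 2
    · rw [← hdecomp hp he hw k hk, heq, hdecomp hp' he' hw' k hk]
    · rw [(IsClass.X_pow ha).mul he (q := 2) rfl k hk, (IsClass.X_pow ha).mul he' (q := 2) rfl k hk]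
  have h2 : e = e' := mul_left_cancel₀ (pow_ne_zero _ PowerSeries.X_ne_zero) h1
  have h3 : p + w = p' + w' := by
    rw [← h2] at heq
    linear_combination heq
  have h4 : w = w' := by
    ext k
    by_cases hk : k % 2 = 0
    · rw [hw k hk, hw' k hk]
    · have h5 := congrArg (PowerSeries.coeff k) h3
      rwa [map_add, map_add, hp k (by omega), hp' k (by omega), zero_add, zero_add] at h5
  rw [h4]
  exact h'

/-- Multiplication by `1 - Λ` turns `z^k (1 + Λ)` into `z^k (1 - Λ²)`, which has no terms in the class of `β`. -/
lemma third_mem {k : ℕ} (hk : k % 4 = α % 4) (hαk : α ≤ k) :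
    PowerSeries.X ^ k * (1 + L) ∈ specialSpace a α β L o := by
  have hodd := S.odd_α
  have hβ := S.β_mod
  have hL := P.isClass_L
  have hX : IsOddSeries (PowerSeries.X ^ k : ℂ⟦X⟧) := IsOddSeries.X_pow (by omega)
  refine ⟨0, 0, PowerSeries.X ^ k * (1 + L), IsClass.zero 0, IsClass.zero 0, ?_, fun i hi => ?_, by ring⟩
  · rw [mul_add, mul_one, mul_comm]
    exact hX.add (IsOddSeries.class_mul rfl hL hX)
  · have h1 : (1 - L) * (PowerSeries.X ^ k * (1 + L)) = PowerSeries.X ^ k - PowerSeries.X ^ k * (L * L) := by ring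
    have h2 : IsClass (α % 4) (PowerSeries.X ^ k * (L * L)) :=
      (IsClass.X_pow hk).mul (hL.mul hL (q := 0) rfl) (by omega)
    rw [h1]
    rcases hi with ⟨-, hi⟩ | ⟨hi, -⟩
    · exact (tail k).sub_mem (X_pow_mem_tail k) (mul_mem_tail_left (X_pow_mem_tail k) _) i (by omega)
    · rw [map_sub, IsClass.X_pow hk i (by omega), h2 i (by omega), sub_zero]

/-- Monic elements of all orders in the special space. -/
def elem (a α : ℕ) (L o : ℂ⟦X⟧) (k : ℕ) : ℂ⟦X⟧ :=
  if k % 4 = 2 then PowerSeries.X ^ (k - a) * (PowerSeries.X ^ a + o)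
  else if k % 4 = α % 4 then PowerSeries.X ^ k * (1 + L) else PowerSeries.X ^ k

lemma elem_spec {k : ℕ} (hk : k % 4 = 0 ∨ (k % 4 = 2 ∧ a ≤ k) ∨ (k % 4 = α % 4 ∧ α ≤ k) ∨ (k % 4 = β % 4 ∧ β ≤ k)) :
    elem a α L o k ∈ specialSpace a α β L o ∧ PowerSeries.coeff k (elem a α L o k) = 1 ∧
      elem a α L o k ∈ tail k := by
  have ha := S.a_mod
  have hodd := S.odd_α
  have hβ := S.β_mod
  unfold elem
  by_cases h2 : k % 4 = 2
  · rw [if_pos h2]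
    exact ⟨class_mul_mem_specialSpace (IsClass.X_pow (by omega)) second_mem_specialSpace, P.coeff_X_pow_mul_second (by omega)⟩
  rw [if_neg h2]
  by_cases hα : k % 4 = α % 4
  · rw [if_pos hα]
    exact ⟨S.third_mem P hα (by omega), P.coeff_X_pow_mul_third k⟩
  rw [if_neg hα]
  refine ⟨?_, PowerSeries.coeff_X_pow_self k, X_pow_mem_tail k⟩
  by_cases h0 : k % 4 = 0
  · exact class_mem_specialSpace (IsClass.X_pow h0)
  · exact S.tail_le_specialSpace P (tail_anti (by omega) (X_pow_mem_tail k))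

/-- The valuations of the special space, for all values of the parameters. -/
lemma valuations_specialSpace (k : ℕ) : k ∈ valuations (specialSpace a α β L o : Set ℂ⟦X⟧) ↔
    k % 4 = 0 ∨ (k % 4 = 2 ∧ a ≤ k) ∨ (k % 4 = α % 4 ∧ α ≤ k) ∨ (k % 4 = β % 4 ∧ β ≤ k) := by
  have ha := S.a_mod
  have hodd := S.odd_α
  have hβ := S.β_mod
  constructor
  · intro hk
    obtain ⟨f, ⟨p, e, w, hp, he, hw, h, rfl⟩, h0, hfk⟩ := mem_valuations_iff.mp hk
    by_contra hcon
    have heo := IsOddSeries.class_mul rfl he (S.o_isOdd P)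
    have hf2 : ∀ i, i % 4 = 2 → PowerSeries.coeff i (p + e * (PowerSeries.X ^ a + o) + w) =
        PowerSeries.coeff i (PowerSeries.X ^ a * e) := by
      intro i hi
      rw [map_add, map_add, mul_add, map_add, hp i (by omega), hw i (by omega), heo i (by omega),
        zero_add, add_zero, add_zero, mul_comm]
    by_cases hk2 : k % 2 = 0
    · rw [hf2 k (by omega), PowerSeries.coeff_X_pow_mul', if_neg (by omega)] at h0
      exact h0 rfl
    have hog : OddGap α β k := by unfold OddGap; omega
    have he' : PowerSeries.X ^ a * e ∈ tail k := by
      intro i hi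
      by_cases hi2 : i % 4 = 2
      · rw [← hf2 i hi2, hfk i hi]
      · exact (IsClass.X_pow ha).mul he (q := 2) rfl i hi2
    have heo' : e * o ∈ tail (k + 1) := by
      by_cases hak : a ≤ k
      · obtain ⟨j, rfl⟩ := Nat.exists_eq_add_of_le hak
        have := mul_mem_tail (X_pow_mul_mem_tail_iff.mp he') (P.o_mem_tail)
        exact tail_anti (by omega) this
      · exact tail_anti (by omega) (mul_mem_tail_right (P.o_mem_tail) e)
    have hfw : ∀ i, i % 2 = 1 → i ≤ k → PowerSeries.coeff i (p + e * (PowerSeries.X ^ a + o) + w) =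
        PowerSeries.coeff i w := by
      intro i hi hik
      rw [map_add, map_add, mul_add, map_add, hp i (by omega), heo' i (by omega), mul_comm e,
        (IsClass.X_pow ha).mul he (q := 2) rfl i (by omega), add_zero, zero_add, zero_add]
    have hwk : w ∈ tail k := by
      intro i hi
      by_cases hi2 : i % 2 = 0
      · exact hw i hi2
      · rw [← hfw i (by omega) hi.le, hfk i hi]
    have := h k hog
    rw [coeff_mul_of_mem_tail (P.constantCoeff_one_sub) hwk, ← hfw k (by omega) le_rfl] at this
    exact h0 this
  · intro hk
    obtain ⟨h1, h2, h3⟩ := S.elem_spec P hk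
    exact mem_valuations_of_mem h1 h2 h3

end Special

/-! ### Stability of the special space under the ring -/

/-- The equations on the parameters `Λ`, `o` expressing that the special space is stable under
`y = z^{2u} + z^v`: they say that `y` and `y (z^a + o)` belong to it. -/
structure IsSolution (u v s a α β : ℕ) (L o : ℂ⟦X⟧) : Prop where
  param : IsParam a α β L o
  first : ∀ k, OddGap α β k →
    PowerSeries.coeff k ((1 - L) * (PowerSeries.X ^ v - PowerSeries.X ^ (4 * s) * o)) = 0
  second : ∀ k, OddGap α β k → PowerSeries.coeff k ((1 - L) * (PowerSeries.X ^ (v + a) +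
    PowerSeries.X ^ (2 * u) * o - quot a (PowerSeries.X ^ v * o) * o)) = 0

namespace Special

variable {s a α β : ℕ} (S : Special u v s a α β) {L o : ℂ⟦X⟧}

include S

/-- The decomposition of `y` according to the definition of the special space. -/
lemma genY_eq (o : ℂ⟦X⟧) : genY u v = 0 + PowerSeries.X ^ (4 * s) * (PowerSeries.X ^ a + o) +
    (PowerSeries.X ^ v - PowerSeries.X ^ (4 * s) * o) := by
  have h : (PowerSeries.X : ℂ⟦X⟧) ^ (2 * u) = PowerSeries.X ^ (4 * s) * PowerSeries.X ^ a := by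
    rw [← pow_add]; congr 1; have := S.a_add; omega
  rw [genY, h]
  ring

/-- The decomposition of `y (z^a + o)` according to the definition of the special space. -/
lemma genY_mul_eq (P : IsParam a α β L o) : genY u v * (PowerSeries.X ^ a + o) =
    (PowerSeries.X ^ (2 * u + a) + part (· % 4 = 0) (PowerSeries.X ^ v * o)) +
      quot a (PowerSeries.X ^ v * o) * (PowerSeries.X ^ a + o) +
      (PowerSeries.X ^ (v + a) + PowerSeries.X ^ (2 * u) * o - quot a (PowerSeries.X ^ v * o) * o) := by
  have ha := S.a_mod
  have hv := S.exponents.v_mod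
  have h : PowerSeries.X ^ v * o =
      part (· % 4 = 0) (PowerSeries.X ^ v * o) + PowerSeries.X ^ a * quot a (PowerSeries.X ^ v * o) := by
    have h1 := mul_mem_tail (X_pow_mem_tail v) P.o_mem_tail
    ext k
    rw [map_add, coeff_part, coeff_X_pow_mul_quot]
    by_cases hk : k < v + (a + 1)
    · simp [h1 k hk]
    rcases (by omega : k % 4 = 0 ∨ k % 4 = 2 ∨ k % 2 = 1) with h | h | h
    · rw [if_pos h, if_neg (by omega), add_zero]
    · rw [if_neg (by omega), if_pos (by omega), zero_add]
    · rw [if_neg (by omega), if_neg (by omega), add_zero]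
      refine coeff_mul_eq_zero fun i j hij => ?_
      by_cases hi : i % 2 = 1
      · exact Or.inr (S.o_isOdd P j (by omega))
      · exact Or.inl (IsOddSeries.X_pow hv i (by omega))
  rw [genY]
  linear_combination h

lemma first_isOdd (P : IsParam a α β L o) : IsOddSeries (PowerSeries.X ^ v - PowerSeries.X ^ (4 * s) * o) :=
  (IsOddSeries.X_pow S.exponents.v_mod).sub
    (IsOddSeries.class_mul (r := 0) rfl (IsClass.X_pow (by omega)) (S.o_isOdd P))

lemma second_isOdd (P : IsParam a α β L o) : IsOddSeries (PowerSeries.X ^ (v + a) +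
    PowerSeries.X ^ (2 * u) * o - quot a (PowerSeries.X ^ v * o) * o) := by
  have ha := S.a_mod
  have hv := S.exponents.v_mod
  have hu := S.exponents.u_mod
  exact ((IsOddSeries.X_pow (by omega)).add (IsOddSeries.class_mul (r := 2) rfl
    (IsClass.X_pow (by omega)) (S.o_isOdd P))).sub
      (IsOddSeries.class_mul rfl (quot_isClass _ _) (S.o_isOdd P))

lemma part_isClass (f : ℂ⟦X⟧) : IsClass 0 (PowerSeries.X ^ (2 * u + a) + part (· % 4 = 0) f) := by
  have ha := S.a_mod
  have hu := S.exponents.u_mod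
  exact (IsClass.X_pow (by omega)).add fun k hk => by rw [coeff_part, if_neg hk]

/-- Solutions of the equations give `R`-modules. -/
lemma exists_module (H : IsSolution u v s a α β L o) :
    ∃ M : Submodule (R u v) ℂ⟦X⟧, M.restrictScalars ℂ = specialSpace a α β L o := by
  have E := S.exponents
  have P := H.param
  have hY : genY u v ∈ specialSpace a α β L o :=
    ⟨_, _, _, IsClass.zero 0, IsClass.X_pow (by omega), S.first_isOdd P, H.first, S.genY_eq o⟩
  have hY2 : genY u v * (PowerSeries.X ^ a + o) ∈ specialSpace a α β L o :=
    ⟨_, _, _, S.part_isClass _, quot_isClass _ _, S.second_isOdd P, H.second, S.genY_mul_eq P⟩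
  refine exists_submodule E.u_pos E.v_pos (S.tail_le_specialSpace P)
    (fun f hf => class_mul_mem_specialSpace (IsClass.X_pow rfl) hf) ?_
  rintro f ⟨p, e, w, hp, he, hw, h, rfl⟩
  have h1 : genY u v * w ∈ specialSpace a α β L o := by
    refine S.tail_le_specialSpace P (tail_anti ?_ (mul_mem_tail (genY_mem_tail E) (S.mem_tail_of_cond P hw h)))
    have := S.β_le
    omega
  have h2 : genY u v * (p + e * (PowerSeries.X ^ a + o) + w) =
      p * genY u v + e * (genY u v * (PowerSeries.X ^ a + o)) + genY u v * w := by ring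
  rw [h2]
  exact Submodule.add_mem _ (Submodule.add_mem _ (class_mul_mem_specialSpace hp hY)
    (class_mul_mem_specialSpace he hY2)) h1

/-- The parameters of a special space that is an `R`-module satisfy the equations. -/
lemma isSolution_of_module (P : IsParam a α β L o) {M : Submodule (R u v) ℂ⟦X⟧}
    (hM : M.restrictScalars ℂ = specialSpace a α β L o) : IsSolution u v s a α β L o := by
  have hmem : ∀ f, f ∈ specialSpace a α β L o → genY u v * f ∈ specialSpace a α β L o := by
    intro f hf
    rw [← hM] at hf ⊢
    exact genY_mul_mem S.exponents hf
  have h1 : (1 : ℂ⟦X⟧) ∈ specialSpace a α β L o :=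
    class_mem_specialSpace (by simpa using IsClass.X_pow (k := 0) rfl)
  refine ⟨P, ?_, ?_⟩
  · refine S.cond_of_mem P (IsClass.zero 0) (IsClass.X_pow (k := 4 * s) (by omega)) (S.first_isOdd P) ?_
    rw [← S.genY_eq o, ← mul_one (genY u v)]
    exact hmem 1 h1
  · refine S.cond_of_mem P (S.part_isClass (PowerSeries.X ^ v * o)) (quot_isClass a (PowerSeries.X ^ v * o))
      (S.second_isOdd P) ?_
    rw [← S.genY_mul_eq P]
    exact hmem _ second_mem_specialSpace

variable {D : Set ℕ} (hΔ : ∀ k, k ∈ semigroup u v ∪ D ↔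
    k % 4 = 0 ∨ (k % 4 = 2 ∧ a ≤ k) ∨ (k % 4 = α % 4 ∧ α ≤ k) ∨ (k % 4 = β % 4 ∧ β ≤ k))

include hΔ

/-- The module belonging to a solution. -/
lemma exists_normCell (H : IsSolution u v s a α β L o) :
    ∃ M : NormCell u v D, M.1.restrictScalars ℂ = specialSpace a α β L o := by
  obtain ⟨M, hM⟩ := S.exists_module H
  refine ⟨⟨M, ?_, ?_⟩, hM⟩
  · have : (1 : ℂ⟦X⟧) ∈ specialSpace a α β L o :=
      class_mem_specialSpace (by simpa using IsClass.X_pow (k := 0) rfl)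
    rwa [← hM] at this
  · ext k
    rw [hΔ, ← S.valuations_specialSpace H.param, ← hM]
    rfl

end Special

/-- The parameter `Λ` of a module. -/
def paramL (α : ℕ) (M : Submodule ℂ ℂ⟦X⟧) : ℂ⟦X⟧ :=
  PowerSeries.mk fun k => if k = 0 then 0 else PowerSeries.coeff (k + α) (red M α)

/-- The parameter `o` of a module. -/
def paramO (a : ℕ) (M : Submodule ℂ ℂ⟦X⟧) : ℂ⟦X⟧ := red M a - PowerSeries.X ^ a

namespace Special

variable {s a α β : ℕ} (S : Special u v s a α β) {L o : ℂ⟦X⟧}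
  {M : Submodule ℂ ℂ⟦X⟧} {c : ℕ} (hc : tail c ≤ M) (hv : ∀ k, k ∈ valuations (M : Set ℂ⟦X⟧) ↔
    k % 4 = 0 ∨ (k % 4 = 2 ∧ a ≤ k) ∨ (k % 4 = α % 4 ∧ α ≤ k) ∨ (k % 4 = β % 4 ∧ β ≤ k))

include S hc hv

lemma X_pow_mul_paramL : PowerSeries.X ^ α * (1 + paramL α M) = red M α := by
  have hα := S.odd_α
  ext k
  rw [PowerSeries.coeff_X_pow_mul']
  by_cases hk : α ≤ k
  · rw [if_pos hk, map_add, paramL, PowerSeries.coeff_mk, PowerSeries.coeff_one]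
    by_cases hk' : k = α
    · rw [hk', Nat.sub_self, if_pos rfl, if_pos rfl, add_zero, coeff_red hc ((hv α).mpr (by omega)), if_pos rfl]
    · rw [if_neg (by omega), if_neg (by omega), zero_add, Nat.sub_add_cancel hk]
  · rw [if_neg hk, red_mem_tail hc α k (by omega)]

lemma isParam : IsParam a α β (paramL α M) (paramO a M) := by
  have hα := S.odd_α
  have hβ := S.β_mod
  have ha := S.a_mod
  have ha' := S.a_lt
  refine ⟨fun k hk => ?_, fun k hk => ?_⟩
  · rw [paramL, PowerSeries.coeff_mk]
    by_cases hk0 : k = 0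
    · rw [if_pos hk0]
    · rw [if_neg hk0, coeff_red hc ((hv _).mpr (by omega)), if_neg (by omega)]
  · rw [paramO, map_sub, PowerSeries.coeff_X_pow]
    by_cases hka : k < a
    · rw [red_mem_tail hc a k hka, if_neg (by omega), sub_zero]
    · rw [coeff_red hc ((hv _).mpr (by unfold OddGap at hk; omega)), sub_self]

/-- Every module with the given valuations is the special space of its parameters. -/
lemma specialSpace_eq (hmul : ∀ p, IsClass 0 p → ∀ f ∈ M, p * f ∈ M) (h1 : (1 : ℂ⟦X⟧) ∈ M) (hβM : tail β ≤ M) :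
    specialSpace a α β (paramL α M) (paramO a M) = M := by
  have P := S.isParam hc hv
  have hα := S.odd_α
  have hβ := S.β_mod
  have ha := S.a_mod
  have ha' := S.a_lt
  refine eq_of_le_of_valuations (S.tail_le_specialSpace P) ?_ fun k hk => ?_
  · rintro _ ⟨p, e, w, hp, he, hw, h, rfl⟩
    have h2 : PowerSeries.X ^ a + paramO a M ∈ M := by
      rw [paramO, add_sub_cancel]
      exact red_mem hc a
    have hp1 : p ∈ M := by rw [← mul_one p]; exact hmul p hp 1 h1
    refine M.add_mem (M.add_mem hp1 (hmul e he _ h2)) ?_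
    -- Subtract from `w` the multiple of the reduced element of order `α`.
    have hwα := S.mem_tail_of_cond P hw h
    have h3 : PowerSeries.X ^ α * quot α w = part (· % 4 = α % 4) w := by
      ext k
      rw [coeff_X_pow_mul_quot, coeff_part]
      by_cases hk : k < α
      · simp [hwα k hk]
      · by_cases hk4 : k % 4 = α % 4
        · rw [if_pos (by omega), if_pos hk4]
        · rw [if_neg (by omega), if_neg hk4]
    have h4 : quot α w * red M α ∈ M := hmul _ (quot_isClass α w) _ (red_mem hc α)
    have h5 : quot α w * red M α = part (· % 4 = α % 4) w + paramL α M * part (· % 4 = α % 4) w := by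
      rw [← S.X_pow_mul_paramL hc hv, ← h3]
      ring
    have h6 : w - quot α w * red M α ∈ tail β := by
      intro k hk
      rw [h5, map_sub, map_add, coeff_part]
      have hLp : k % 4 ≠ β % 4 → PowerSeries.coeff k (paramL α M * part (· % 4 = α % 4) w) = 0 := by
        intro hk4
        refine coeff_mul_eq_zero fun i j hij => ?_
        by_cases hi : i % 4 = 2
        · refine Or.inr ?_
          rw [coeff_part, if_neg (by omega)]
        · exact Or.inl (P.isClass_L i hi)
      by_cases hk4 : k % 4 = β % 4
      · have h7 := h k (Or.inr ⟨hk4, hk⟩)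
        have h8 : PowerSeries.coeff k (paramL α M * w) =
            PowerSeries.coeff k (paramL α M * part (· % 4 = α % 4) w) := by
          rw [PowerSeries.coeff_mul, PowerSeries.coeff_mul]
          refine Finset.sum_congr rfl fun q hq => ?_
          rw [Finset.HasAntidiagonal.mem_antidiagonal] at hq
          by_cases hi : q.1 % 4 = 2
          · rw [coeff_part, if_pos (by omega)]
          · rw [P.isClass_L _ hi, zero_mul, zero_mul]
        rw [sub_mul, one_mul, map_sub, h8] at h7
        rw [if_neg (by omega), zero_add, h7]
      · rw [hLp hk4, add_zero]
        by_cases hkα : k % 4 = α % 4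
        · rw [if_pos hkα, sub_self]
        · rw [if_neg hkα, sub_zero, hw k (by omega)]
    have h9 := M.add_mem (hβM h6) h4
    rwa [sub_add_cancel] at h9
  · rw [S.valuations_specialSpace P]
    exact (hv k).mp hk

end Special

/-! ### Solving the equations of the exceptional case -/

lemma quot_add (a : ℕ) (f g : ℂ⟦X⟧) : quot a (f + g) = quot a f + quot a g := by
  ext k
  rw [map_add, coeff_quot, coeff_quot, coeff_quot, map_add]
  split_ifs <;> simp

lemma quot_sub (a : ℕ) (f g : ℂ⟦X⟧) : quot a (f - g) = quot a f - quot a g := by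
  rw [eq_sub_iff_add_eq, ← quot_add, sub_add_cancel]

lemma quot_X_pow {a k : ℕ} (hk : a ≤ k) (h : (k - a) % 4 = 0) :
    quot a (PowerSeries.X ^ k) = PowerSeries.X ^ (k - a) := by
  ext i
  rw [coeff_quot, PowerSeries.coeff_X_pow, PowerSeries.coeff_X_pow]
  split_ifs <;> first | rfl | omega

lemma coeff_mul_X_pow_add (f : ℂ⟦X⟧) (n k : ℕ) :
    PowerSeries.coeff (n + k) (f * PowerSeries.X ^ n) = PowerSeries.coeff k f := by
  rw [add_comm, PowerSeries.coeff_mul_X_pow]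

lemma coeff_mul_X_pow_of_lt (f : ℂ⟦X⟧) {n k : ℕ} (h : k < n) :
    PowerSeries.coeff k (f * PowerSeries.X ^ n) = 0 :=
  mul_mem_tail_right (X_pow_mem_tail n) f k h

/-- The coefficients of `Λ` that are forced by the compatibility of the two systems of equations. -/
def Forced (v a α β k : ℕ) : Prop := k % 4 = 2 ∧ v + k < α ∧ v + a + k < β

instance (v a α β : ℕ) : DecidablePred (Forced v a α β) := fun k => by unfold Forced; infer_instance

/-- The values of the forced coefficients. -/
def forcedValue (u v k : ℕ) : ℂ := if k + 4 * u = 2 * v then -(1 / 2) else 0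

/-- The triangular system for `o`. -/
def IsTriangular (u v s a α β : ℕ) (L o : ℂ⟦X⟧) : Prop := ∀ i, OddGap α β i → a < i →
  (OddGap α β (i + 4 * s) →
    PowerSeries.coeff i ((1 - L) * o) = PowerSeries.coeff (i + 4 * s) ((1 - L) * PowerSeries.X ^ v)) ∧
  (¬ OddGap α β (i + 4 * s) → OddGap α β (i + 2 * u) →
    PowerSeries.coeff i ((1 - L) * o) = PowerSeries.coeff (i + 2 * u)
      ((1 - L) * (quot a (PowerSeries.X ^ v * o) * o - PowerSeries.X ^ (v + a))))

/-- The first equation at `i + 4s` determines the `i`-th coefficient of `(1 - Λ) o`. -/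
lemma coeff_first_iff (v s : ℕ) (L o : ℂ⟦X⟧) (i : ℕ) :
    PowerSeries.coeff (i + 4 * s) ((1 - L) * (PowerSeries.X ^ v - PowerSeries.X ^ (4 * s) * o)) = 0 ↔
    PowerSeries.coeff i ((1 - L) * o) = PowerSeries.coeff (i + 4 * s) ((1 - L) * PowerSeries.X ^ v) := by
  rw [mul_sub, map_sub, mul_left_comm, PowerSeries.coeff_X_pow_mul, sub_eq_zero, eq_comm]

/-- The second equation at `i + 2u` determines the `i`-th coefficient of `(1 - Λ) o`. -/
lemma coeff_second_iff (u v a : ℕ) (L o : ℂ⟦X⟧) (i : ℕ) :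
    PowerSeries.coeff (i + 2 * u) ((1 - L) * (PowerSeries.X ^ (v + a) +
      PowerSeries.X ^ (2 * u) * o - quot a (PowerSeries.X ^ v * o) * o)) = 0 ↔
    PowerSeries.coeff i ((1 - L) * o) = PowerSeries.coeff (i + 2 * u)
      ((1 - L) * (quot a (PowerSeries.X ^ v * o) * o - PowerSeries.X ^ (v + a))) := by
  have h : (1 - L) * (PowerSeries.X ^ (v + a) + PowerSeries.X ^ (2 * u) * o -
      quot a (PowerSeries.X ^ v * o) * o) = PowerSeries.X ^ (2 * u) * ((1 - L) * o) -
      (1 - L) * (quot a (PowerSeries.X ^ v * o) * o - PowerSeries.X ^ (v + a)) := by ring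
  rw [h, map_sub, PowerSeries.coeff_X_pow_mul, sub_eq_zero]

lemma IsParam.quot_mul_mem_tail {a α β : ℕ} {L o : ℂ⟦X⟧} (P : IsParam a α β L o) (v : ℕ) : quot a (PowerSeries.X ^ v * o) ∈ tail (v + 1) :=
  quot_mem_tail (tail_anti (by omega) (mul_mem_tail (X_pow_mem_tail v) P.o_mem_tail))

namespace Special

variable {s a α β : ℕ} (S : Special u v s a α β) {L o : ℂ⟦X⟧}

include S

/-- The two systems overlap nontrivially only at the forced indices. -/
lemma forced_of_oddGap {m : ℕ} (h1 : OddGap α β m) (h2 : OddGap α β (m + a)) (hm : v ≤ m) :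
    v < α ∧ Forced v a α β (m - v) := by
  have ha := S.a_mod
  have hodd := S.odd_α
  have hβ := S.β_mod
  have hc := S.cases
  have hv := S.exponents.v_mod
  unfold OddGap at h1 h2
  unfold Forced
  omega

/-- Where both systems of equations determine the same coefficient of `o`, their compatibility
determines a coefficient of `Λ`: up to the relevant order `o` agrees with `z^{v - 4s}`. -/
lemma compatible_iff (P : IsParam a α β L o) (h1 : ∀ k, OddGap α β k →
      PowerSeries.coeff k ((1 - L) * (PowerSeries.X ^ v - PowerSeries.X ^ (4 * s) * o)) = 0)
    {m : ℕ} (hm : OddGap α β m) (hma : OddGap α β (m + a)) :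
    PowerSeries.coeff m ((1 - L) * PowerSeries.X ^ v) = PowerSeries.coeff (m + a)
      ((1 - L) * (quot a (PowerSeries.X ^ v * o) * o - PowerSeries.X ^ (v + a))) ↔
    ∀ k, v + k = m → PowerSeries.coeff k L = forcedValue u v k := by
  have ha := S.a_mod
  have hlt := S.a_lt
  have hadd := S.a_add
  have huv := S.exponents.lt
  have hvm := S.exponents.v_mod
  have h2 : PowerSeries.coeff (m + a) ((1 - L) * PowerSeries.X ^ (v + a)) =
      PowerSeries.coeff m ((1 - L) * PowerSeries.X ^ v) := by
    rw [pow_add, ← mul_assoc, PowerSeries.coeff_mul_X_pow]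
  rw [mul_sub, map_sub, h2]
  by_cases hmv : m < v
  · have h3 : PowerSeries.coeff (m + a) ((1 - L) * (quot a (PowerSeries.X ^ v * o) * o)) = 0 :=
      mul_mem_tail_right (mul_mem_tail (P.quot_mul_mem_tail v) P.o_mem_tail) (1 - L) _ (by omega)
    rw [h3, coeff_mul_X_pow_of_lt _ hmv, sub_zero]
    exact ⟨fun _ k hk => by omega, fun _ => rfl⟩
  obtain ⟨hvα, hk4, hkα, hkβ⟩ := S.forced_of_oddGap hm hma (not_lt.mp hmv)
  obtain ⟨k, rfl⟩ := Nat.exists_eq_add_of_le (not_lt.mp hmv)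
  rw [Nat.add_sub_cancel_left] at hk4 hkα hkβ
  have ho : o - PowerSeries.X ^ (v - 4 * s) ∈ tail (α - 4 * s) := by
    have h3 := S.mem_tail_of_cond P (S.first_isOdd P) h1
    have h4 : PowerSeries.X ^ (4 * s) * (o - PowerSeries.X ^ (v - 4 * s)) ∈ tail (4 * s + (α - 4 * s)) := by
      rw [mul_sub, ← pow_add, show 4 * s + (v - 4 * s) = v by omega, show 4 * s + (α - 4 * s) = α by omega,
        ← neg_sub]
      exact (tail α).neg_mem h3
    exact X_pow_mul_mem_tail_iff.mp h4
  set o' := o - PowerSeries.X ^ (v - 4 * s) with ho'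
  have ho2 : o = PowerSeries.X ^ (v - 4 * s) + o' := by rw [ho']; ring
  have hoc : o ∈ tail (v - 4 * s) := by
    rw [ho2]
    exact (tail _).add_mem (X_pow_mem_tail _) (tail_anti (by omega) ho)
  have hq : quot a (PowerSeries.X ^ v * o) =
      PowerSeries.X ^ (2 * v - 2 * u) + quot a (PowerSeries.X ^ v * o') := by
    have hu := S.exponents.u_mod
    nth_rewrite 1 [ho2]
    rw [mul_add, quot_add, ← pow_add, quot_X_pow (by omega) (by omega)]
    congr 2
    omega
  have hq' : quot a (PowerSeries.X ^ v * o') ∈ tail (v + (α - 4 * s) - a) :=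
    quot_mem_tail (tail_anti (by omega) (mul_mem_tail (X_pow_mem_tail v) ho))
  have hrest : PowerSeries.X ^ (2 * v - 2 * u) * o' + quot a (PowerSeries.X ^ v * o') * o ∈ tail (α + a) :=
    (tail _).add_mem (tail_anti (by omega) (mul_mem_tail (X_pow_mem_tail (2 * v - 2 * u)) ho))
      (tail_anti (by omega) (mul_mem_tail hq' hoc))
  have hqo : quot a (PowerSeries.X ^ v * o) * o = PowerSeries.X ^ (2 * v - 2 * u + (v - 4 * s)) +
      (PowerSeries.X ^ (2 * v - 2 * u) * o' + quot a (PowerSeries.X ^ v * o') * o) := by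
    rw [hq, pow_add]
    linear_combination PowerSeries.X ^ (2 * v - 2 * u) * ho2
  have h5 : PowerSeries.coeff (v + k + a) ((1 - L) * (quot a (PowerSeries.X ^ v * o) * o)) =
      if k + 4 * u = 2 * v then 1 else 0 := by
    rw [hqo, mul_add, map_add, mul_mem_tail_right hrest (1 - L) _ (by omega), add_zero]
    rcases lt_trichotomy (k + 4 * u) (2 * v) with h | h | h
    · rw [coeff_mul_X_pow_of_lt _ (by omega), if_neg (by omega)]
    · rw [if_pos h, show v + k + a = 2 * v - 2 * u + (v - 4 * s) + 0 by omega, coeff_mul_X_pow_add,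
        PowerSeries.coeff_zero_eq_constantCoeff_apply, P.constantCoeff_one_sub]
    · obtain ⟨t, ht⟩ := Nat.exists_eq_add_of_le h.le
      rw [if_neg (by omega), show v + k + a = 2 * v - 2 * u + (v - 4 * s) + t by omega, coeff_mul_X_pow_add,
        map_sub, PowerSeries.coeff_one, if_neg (by omega), P.isClass_L t (by omega), sub_zero]
  have h6 : PowerSeries.coeff (v + k) ((1 - L) * PowerSeries.X ^ v) = -PowerSeries.coeff k L := by
    rw [coeff_mul_X_pow_add, map_sub, PowerSeries.coeff_one, if_neg (by omega), zero_sub]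
  rw [h5, h6]
  have h7 : (∀ k', v + k' = v + k → PowerSeries.coeff k' L = forcedValue u v k') ↔
      PowerSeries.coeff k L = forcedValue u v k :=
    ⟨fun h => h k rfl, fun h k' hk' => by rw [Nat.add_left_cancel hk']; exact h⟩
  rw [h7, forcedValue]
  split_ifs
  · exact ⟨fun h => by linear_combination (-1 / 2) * h, fun h => by linear_combination -2 * h⟩
  · exact ⟨fun h => by linear_combination (-1 / 2) * h, fun h => by linear_combination -2 * h⟩

lemma oddGap_sub_two_mul {k : ℕ} (hk : OddGap α β k) (h : 2 * u ≤ k) : OddGap α β (k - 2 * u) := by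
  have := S.exponents.u_mod
  have := S.odd_α
  have := S.β_mod
  have := S.β_le
  have := S.α_lt
  unfold OddGap at *
  omega

/-- The parameters `Λ`, `o` of modules: the coefficients of `o` solve a triangular system and those of
`Λ` are free apart from the forced ones. -/
lemma isSolution_iff (P : IsParam a α β L o) : IsSolution u v s a α β L o ↔
    (∀ k, Forced v a α β k → PowerSeries.coeff k L = forcedValue u v k) ∧ IsTriangular u v s a α β L o := by
  have hadd := S.a_add
  have hlt := S.a_lt
  have huv := S.exponents.lt
  constructor
  · intro H
    refine ⟨fun k hk => ?_, fun i hi _ => ⟨fun h => (coeff_first_iff v s L o i).mp (H.first _ h),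
      fun _ h => (coeff_second_iff u v a L o i).mp (H.second _ h)⟩⟩
    obtain ⟨hk4, hkα, hkβ⟩ := hk
    have ha := S.a_mod
    have hodd := S.odd_α
    have hβ := S.β_mod
    have hc := S.cases
    have h1 : OddGap α β (v + k) := by unfold OddGap; omega
    have h2 : OddGap α β (v + k + a) := by unfold OddGap; omega
    refine (S.compatible_iff P H.first h1 h2).mp ?_ k rfl
    obtain ⟨i, hi⟩ : ∃ i, v + k = i + 4 * s := ⟨v + k - 4 * s, by omega⟩
    have h3 := (coeff_first_iff v s L o i).mp (H.first _ (hi ▸ h1))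
    have h4 := (coeff_second_iff u v a L o i).mp (H.second _ (by rwa [show i + 2 * u = v + k + a by omega]))
    rw [hi, ← h3, h4, show i + 4 * s + a = i + 2 * u by omega]
  · rintro ⟨hF, hT⟩
    have hfirst : ∀ k, OddGap α β k →
        PowerSeries.coeff k ((1 - L) * (PowerSeries.X ^ v - PowerSeries.X ^ (4 * s) * o)) = 0 := by
      intro k hk
      by_cases hk2 : k ≤ 2 * u
      · refine mul_mem_tail_right ((tail (2 * u + 1)).sub_mem (tail_anti (by omega) (X_pow_mem_tail v))
          (tail_anti (by omega) (mul_mem_tail (X_pow_mem_tail (4 * s)) P.o_mem_tail))) _ _ (by omega)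
      · obtain ⟨i, hi⟩ : ∃ i, k = i + 4 * s := ⟨k - 4 * s, by omega⟩
        rw [hi, coeff_first_iff]
        have hi2 : OddGap α β i := by
          have := hk.sub_of_dvd (i := 4 * s) (by omega)
          rw [show k - 4 * s = i by omega] at this
          exact this.resolve_right (by omega)
        exact (hT i hi2 (by omega)).1 (hi ▸ hk)
    refine ⟨P, hfirst, fun k hk => ?_⟩
    by_cases hk2 : k ≤ 2 * u + a
    · refine mul_mem_tail_right ((tail (2 * u + a + 1)).sub_mem ((tail _).add_mem
        (tail_anti (by omega) (X_pow_mem_tail (v + a)))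
        (tail_anti (by omega) (mul_mem_tail (X_pow_mem_tail (2 * u)) P.o_mem_tail)))
        (tail_anti (by omega) (mul_mem_tail (P.quot_mul_mem_tail v) P.o_mem_tail))) _ _ (by omega)
    · obtain ⟨i, hi⟩ : ∃ i, k = i + 2 * u := ⟨k - 2 * u, by omega⟩
      have hi2 : OddGap α β i := by
        have := S.oddGap_sub_two_mul hk (by omega)
        rwa [show k - 2 * u = i by omega] at this
      rw [hi, coeff_second_iff]
      by_cases h4 : OddGap α β (i + 4 * s)
      · have hk' : OddGap α β (i + 4 * s + a) := by rwa [show i + 4 * s + a = k by omega]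
        rw [(hT i hi2 (by omega)).1 h4, show i + 2 * u = i + 4 * s + a by omega, S.compatible_iff P hfirst h4 hk']
        intro j hj
        refine hF j ?_
        have := (S.forced_of_oddGap h4 hk' (by omega)).2
        rwa [show i + 4 * s - v = j by omega] at this
      · exact (hT i hi2 (by omega)).2 h4 (hi ▸ hk)

end Special

/-! ### Coordinates in the exceptional case -/

/-- Recursive construction of a regular family, coefficient by coefficient. -/
lemma exists_recursion {T : Type*} {O : Subalgebra ℂ (T → ℂ)} {Φ : ℕ → T → ℂ⟦X⟧ → ℂ} {c : ℕ}
    (hc : ∀ i, c ≤ i → ∀ x f, Φ i x f = 0) (hcaus : ∀ i x f g, f - g ∈ tail i → Φ i x f = Φ i x g)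
    (hreg : ∀ i F, IsRegularFamily O F → (fun x => Φ i x (F x)) ∈ O) :
    ∃ F : T → ℂ⟦X⟧, IsRegularFamily O F ∧ ∀ x i, PowerSeries.coeff i (F x) = Φ i x (F x) := by
  have key : ∀ n, ∃ F : T → ℂ⟦X⟧, IsRegularFamily O F ∧ ∀ x,
      (∀ i < n, PowerSeries.coeff i (F x) = Φ i x (F x)) ∧ ∀ i, n ≤ i → PowerSeries.coeff i (F x) = 0 := by
    intro n
    induction n with
    | zero => exact ⟨fun _ => 0, IsRegularFamily.const 0, fun x => ⟨by simp, by simp⟩⟩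
    | succ n ih =>
      obtain ⟨F, hF, h⟩ := ih
      have hdiff : ∀ x, F x + Φ n x (F x) • PowerSeries.X ^ n - F x ∈ tail n := fun x => by
        rw [add_sub_cancel_left]
        exact (tail n).smul_mem _ (X_pow_mem_tail n)
      refine ⟨fun x => F x + Φ n x (F x) • PowerSeries.X ^ n,
        hF.add (IsRegularFamily.smul (hreg n F hF) (IsRegularFamily.const _)), fun x => ⟨fun i hi => ?_, fun i hi => ?_⟩⟩
      · rw [hcaus i x _ (F x) (tail_anti (by omega) (hdiff x)), map_add, map_smul, PowerSeries.coeff_X_pow]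
        by_cases hin : i = n
        · rw [if_pos hin, (h x).2 i hin.ge, zero_add, smul_eq_mul, mul_one, hin]
        · rw [if_neg hin, smul_zero, add_zero, (h x).1 i (by omega)]
      · rw [map_add, map_smul, PowerSeries.coeff_X_pow, if_neg (by omega), (h x).2 i (by omega), smul_zero, add_zero]
  obtain ⟨F, hF, h⟩ := key c
  refine ⟨F, hF, fun x i => ?_⟩
  by_cases hi : i < c
  · exact (h x).1 i hi
  · rw [hc i (by omega), (h x).2 i (by omega)]

/-- The solution of a recursion is unique. -/
lemma eq_of_recursion {Φ : ℕ → ℂ⟦X⟧ → ℂ} (hcaus : ∀ i f g, f - g ∈ tail i → Φ i f = Φ i g) {f g : ℂ⟦X⟧}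
    (hf : ∀ i, PowerSeries.coeff i f = Φ i f) (hg : ∀ i, PowerSeries.coeff i g = Φ i g) : f = g := by
  ext i
  induction i using Nat.strong_induction_on with
  | _ i ih =>
    rw [hf, hg]
    refine hcaus i f g fun k hk => ?_
    rw [map_sub, ih k hk, sub_self]

lemma IsRegularFamily.quot {T : Type*} {O : Subalgebra ℂ (T → ℂ)} {F : T → ℂ⟦X⟧} (hF : IsRegularFamily O F)
    (a : ℕ) : IsRegularFamily O fun x => quot a (F x) := by
  intro k
  simp only [coeff_quot]
  by_cases hk : k % 4 = 0
  · simp only [if_pos hk]; exact hF _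
  · simp only [if_neg hk]; exact O.zero_mem

lemma IsRegularFamily.part {T : Type*} {O : Subalgebra ℂ (T → ℂ)} {F : T → ℂ⟦X⟧} (hF : IsRegularFamily O F)
    (p : ℕ → Prop) [DecidablePred p] : IsRegularFamily O fun x => part p (F x) := by
  intro k
  simp only [coeff_part]
  by_cases hk : p k
  · simp only [if_pos hk]; exact hF _
  · simp only [if_neg hk]; exact O.zero_mem

/-- The recursion for the coefficients of `o`: the `i`-th coefficient is expressed by the previous ones and,
where the system of equations leaves it undetermined, by the value `φ i` of the coefficient of
`(1 - Λ) o`. -/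
def recCoeff (u v s a α β : ℕ) (L : ℂ⟦X⟧) (φ : ℕ → ℂ) (i : ℕ) (f : ℂ⟦X⟧) : ℂ :=
  if OddGap α β i ∧ a < i then
    (if OddGap α β (i + 4 * s) then PowerSeries.coeff (i + 4 * s) ((1 - L) * PowerSeries.X ^ v)
    else if OddGap α β (i + 2 * u) then PowerSeries.coeff (i + 2 * u)
      ((1 - L) * (quot a (PowerSeries.X ^ v * part (a < ·) f) * part (a < ·) f - PowerSeries.X ^ (v + a)))
    else φ i) + PowerSeries.coeff i (L * f)
  else 0

lemma part_mem_tail (a : ℕ) (f : ℂ⟦X⟧) : part (a < ·) f ∈ tail (a + 1) := fun k hk => by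
  rw [coeff_part, if_neg (by omega)]

lemma part_sub_mem_tail {p : ℕ → Prop} [DecidablePred p] {f g : ℂ⟦X⟧} {i : ℕ} (h : f - g ∈ tail i) :
    part p f - part p g ∈ tail i := fun k hk => by
  have := h k hk
  rw [map_sub] at this
  rw [map_sub, coeff_part, coeff_part]
  split_ifs
  · exact this
  · exact sub_self 0

/-- The recursion for the `i`-th coefficient only involves coefficients of smaller index. -/
lemma recCoeff_congr {s a α β : ℕ} (huv : 2 * u < v) {L : ℂ⟦X⟧} (hL : L ∈ tail 2) (φ : ℕ → ℂ) (i : ℕ) (f g : ℂ⟦X⟧)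
    (h : f - g ∈ tail i) : recCoeff u v s a α β L φ i f = recCoeff u v s a α β L φ i g := by
  have h1 : PowerSeries.coeff i (L * f) = PowerSeries.coeff i (L * g) := by
    rw [← sub_eq_zero, ← map_sub, ← mul_sub]
    exact mul_mem_tail hL h i (by omega)
  have h2 : PowerSeries.coeff (i + 2 * u)
      ((1 - L) * (quot a (PowerSeries.X ^ v * part (a < ·) f) * part (a < ·) f - PowerSeries.X ^ (v + a))) =
      PowerSeries.coeff (i + 2 * u)
      ((1 - L) * (quot a (PowerSeries.X ^ v * part (a < ·) g) * part (a < ·) g - PowerSeries.X ^ (v + a))) := by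
    have hf' := part_mem_tail a f
    have hg' := part_mem_tail a g
    have hd := part_sub_mem_tail (p := (a < ·)) h
    set f' := part (a < ·) f
    set g' := part (a < ·) g
    rw [← sub_eq_zero, ← map_sub, ← mul_sub]
    have e : quot a (PowerSeries.X ^ v * f') * f' - PowerSeries.X ^ (v + a) -
        (quot a (PowerSeries.X ^ v * g') * g' - PowerSeries.X ^ (v + a)) =
        quot a (PowerSeries.X ^ v * (f' - g')) * f' + quot a (PowerSeries.X ^ v * g') * (f' - g') := by
      rw [mul_sub, quot_sub]; ring
    rw [e]
    refine mul_mem_tail_right ((tail (v + i)).add_mem ?_ ?_) _ _ (by omega)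
    · have h3 := mul_mem_tail (X_pow_mem_tail v) hd
      by_cases hai : a ≤ v + i
      · have h4 : quot a (PowerSeries.X ^ v * (f' - g')) ∈ tail (v + i - a) :=
          quot_mem_tail (tail_anti (by omega) h3)
        exact tail_anti (by omega) (mul_mem_tail h4 hf')
      · exact tail_anti (by omega) (mul_mem_tail_right hf' _)
    · have h4 : quot a (PowerSeries.X ^ v * g') ∈ tail (v + 1) :=
        quot_mem_tail (tail_anti (by omega) (mul_mem_tail (X_pow_mem_tail v) hg'))
      exact tail_anti (by omega) (mul_mem_tail h4 hd)
  unfold recCoeff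
  rw [h1, h2]

lemma regular_recCoeff {T : Type*} {O : Subalgebra ℂ (T → ℂ)} {L F : T → ℂ⟦X⟧} (hL : IsRegularFamily O L)
    {φ : T → ℕ → ℂ} (hφ : ∀ i, (fun x => φ x i) ∈ O) (hF : IsRegularFamily O F) (u v s a α β i : ℕ) :
    (fun x => recCoeff u v s a α β (L x) (φ x) i (F x)) ∈ O := by
  unfold recCoeff
  have h1 : IsRegularFamily O fun x => 1 - L x := (IsRegularFamily.const 1).sub hL
  by_cases hi : OddGap α β i ∧ a < i
  · simp only [if_pos hi]
    refine O.add_mem ?_ (hL.mul hF i)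
    by_cases hi1 : OddGap α β (i + 4 * s)
    · simp only [if_pos hi1]
      exact h1.mul (IsRegularFamily.const _) _
    · simp only [if_neg hi1]
      by_cases hi2 : OddGap α β (i + 2 * u)
      · simp only [if_pos hi2]
        have h2 := hF.part (a < ·)
        exact h1.mul (((((IsRegularFamily.const (PowerSeries.X ^ v)).mul h2).quot a).mul h2).sub
          (IsRegularFamily.const _)) _
      · simp only [if_neg hi2]
        exact hφ i
  · simp only [if_neg hi]
    exact O.zero_mem

lemma coeff_eq_coeff_one_sub_add (L o : ℂ⟦X⟧) (i : ℕ) : PowerSeries.coeff i o =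
    PowerSeries.coeff i ((1 - L) * o) + PowerSeries.coeff i (L * o) := by
  rw [← map_add]; congr 1; ring

/-- The recursion is equivalent to the triangular system. -/
lemma recCoeff_iff {s a α β : ℕ} {L o : ℂ⟦X⟧} {φ : ℕ → ℂ} :
    (∀ i, PowerSeries.coeff i o = recCoeff u v s a α β L φ i o) ↔
    (∀ k, ¬ (OddGap α β k ∧ a < k) → PowerSeries.coeff k o = 0) ∧ IsTriangular u v s a α β L o ∧
    ∀ i, OddGap α β i → a < i → ¬ OddGap α β (i + 4 * s) → ¬ OddGap α β (i + 2 * u) →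
      PowerSeries.coeff i ((1 - L) * o) = φ i := by
  have hpart : (∀ k, ¬ (OddGap α β k ∧ a < k) → PowerSeries.coeff k o = 0) → part (a < ·) o = o := by
    intro h
    ext k
    rw [coeff_part]
    by_cases hk : a < k
    · rw [if_pos hk]
    · rw [if_neg hk, h k fun h' => hk h'.2]
  constructor
  · intro h
    have h0 : ∀ k, ¬ (OddGap α β k ∧ a < k) → PowerSeries.coeff k o = 0 := fun k hk => by
      rw [h k, recCoeff, if_neg hk]
    have h1 : ∀ i, OddGap α β i → a < i → PowerSeries.coeff i ((1 - L) * o) =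
        if OddGap α β (i + 4 * s) then PowerSeries.coeff (i + 4 * s) ((1 - L) * PowerSeries.X ^ v)
        else if OddGap α β (i + 2 * u) then PowerSeries.coeff (i + 2 * u)
          ((1 - L) * (quot a (PowerSeries.X ^ v * o) * o - PowerSeries.X ^ (v + a)))
        else φ i := by
      intro i hi hai
      have h2 := h i
      rw [recCoeff, if_pos ⟨hi, hai⟩, hpart h0, coeff_eq_coeff_one_sub_add L o i] at h2
      exact add_right_cancel h2
    refine ⟨h0, fun i hi hai => ⟨fun h' => ?_, fun h' h'' => ?_⟩, fun i hi hai h' h'' => ?_⟩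
    · rw [h1 i hi hai, if_pos h']
    · rw [h1 i hi hai, if_neg h', if_pos h'']
    · rw [h1 i hi hai, if_neg h', if_neg h'']
  · rintro ⟨h0, hT, hf⟩ i
    unfold recCoeff
    by_cases hi : OddGap α β i ∧ a < i
    · rw [if_pos hi, hpart h0, coeff_eq_coeff_one_sub_add L o i, add_left_inj]
      by_cases hi1 : OddGap α β (i + 4 * s)
      · rw [if_pos hi1, (hT i hi.1 hi.2).1 hi1]
      · rw [if_neg hi1]
        by_cases hi2 : OddGap α β (i + 2 * u)
        · rw [if_pos hi2, (hT i hi.1 hi.2).2 hi1 hi2]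
        · rw [if_neg hi2, hf i hi.1 hi.2 hi1 hi2]
    · rw [if_neg hi, h0 i hi]

namespace Special

variable {s a α β : ℕ} (S : Special u v s a α β)

include S

lemma paramL_specialSpace {L o : ℂ⟦X⟧} (P : IsParam a α β L o) : paramL α (specialSpace a α β L o) = L := by
  have hodd := S.odd_α
  have hβ := S.β_mod
  have h1 : red (specialSpace a α β L o) α = PowerSeries.X ^ α * (1 + L) := by
    refine red_eq (S.third_mem P rfl le_rfl) fun b hb => ?_
    rw [S.valuations_specialSpace P] at hb
    rw [PowerSeries.coeff_X_pow_mul', map_add, PowerSeries.coeff_one]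
    by_cases hbα : b = α
    · rw [if_pos hbα.ge, if_pos (by omega), if_pos hbα, P.L_mem_tail _ (by omega), add_zero]
    · rw [if_neg hbα]
      split_ifs with h h'
      · omega
      · rw [P.coeff_L _ (by omega), add_zero]
      · rfl
  ext k
  rw [paramL, PowerSeries.coeff_mk, h1, PowerSeries.coeff_X_pow_mul, map_add, PowerSeries.coeff_one]
  by_cases hk : k = 0
  · rw [if_pos hk, P.L_mem_tail k (by omega)]
  · rw [if_neg hk, if_neg hk, zero_add]

lemma paramO_specialSpace {L o : ℂ⟦X⟧} (P : IsParam a α β L o) : paramO a (specialSpace a α β L o) = o := by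
  have hodd := S.odd_α
  have hβ := S.β_mod
  have ha := S.a_mod
  have h1 : red (specialSpace a α β L o) a = PowerSeries.X ^ a + o := by
    refine red_eq second_mem_specialSpace fun b hb => ?_
    rw [S.valuations_specialSpace P] at hb
    rw [map_add, PowerSeries.coeff_X_pow, P.coeff_o b (by unfold OddGap; omega), add_zero]
  rw [paramO, h1, add_sub_cancel_left]

/-- In the exceptional case the normalised cell is an affine space, whose coordinates are the coefficients
of `Λ` that are not forced and the coefficients of `(1 - Λ) o` left undetermined by the triangular
system. -/
theorem isAffineCell {D : Set ℕ} (hΔ : ∀ k, k ∈ semigroup u v ∪ D ↔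
      k % 4 = 0 ∨ (k % 4 = 2 ∧ a ≤ k) ∨ (k % 4 = α % 4 ∧ α ≤ k) ∨ (k % 4 = β % 4 ∧ β ≤ k))
    {J I : Finset ℕ} (hJ : ∀ k, k ∈ J ↔ k % 4 = 2 ∧ α + k < β ∧ ¬ Forced v a α β k)
    (hI : ∀ i, i ∈ I ↔ OddGap α β i ∧ a < i ∧ ¬ OddGap α β (i + 4 * s) ∧ ¬ OddGap α β (i + 2 * u)) :
    IsAffineCell (normAlg u v D) (J.card + I.card) := by
  have E := S.exponents
  have hFJ : ∀ k, Forced v a α β k → k ∉ J ∧ k % 4 = 2 ∧ α + k < β := by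
    intro k hk
    have hc := S.cases
    refine ⟨fun h => ((hJ k).mp h).2.2 hk, hk.1, ?_⟩
    have := hk.2.1
    have := hk.2.2
    omega
  let T := J ⊕ I → ℂ
  let Lf : T → ℂ⟦X⟧ := fun c => PowerSeries.mk fun k =>
    if h : k ∈ J then c (Sum.inl ⟨k, h⟩) else if Forced v a α β k then forcedValue u v k else 0
  let φ : T → ℕ → ℂ := fun c i => if h : i ∈ I then c (Sum.inr ⟨i, h⟩) else 0
  have hLreg : IsRegularFamily (polyFun (J ⊕ I)) Lf := by
    intro k
    simp only [Lf, PowerSeries.coeff_mk]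
    by_cases hk : k ∈ J
    · simp only [dif_pos hk]; exact coord_mem_polyFun _
    · simp only [dif_neg hk]
      exact (polyFun (J ⊕ I)).algebraMap_mem (if Forced v a α β k then forcedValue u v k else 0)
  have hφreg : ∀ i, (fun c => φ c i) ∈ polyFun (J ⊕ I) := by
    intro i
    by_cases hi : i ∈ I
    · simp only [φ, dif_pos hi]; exact coord_mem_polyFun _
    · simp only [φ, dif_neg hi]; exact Subalgebra.zero_mem _
  have hLsupp : ∀ c k, ¬ (k % 4 = 2 ∧ α + k < β) → PowerSeries.coeff k (Lf c) = 0 := by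
    intro c k hk
    rw [PowerSeries.coeff_mk, dif_neg fun h => hk ⟨((hJ k).mp h).1, ((hJ k).mp h).2.1⟩,
      if_neg fun h => hk (hFJ k h).2]
  have hLtail : ∀ c, Lf c ∈ tail 2 := fun c k hk => hLsupp c k (by omega)
  obtain ⟨of, horeg, hof⟩ := exists_recursion (O := polyFun (J ⊕ I)) (c := β)
    (Φ := fun i c f => recCoeff u v s a α β (Lf c) (φ c) i f)
    (fun i hi x f => by
      rw [recCoeff, if_neg fun h => ?_]
      have := S.oddGap_lt h.1
      omega)
    (fun i c f g h => recCoeff_congr E.lt (hLtail c) (φ c) i f g h)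
    (fun i F hF => regular_recCoeff hLreg hφreg hF u v s a α β i)
  have hrec := fun c => recCoeff_iff.mp (hof c)
  have hP : ∀ c, IsParam a α β (Lf c) (of c) := fun c => ⟨hLsupp c, (hrec c).1⟩
  have hsol : ∀ c, IsSolution u v s a α β (Lf c) (of c) := fun c =>
    (S.isSolution_iff (hP c)).mpr ⟨fun k hk => by
      rw [PowerSeries.coeff_mk, dif_neg (hFJ k hk).1, if_pos hk], (hrec c).2.1⟩
  choose G hG using fun c => S.exists_normCell hΔ (hsol c)
  -- The coordinates of a module.
  let e₀ : NormCell u v D → T := fun M => Sum.elim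
    (fun j => PowerSeries.coeff (j : ℕ) (paramL α (M.1.restrictScalars ℂ)))
    (fun i => PowerSeries.coeff (i : ℕ)
      ((1 - paramL α (M.1.restrictScalars ℂ)) * paramO a (M.1.restrictScalars ℂ)))
  have he₀G : ∀ c, e₀ (G c) = c := by
    intro c
    funext x
    rcases x with j | i
    · change PowerSeries.coeff (j : ℕ) (paramL α ((G c).1.restrictScalars ℂ)) = _
      rw [hG, S.paramL_specialSpace (hP c), PowerSeries.coeff_mk, dif_pos j.2]
    · change PowerSeries.coeff (i : ℕ) ((1 - paramL α ((G c).1.restrictScalars ℂ)) *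
        paramO a ((G c).1.restrictScalars ℂ)) = _
      obtain ⟨h1, h2, h3, h4⟩ := (hI i).mp i.2
      rw [hG, S.paramL_specialSpace (hP c), S.paramO_specialSpace (hP c), (hrec c).2.2 i h1 h2 h3 h4]
      exact dif_pos i.2
  have hM : ∀ M : NormCell u v D,
      specialSpace a α β (paramL α (M.1.restrictScalars ℂ)) (paramO a (M.1.restrictScalars ℂ)) =
        M.1.restrictScalars ℂ ∧
      IsParam a α β (paramL α (M.1.restrictScalars ℂ)) (paramO a (M.1.restrictScalars ℂ)) := by
    intro M
    have hc := tail_le_of_one_mem E M.2.1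
    have hv : ∀ k, k ∈ valuations (M.1.restrictScalars ℂ : Set ℂ⟦X⟧) ↔
        k % 4 = 0 ∨ (k % 4 = 2 ∧ a ≤ k) ∨ (k % 4 = α % 4 ∧ α ≤ k) ∨ (k % 4 = β % 4 ∧ β ≤ k) := by
      intro k
      rw [← hΔ]
      exact Set.ext_iff.mp M.2.2 k
    refine ⟨S.specialSpace_eq hc hv (fun p hp f hf => ?_) M.2.1 ?_, S.isParam hc hv⟩
    · exact mul_mem_of_mem_R (mem_R_of_support E.u_pos E.v_pos hp) hf
    · refine tail_le_module E fun k hk => (hv k).mpr ?_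
      have := S.odd_α
      have := S.β_mod
      have := S.a_lt
      have := S.α_lt
      omega
  have hinj : Function.Injective e₀ := by
    intro M M' h
    obtain ⟨h1, h2⟩ := hM M
    obtain ⟨h1', h2'⟩ := hM M'
    have hs := (S.isSolution_iff h2).mp (S.isSolution_of_module h2 h1.symm)
    have hs' := (S.isSolution_iff h2').mp (S.isSolution_of_module h2' h1'.symm)
    have hL : paramL α (M.1.restrictScalars ℂ) = paramL α (M'.1.restrictScalars ℂ) := by
      ext k
      by_cases hk : k ∈ J
      · exact congrFun h (Sum.inl ⟨k, hk⟩)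
      by_cases hF : Forced v a α β k
      · rw [hs.1 k hF, hs'.1 k hF]
      have hk' : ¬ (k % 4 = 2 ∧ α + k < β) := fun h => hk ((hJ k).mpr ⟨h.1, h.2, hF⟩)
      rw [h2.coeff_L k hk', h2'.coeff_L k hk']
    have hO : paramO a (M.1.restrictScalars ℂ) = paramO a (M'.1.restrictScalars ℂ) := by
      refine eq_of_recursion (Φ := recCoeff u v s a α β (paramL α (M.1.restrictScalars ℂ))
        fun i => PowerSeries.coeff i ((1 - paramL α (M.1.restrictScalars ℂ)) *
          paramO a (M.1.restrictScalars ℂ))) (recCoeff_congr E.lt h2.L_mem_tail _)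
        (recCoeff_iff.mpr ⟨h2.coeff_o, hs.2, fun _ _ _ _ _ => rfl⟩)
        (recCoeff_iff.mpr ⟨h2'.coeff_o, ?_, fun i i1 i2 i3 i4 => ?_⟩)
      · rw [hL]; exact hs'.2
      · have := congrFun h (Sum.inr ⟨i, (hI i).mpr ⟨i1, i2, i3, i4⟩⟩)
        change PowerSeries.coeff i ((1 - paramL α (M.1.restrictScalars ℂ)) *
          paramO a (M.1.restrictScalars ℂ)) = PowerSeries.coeff i ((1 - paramL α (M'.1.restrictScalars ℂ)) *
          paramO a (M'.1.restrictScalars ℂ)) at this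
        rw [this, hL]
    have hMM : M.1.restrictScalars ℂ = M'.1.restrictScalars ℂ := by rw [← h1, ← h1', hL, hO]
    exact Subtype.ext (Submodule.restrictScalars_injective ℂ _ _ hMM)
  let e := Equiv.ofBijective e₀ ⟨hinj, fun c => ⟨G c, he₀G c⟩⟩
  have hesymm : ∀ c, e.symm c = G c := fun c => by
    rw [Equiv.symm_apply_eq]
    exact (he₀G c).symm
  have hLp : IsRegularFamily (normAlg u v D) fun M => paramL α (M.1.restrictScalars ℂ) := by
    intro k
    simp only [paramL, PowerSeries.coeff_mk]
    by_cases hk : k = 0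
    · simp only [if_pos hk]; exact Subalgebra.zero_mem _
    · simp only [if_neg hk]
      exact regularFamily_red_coordAlg (fun (M : NormCell u v D) (_ : Unit) => M.1.restrictScalars ℂ) () α _
  have hOp : IsRegularFamily (normAlg u v D) fun M => paramO a (M.1.restrictScalars ℂ) :=
    (regularFamily_red_coordAlg (fun (M : NormCell u v D) (_ : Unit) => M.1.restrictScalars ℂ) () a).sub
      (IsRegularFamily.const _)
  refine isAffineCell_of_equiv e ?_ ?_ (by simp)
  · rintro (j | i)
    · exact hLp j
    · exact ((IsRegularFamily.const 1).sub hLp).mul hOp i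
  · intro f hf
    simp only [hesymm]
    refine comp_mem_of_mem_coordAlg (fun _ b => ?_) hf
    simp only [hG]
    refine regularFamily_red (Δ := semigroup u v ∪ D) (c := β) (fun c => S.tail_le_specialSpace (hP c)) ?_
      (e := fun k c => elem a α (Lf c) (of c) k) (fun k hk _ => ⟨?_, fun c => S.elem_spec (hP c) ((hΔ k).mp hk)⟩) b
    · intro c
      ext k
      rw [S.valuations_specialSpace (hP c), hΔ]
    · unfold elem
      by_cases h2 : k % 4 = 2
      · simp only [if_pos h2]
        exact (IsRegularFamily.const _).mul ((IsRegularFamily.const _).add horeg)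
      · simp only [if_neg h2]
        by_cases hα : k % 4 = α % 4
        · simp only [if_pos hα]
          exact (IsRegularFamily.const _).mul ((IsRegularFamily.const 1).add hLreg)
        · simp only [if_neg hα]
          exact IsRegularFamily.const _

end Special

/-! ### The exceptional step -/

/-- The free coefficients of `Λ`. -/
def freeL (v a α β : ℕ) : Finset ℕ :=
  (Finset.range β).filter fun k => k % 4 = 2 ∧ α + k < β ∧ ¬ Forced v a α β k

/-- The free coefficients of `(1 - Λ) o`. -/
def freeO (u s a α β : ℕ) : Finset ℕ :=
  (Finset.range β).filter fun i => OddGap α β i ∧ a < i ∧ ¬ OddGap α β (i + 4 * s) ∧ ¬ OddGap α β (i + 2 * u)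

lemma mem_freeL {v a α β k : ℕ} : k ∈ freeL v a α β ↔ k % 4 = 2 ∧ α + k < β ∧ ¬ Forced v a α β k := by
  rw [freeL, Finset.mem_filter, Finset.mem_range, and_iff_right_iff_imp]
  omega

namespace Special

variable {s a α β : ℕ} (S : Special u v s a α β)

include S

lemma mem_freeO {i : ℕ} :
    i ∈ freeO u s a α β ↔ OddGap α β i ∧ a < i ∧ ¬ OddGap α β (i + 4 * s) ∧ ¬ OddGap α β (i + 2 * u) := by
  rw [freeO, Finset.mem_filter, Finset.mem_range, and_iff_right_iff_imp]
  exact fun h => S.oddGap_lt h.1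

lemma mem_freeO_iff {i : ℕ} : i ∈ freeO u s a α β ↔ (i % 4 = β % 4 ∧ i < β ∧ β ≤ i + 4 * s) ∨
    (i % 4 = α % 4 ∧ i < α ∧ α ≤ i + 4 * s ∧ β ≤ i + 2 * u) := by
  have h1 := S.odd_α
  have h2 := S.β_mod
  have h3 := S.a_mod
  have h4 := S.a_add
  have h5 := S.le_β
  have h6 := S.α_lt
  rw [S.mem_freeO]
  unfold OddGap
  constructor
  · rintro ⟨h | h, h7, h8, h9⟩
    · right
      omega
    · left
      omega
  · rintro (h | h)
    · exact ⟨Or.inr (by omega), by omega, by omega, by omega⟩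
    · exact ⟨Or.inl (by omega), by omega, by omega, by omega⟩

end Special

/-- Passing from `D` to `D ∪ {g}` in the exceptional case adds one free coefficient in total. -/
lemma card_free_add {s g α β : ℕ} (S₀ : Special u v s (g + 4) α β) (S₁ : Special u v (s + 1) g α β) :
    (freeL v g α β).card + (freeO u (s + 1) g α β).card =
      (freeL v (g + 4) α β).card + (freeO u s (g + 4) α β).card + 1 := by
  have h1 := S₀.odd_α
  have h2 := S₀.β_mod
  have h3 := S₁.a_mod
  have h4 := S₁.a_add
  have h5 := S₀.le_β
  have h6 := S₀.α_lt
  have h7 := S₀.a_lt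
  have hc0 := S₀.cases
  have hc1 := S₁.cases
  have hu := S₀.exponents.u_mod
  by_cases hαβ : α + (g + 4) ≤ β
  · have e1 : freeL v g α β = freeL v (g + 4) α β := by
      ext k
      rw [mem_freeL, mem_freeL]
      unfold Forced
      omega
    have e2 : freeO u (s + 1) g α β = insert (β - 4 * (s + 1)) (freeO u s (g + 4) α β) := by
      ext i
      rw [Finset.mem_insert, S₀.mem_freeO_iff, S₁.mem_freeO_iff]
      constructor
      · rintro (h | h)
        · by_cases hi : i = β - 4 * (s + 1)
          · exact Or.inl hi
          · exact Or.inr (Or.inl (by omega))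
        · exact Or.inr (Or.inr (by omega))
      · rintro (h | h | h)
        · exact Or.inl (by omega)
        · exact Or.inl (by omega)
        · exact Or.inr (by omega)
    have e3 : β - 4 * (s + 1) ∉ freeO u s (g + 4) α β := by
      rw [S₀.mem_freeO_iff]
      omega
    rw [e1, e2, Finset.card_insert_of_notMem e3]
    omega
  · have hc : v < α ∧ α % 4 = (v + 2) % 4 ∧ α ≤ v + g ∧ v + (g + 4) ≤ β := by omega
    have e1 : freeL v (g + 4) α β = insert (β - v - (g + 4)) (freeL v g α β) := by
      ext k
      rw [Finset.mem_insert, mem_freeL, mem_freeL]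
      unfold Forced
      omega
    have e2 : freeO u (s + 1) g α β =
        insert (β - 4 * (s + 1)) (insert (α - 4 * (s + 1)) (freeO u s (g + 4) α β)) := by
      ext i
      rw [Finset.mem_insert, Finset.mem_insert, S₀.mem_freeO_iff, S₁.mem_freeO_iff]
      constructor
      · rintro (h | h)
        · by_cases hi : i = β - 4 * (s + 1)
          · exact Or.inl hi
          · exact Or.inr (Or.inr (Or.inl (by omega)))
        · by_cases hi : i = α - 4 * (s + 1)
          · exact Or.inr (Or.inl hi)
          · exact Or.inr (Or.inr (Or.inr (by omega)))
      · rintro (h | h | h | h)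
        · exact Or.inl (by omega)
        · exact Or.inr (by omega)
        · exact Or.inl (by omega)
        · exact Or.inr (by omega)
    have e3 : α - 4 * (s + 1) ∉ freeO u s (g + 4) α β := by
      rw [S₀.mem_freeO_iff]
      omega
    have e4 : β - 4 * (s + 1) ∉ insert (α - 4 * (s + 1)) (freeO u s (g + 4) α β) := by
      rw [Finset.mem_insert, S₀.mem_freeO_iff]
      omega
    have e5 : β - v - (g + 4) ∉ freeL v g α β := by
      rw [mem_freeL]
      unfold Forced
      omega
    rw [e1, e2, Finset.card_insert_of_notMem e4, Finset.card_insert_of_notMem e3,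
      Finset.card_insert_of_notMem e5]
    omega

/-- In an exceptional step both normalised cells are affine spaces, and the dimension grows by one. -/
theorem IsStep.exists_isAffineCell_of_not_isFree {D : Set ℕ} {g : ℕ} (S : IsStep u v D g)
    (hf : ¬ IsFree u v D g) (hne : Nonempty (NormCell u v (D ∪ {g}))) :
    ∃ N, IsAffineCell (normAlg u v D) N ∧ IsAffineCell (normAlg u v (D ∪ {g})) (N + 1) := by
  have h2 := IsStep.mod_four_of_not_isFree hf
  obtain ⟨α, β, X⟩ := S.exists_exceptional hf hne
  have E := S.exponents
  have hu := E.u_mod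
  have hg := S.lt_two_mul (by omega)
  have hlt := fun d hd hd4 => X.lt_of_mem S h2 (d := d) hd hd4
  set n := smallestOdd u v D
  have x1 := X.odd_α
  have x2 := X.β_mod
  have x3 := X.le_α
  have x4 := X.α_lt_β
  have x5 := X.β_le
  have x6 := X.le_β
  have x7 := X.le_n
  have x8 := X.α_le_n
  have x9 := X.n_eq
  have x10 := X.α_mod
  have x11 := X.α_le
  obtain ⟨s, hs⟩ : ∃ s, g + 4 + 4 * s = 2 * u := ⟨(2 * u - g - 4) / 4, by omega⟩
  have S₀ : Special u v s (g + 4) α β := by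
    refine ⟨E, hs, x1, x2, by omega, x4, x5, by omega, ?_⟩
    by_cases hv : α ≤ v
    · exact Or.inl ⟨hv, by have := x8 hv; omega⟩
    · have hv' : v < α := by omega
      exact Or.inr ⟨hv', x10 hv', by have := x11 hv'; omega, by have := x9 hv'; omega⟩
  have S₁ : Special u v (s + 1) g α β := by
    refine ⟨E, by omega, x1, x2, by omega, x4, x5, by omega, ?_⟩
    by_cases hv : α ≤ v
    · exact Or.inl ⟨hv, by have := x8 hv; omega⟩
    · have hv' : v < α := by omega
      exact Or.inr ⟨hv', x10 hv', x11 hv', by have := x9 hv'; omega⟩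
  have hΔ₀ : ∀ k, k ∈ semigroup u v ∪ D ↔ k % 4 = 0 ∨ (k % 4 = 2 ∧ g + 4 ≤ k) ∨
      (k % 4 = α % 4 ∧ α ≤ k) ∨ (k % 4 = β % 4 ∧ β ≤ k) := by
    intro k
    rcases (by omega : k % 4 = 0 ∨ k % 4 = 2 ∨ k % 4 = α % 4 ∨ k % 4 = β % 4) with h | h | h | h
    · exact iff_of_true (Or.inl (E.mem_semigroup_of_four h)) (Or.inl h)
    · constructor
      · intro hk
        have := hlt k hk (by omega)
        omega
      · intro hk
        have := S.add_mem_of_pos (a := k - g) (E.mem_semigroup_of_four (by omega)) (by omega)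
        rwa [show g + (k - g) = k by omega] at this
    · rw [X.mem_α k h]; omega
    · rw [X.mem_β k h]; omega
  have hΔ₁ : ∀ k, k ∈ semigroup u v ∪ (D ∪ {g}) ↔ k % 4 = 0 ∨ (k % 4 = 2 ∧ g ≤ k) ∨
      (k % 4 = α % 4 ∧ α ≤ k) ∨ (k % 4 = β % 4 ∧ β ≤ k) := by
    intro k
    by_cases hk : k = g
    · exact iff_of_true (Or.inr (Or.inr hk)) (by omega)
    · rw [show k ∈ semigroup u v ∪ (D ∪ {g}) ↔ k ∈ semigroup u v ∪ D from
        ⟨fun h => S.mem_of_mem_union h hk, S.mem_union⟩, hΔ₀]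
      omega
  refine ⟨(freeL v (g + 4) α β).card + (freeO u s (g + 4) α β).card,
    S₀.isAffineCell hΔ₀ (fun _ => mem_freeL) (fun _ => S₀.mem_freeO), ?_⟩
  rw [← card_free_add S₀ S₁]
  exact S₁.isAffineCell hΔ₁ (fun _ => mem_freeL) (fun _ => S₁.mem_freeO)

/-! ### All cells are affine spaces -/

/-- The normalised cell of the empty set is the point `R`. -/
lemma normCell_empty (E : Exponents u v) (hne : Nonempty (NormCell u v ∅)) : IsAffineCell (normAlg u v ∅) 0 := by
  obtain ⟨M₀⟩ := hne
  -- A module containing `1` contains `R`, whose valuations are already all of `Γ`.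
  have huniq : ∀ M : NormCell u v ∅, (M.1 : Set ℂ⟦X⟧) = (R u v : Set ℂ⟦X⟧) := by
    intro M
    have h1 : (R u v).toSubmodule ≤ M.1.restrictScalars ℂ := fun r hr => mem_of_mem_R M.2.1 hr
    have hΓ : valuations ((R u v).toSubmodule : Set ℂ⟦X⟧) = semigroup u v := rfl
    have hc : tail (2 * delta u v) ≤ (R u v).toSubmodule := by
      obtain ⟨MR, hMR⟩ : ∃ MR : Submodule (R u v) ℂ⟦X⟧, MR.restrictScalars ℂ = (R u v).toSubmodule :=
        ⟨{ carrier := R u v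
           add_mem' := (R u v).add_mem
           zero_mem' := (R u v).zero_mem
           smul_mem' := fun r _ hf => (R u v).mul_mem r.2 hf }, rfl⟩
      rw [← hMR]
      refine tail_le_of_one_mem E ?_
      have : (1 : ℂ⟦X⟧) ∈ (R u v).toSubmodule := (R u v).one_mem
      rwa [← hMR] at this
    have h2 := eq_of_le_of_valuations hc h1 (by
      rw [hΓ, Submodule.coe_restrictScalars]
      exact (M.2.2.trans (Set.union_empty _)).le)
    exact (congrArg (fun N : Submodule ℂ ℂ⟦X⟧ => (N : Set ℂ⟦X⟧)) h2).symm
  have hsub : ∀ M : NormCell u v ∅, M = M₀ := fun M =>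
    Subtype.ext (SetLike.coe_injective ((huniq M).trans (huniq M₀).symm))
  refine isAffineCell_of_equiv (ι := Fin 0)
    ⟨fun _ => Fin.elim0, fun _ => M₀, fun M => (hsub M).symm, fun c => Subsingleton.elim _ _⟩
    (fun j => j.elim0) (fun f _ => ?_) rfl
  exact (polyFun (Fin 0)).algebraMap_mem (f M₀)

/-- A standard module contains a unit, and dividing by it gives a module containing `1`. -/
lemma nonempty_normCell (D : Set ℕ) {M : Submodule (R u v) ℂ⟦X⟧}
    (hv : valuations (M : Set ℂ⟦X⟧) = semigroup u v ∪ D) (h0 : IsStandard M) : Nonempty (NormCell u v D) := by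
  obtain ⟨p, hpM, hp⟩ := exists_unit_mem h0
  exact ⟨⟨scale p⁻¹ M, one_mem_scale_inv hpM hp, by rw [valuations_scale (inv_constantCoeff hp), hv]⟩⟩

/-- Every normalised cell is an affine space, by removing the least element of `D` repeatedly. -/
theorem exists_isAffineCell_normCell (E : Exponents u v) (n : ℕ) : ∀ D : Set ℕ, D.ncard = n → D ⊆ gaps u v →
    IsStandardGammaModule u v (semigroup u v ∪ D) → Nonempty (NormCell u v D) →
    ∃ N, IsAffineCell (normAlg u v D) N := by
  induction n with
  | zero =>
    intro D hn hD _ hne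
    obtain rfl : D = ∅ := (Set.ncard_eq_zero (E.gaps_finite.subset hD)).mp hn
    exact ⟨0, normCell_empty E hne⟩
  | succ n ih =>
    intro D hn hD hΔ hne
    have hDne : D.Nonempty := by
      rw [Set.nonempty_iff_ne_empty]
      rintro rfl
      simp at hn
    have hg := Nat.sInf_mem hDne
    set g := sInf D
    have hg0 : g ∈ gaps u v \ (D \ {g}) := ⟨hD hg, fun h => h.2 rfl⟩
    have hgD : ∀ d ∈ D \ {g}, g < d := fun d hd =>
      lt_of_le_of_ne (Nat.sInf_le hd.1) fun h => hd.2 h.symm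
    have hD' : D = (D \ {g}) ∪ {g} := (Set.sdiff_union_of_subset (Set.singleton_subset_iff.mpr hg)).symm
    have hΔ' : IsStandardGammaModule u v (semigroup u v ∪ (D \ {g})) := by
      refine ⟨Or.inl E.zero_mem_semigroup, fun a ha b hb => ?_⟩
      rcases hb with hb | hb
      · exact Or.inl (add_mem_semigroup ha hb)
      · refine (hΔ.2 a ha b (Or.inr hb.1)).imp_right fun h => ⟨h, fun h' => ?_⟩
        have h1 : a + b = g := h'
        have := hgD b hb
        omega
    rw [hD'] at hne hΔ
    obtain ⟨N, hN⟩ := ih (D \ {g}) (by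
      rw [Set.ncard_sdiff_singleton_of_mem hg, hn]; rfl) (Set.sdiff_subset.trans hD) hΔ'
      (hne.map (smaller hg0 hgD))
    have S : IsStep u v (D \ {g}) g := ⟨E, Set.sdiff_subset.trans hD, hg0, hΔ', hΔ⟩
    rw [hD']
    by_cases hf : IsFree u v (D \ {g}) g
    · obtain ⟨K, hK⟩ := S.exists_finset
      exact ⟨_, normCell_step E hg0 hgD hK (S.add_mem_of_pos (E.mem_semigroup_of_four rfl) (by omega))
        (fun M f h1 h2 h3 => S.free_of_isFree hf M.2.2 h1 h2 h3) hN⟩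
    · obtain ⟨N, -, hN⟩ := S.exists_isAffineCell_of_not_isFree hf hne
      exact ⟨_, hN⟩

lemma IsDFlag.isStep (E : Exponents u v) {m : ℕ} {D : Set ℕ} {g : Fin (m + 1) → ℕ} (hD : IsDFlag u v D g) :
    IsStep u v (dset D (fun j => g j.castSucc) (Fin.last m)) (g (Fin.last m)) where
  exponents := E
  subset_gaps := dset_subset_gaps hD.init _
  mem_gaps := ⟨(hD.mem_gaps _).1, fun h => hD.last_notMem (Or.inr h)⟩
  isModule := hD.init.isModule _
  isModule' := by rw [← dset_last]; exact hD.isModule _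

lemma dim_of_isAffineCell (E : Exponents u v) {m : ℕ} {D : Set ℕ} {g : Fin m → ℕ} (hD : IsDFlag u v D g) {N : ℕ}
    (h : IsAffineCell (flagAlg u v D g) N) : (flagCellVariety u v D g).dim = N := by
  rw [(isomorphic_of_isAffineCell E hD h).dim_eq, dim_affineSpace]

/-- The flagged cell of a single exceptional step has dimension one more than the cell of the smaller set. -/
lemma IsStep.exists_isAffineCell_flagCell_of_not_isFree {D : Set ℕ} {g d₀ : ℕ} (S : IsStep u v D g)
    (hf : ¬ IsFree u v D g) (hne : Nonempty (NormCell u v (D ∪ {g}))) (hD : IsDFlag u v D ![g])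
    (hd₀ : IsAffineCell (flagAlg u v D (![] : Fin 0 → ℕ)) d₀) :
    ∃ N : ℕ, IsAffineCell (flagAlg u v D ![g]) N ∧ (N : ℤ) = (d₀ : ℤ) + mu u v D g := by
  have E := S.exponents
  have h2 := IsStep.mod_four_of_not_isFree hf
  obtain ⟨α, β, X⟩ := S.exists_exceptional hf hne
  obtain ⟨N, hN₀, hN₁⟩ := S.exists_isAffineCell_of_not_isFree hf hne
  obtain ⟨G, hG⟩ := exists_finset_compl E D
  have hD0 : IsDFlag u v D (![] : Fin 0 → ℕ) := isDFlag_empty S.subset_gaps S.isModule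
  have hc0 := flagCell_empty_of_normCell E hD0 hG hN₀
  have hc1 := flagCell_singleton_of_normCell E hD (fun d hd => X.lt_of_mem S h2 (Or.inr hd) fun h =>
    hD.subset_gaps hd (E.mem_semigroup_of_four h)) hG hN₁
  have hdim : d₀ = N + G.card := by
    have := (dim_of_isAffineCell E hD0 hd₀).symm.trans (dim_of_isAffineCell E hD0 hc0)
    exact_mod_cast this
  refine ⟨_, hc1, ?_⟩
  rw [X.mu_eq S h2, hdim]
  push_cast
  ring

/-- All flagged cells are affine spaces, of the expected dimension. The exceptional step can only be the
first one of a flag, since all gaps in `D` are then greater than `g`. -/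
theorem exists_isAffineCell_flagCell (E : Exponents u v) {D : Set ℕ} {d₀ : ℕ}
    (hd₀ : IsAffineCell (flagAlg u v D (![] : Fin 0 → ℕ)) d₀) (m : ℕ) : ∀ g : Fin m → ℕ, IsDFlag u v D g →
    (∀ i, Nonempty (NormCell u v (dset D g i))) →
    ∃ N : ℕ, IsAffineCell (flagAlg u v D g) N ∧
      (N : ℤ) = (d₀ : ℤ) + ∑ i : Fin m, mu u v (dset D g i.castSucc) (g i) := by
  induction m with
  | zero =>
    intro g _ _
    obtain rfl : g = ![] := Subsingleton.elim _ _
    exact ⟨d₀, hd₀, by simp⟩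
  | succ m ih =>
    intro g hD hne
    obtain ⟨N, hN, hNeq⟩ := ih (fun j => g j.castSucc) hD.init fun i => by
      rw [← dset_castSucc]; exact hne _
    have S := hD.isStep E
    have hsum : ∑ i : Fin (m + 1), mu u v (dset D g i.castSucc) (g i) =
        ∑ i : Fin m, mu u v (dset D (fun j => g j.castSucc) i.castSucc) (g i.castSucc) +
          mu u v (dset D (fun j => g j.castSucc) (Fin.last m)) (g (Fin.last m)) := by
      rw [Fin.sum_univ_castSucc]
      simp only [dset_castSucc]
    by_cases hf : IsFree u v (dset D (fun j => g j.castSucc) (Fin.last m)) (g (Fin.last m))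
    · obtain ⟨K, hK⟩ := S.exists_finset
      refine ⟨N + K.card, flagCell_step E hD hK (fun M hv f h1 h2 h3 => S.free_of_isFree hf hv h1 h2 h3) hN, ?_⟩
      rw [hsum, S.mu_of_isFree hf hK]
      push_cast
      linarith
    · have hne' : Nonempty (NormCell u v (dset D (fun j => g j.castSucc) (Fin.last m) ∪ {g (Fin.last m)})) := by
        rw [← dset_last]; exact hne _
      have h2 := IsStep.mod_four_of_not_isFree hf
      obtain ⟨α, β, X⟩ := S.exists_exceptional hf hne'
      have hlt := fun d hd hd4 => X.lt_of_mem S h2 (d := d) hd hd4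
      obtain rfl : m = 0 := by
        by_contra hm
        obtain ⟨m', rfl⟩ := Nat.exists_eq_succ_of_ne_zero hm
        have h3 := hlt (g (Fin.last m').castSucc) (Or.inr (Or.inr ⟨Fin.last m', Fin.castSucc_lt_last _, rfl⟩))
          fun h => (hD.mem_gaps _).1 (E.mem_semigroup_of_four h)
        exact absurd (hD.strictMono (Fin.castSucc_lt_last (Fin.last m'))) h3.not_gt
      obtain ⟨g, rfl⟩ : ∃ g' : ℕ, g = ![g'] :=
        ⟨g 0, by funext i; rw [Subsingleton.elim (α := Fin 1) i 0]; rfl⟩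
      have hDe : dset D (fun j : Fin 0 => (![g] : Fin 1 → ℕ) j.castSucc) (Fin.last 0) = D := dset_zero _
      have hge : (![g] : Fin 1 → ℕ) (Fin.last 0) = g := rfl
      rw [hsum]
      rw [hDe, hge] at S hf hne' ⊢
      simpa using S.exists_isAffineCell_flagCell_of_not_isFree hf hne' hD hd₀

/-- The flagged cell is an affine space of the expected dimension as soon as all cells of its members are
nonempty; nonemptiness of the flagged cell itself is not needed. -/
theorem exists_isomorphic_affineSpace (E : Exponents u v) {D : Set ℕ} {m : ℕ} {g : Fin m → ℕ}
    (hD : IsDFlag u v D g) (hne : ∀ i, Nonempty (NormCell u v (dset D g i))) :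
    ∃ N d₀ : ℕ, (cellVariety u v D).dim = (d₀ : WithBot ℕ∞) ∧
      (N : ℤ) = (d₀ : ℤ) + ∑ i : Fin m, mu u v (dset D g i.castSucc) (g i) ∧
      (flagCellVariety u v D g).Isomorphic (affineSpace N) := by
  have hΔ : IsStandardGammaModule u v (semigroup u v ∪ D) := by
    have := hD.isModule 0
    rwa [dset_zero] at this
  have hne0 : Nonempty (NormCell u v D) := by
    have := hne 0
    rwa [dset_zero] at this
  have hD0 : IsDFlag u v D (![] : Fin 0 → ℕ) := isDFlag_empty hD.subset_gaps hΔ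
  obtain ⟨N₀, hN₀⟩ := exists_isAffineCell_normCell E _ D rfl hD.subset_gaps hΔ hne0
  obtain ⟨G, hG⟩ := exists_finset_compl E D
  have hd₀ := flagCell_empty_of_normCell E hD0 hG hN₀
  obtain ⟨N, hN, hNeq⟩ := exists_isAffineCell_flagCell E hd₀ m g hD hne
  exact ⟨N, _, dim_of_isAffineCell E hD0 hd₀, hNeq, isomorphic_of_isAffineCell E hD hN⟩

lemma IsAdmissibleSet.spec (E : Exponents u v) {D : Set ℕ} (h : IsAdmissibleSet u v D) :
    D ⊆ gaps u v ∧ IsStandardGammaModule u v (semigroup u v ∪ D) ∧ Nonempty (NormCell u v D) := by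
  obtain ⟨M, hM, rfl⟩ := h
  have hD : addedGaps M ⊆ gaps u v := Set.inter_subset_left
  have hv := (isStandard_iff_valuations E hD).mp ⟨hM, rfl⟩
  refine ⟨hD, ?_, nonempty_normCell _ hv hM⟩
  rw [← hv]
  exact ⟨hM, fun a ha b hb => add_mem_valuations ha hb⟩

lemma isDFlag_singleton {D : Set ℕ} {g : ℕ} (hD : D ⊆ gaps u v) (hg : g ∈ gaps u v \ D)
    (hΔ : IsStandardGammaModule u v (semigroup u v ∪ D))
    (hΔ' : IsStandardGammaModule u v (semigroup u v ∪ (D ∪ {g}))) : IsDFlag u v D ![g] where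
  subset_gaps := hD
  strictMono := Subsingleton.strictMono _
  mem_gaps := fun j => by rw [Subsingleton.elim j 0]; exact hg
  isModule := fun i => by
    fin_cases i
    · rw [show (⟨0, _⟩ : Fin 2) = 0 from rfl, dset_zero]; exact hΔ
    · rw [show (⟨1, _⟩ : Fin 2) = 1 from rfl, dset_singleton_one]; exact hΔ'

end FlaggedJacobian

end

open FlaggedJacobian

theorem theorem3p1 (u v : ℕ) (hu : Odd u) (hv : Odd v) (huv : 2 * u < v) :
    (∀ (m : ℕ) (D : Set ℕ) (g : Fin m → ℕ), IsAdmissible u v D g →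
      ∃ N d₀ : ℕ,
        (cellVariety u v D).dim = (d₀ : WithBot ℕ∞) ∧
        (N : ℤ) = (d₀ : ℤ) + ∑ i : Fin m, mu u v (dset D g i.castSucc) (g i) ∧
        (flagCellVariety u v D g).Isomorphic (affineSpace N)) ∧
    (∀ (D : Set ℕ) (g : ℕ), IsAdmissibleSet u v D → g ∈ gaps u v \ D →
      IsAdmissibleSet u v (D ∪ {g}) →
      ∃ d d₁ : ℕ,
        (cellVariety u v D).dim = (d : WithBot ℕ∞) ∧
        (flagCellVariety u v D ![g]).dim = (d₁ : WithBot ℕ∞) ∧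
        (d₁ : ℤ) - (d : ℤ) = mu u v D g) := by
  have E : Exponents u v := ⟨hu, hv, huv⟩
  refine ⟨fun m D g h => ?_, fun D g hD hg hD' => ?_⟩
  · obtain ⟨hflag, ⟨F⟩⟩ := h
    exact exists_isomorphic_affineSpace E hflag fun i =>
      nonempty_normCell _ (valuations_flagCell E hflag F i) (F.2.2 i).1
  · obtain ⟨h1, h2, h3⟩ := hD.spec E
    obtain ⟨-, h2', h3'⟩ := hD'.spec E
    obtain ⟨N, d₀, hd₀, hN, hiso⟩ := exists_isomorphic_affineSpace E (isDFlag_singleton h1 hg h2 h2') fun i => by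
      fin_cases i
      · rw [show (⟨0, _⟩ : Fin 2) = 0 from rfl, dset_zero]; exact h3
      · rw [show (⟨1, _⟩ : Fin 2) = 1 from rfl, dset_singleton_one]; exact h3'
    refine ⟨d₀, N, hd₀, by rw [hiso.dim_eq, dim_affineSpace], ?_⟩
    rw [hN]
    simp only [Fin.sum_univ_one, Fin.castSucc_zero, dset_zero]
    simp
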